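/- Let $\Omega\subset\mathbb R^3$ be a bounded open set with $\operatorname{int}\overline\Omega=\Omega$ (for instance a bounded Lipschitz polyhedron), and let $\partial\Omega=\Gamma\cup\Sigma$, where the interiors of $\Gamma$ and $\Sigma$ relative to $\partial\Omega$ are disjoint. Let $\mathcal W:=\{\tau\in H(\mathrm{div};\Omega):\ \tau n=0 \text{ on }\Sigma\}$, where $H(\mathrm{div};\Omega)$ consists of the $\tau\in L^2(\Omega)^{3\times3}$ with row-wise weak divergence $\operatorname{div}\tau\in L^2(\Omega)^3$, with $\|\tau\|_{H(\mathrm{div})}^2=\|\tau\|_{0,\Omega}^2+\|\operatorname{div}\tau\|_{0,\Omega}^2$. The condition $\tau n=0$ on $\Sigma$ is understood weakly: $\int_\Omega(\operatorname{div}\tau\cdot\varphi+\tau:\nabla\varphi)=0$ for all $\varphi\in C_c^\infty(\mathbb R^3)^3$ with $\operatorname{supp}\varphi\cap\partial\Omega\subset\Sigma$. Let $\mathcal T_h$ be a finite conforming mesh of $\overline\Omega$ into closed nondegenerate tetrahedra (two different tetrahedra meet in a common vertex, edge or face, or not at all) such that each of $\Gamma$ and $\Sigma$ is a union of faces of the mesh.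 Let $\mathcal F_h^0$ be the set of interior faces (those of the form $F=K\cap K'$ with $K\ne K'$ in $\mathcal T_h$), and let $\mathcal F_h^\Gamma$, $\mathcal F_h^\Sigma$ be the sets of boundary faces contained in $\Gamma$ and in $\Sigma$. Put $\mathcal F_h^*=\mathcal F_h^0\cup\mathcal F_h^\Sigma$. Let $n_K$ be the outward unit normal of $K$, $n_F$ a unit normal of $F$, and $h_F$ the diameter of $F$. Fix $k\ge1$, and let $\mathcal W_h=\mathcal P_k(\mathcal T_h)^{3\times3}$ be the space of discontinuous piecewise polynomial tensors of degree at most $k$, and $\mathcal W_h^c=\mathcal W_h\cap\mathcal W$. For $\tau\in\mathcal W_h$ with restrictions $\tau_K$ let $\operatorname{div}_h\tau$ be its elementwise divergence. On an interior face $F=K\cap K'$ put $[\![\tau]\!]_F=\tau_Kn_K+\tau_{K'}n_{K'}$ and $\{\tau\}_F=\frac12(\tau_K+\tau_{K'})$, and on a boundary face of $K$ put $[\![\tau]\!]_F=\tau_Kn_K$. Let $$\|h_{\mathcal F}^{-1/2}[\![\tau]\!]\|_{0,\mathcal F_h^*}^2=\sum_{F\in\mathcal F_h^*}h_F^{-1}\int_F|[\![\tau]\!]_F|^2,\qquad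 \|\tau\|_{\mathcal W(h)}^2=\|\operatorname{div}_h\tau\|_{0,\Omega}^2+\|h_{\mathcal F}^{-1/2}[\![\tau]\!]\|_{0,\mathcal F_h^*}^2+\|\tau\|_{0,\Omega}^2 .$$ For $m\ge1$ let $\mathcal N_m(K)$ be the space of fields $w$ with $w\circ A=B^{-\mathsf t}\check w$ and $\check w\in\mathcal P_{m-1}^3\oplus\{s\in\tilde{\mathcal P}_m^3:\ s(x)\cdot x=0\}$, where $\tilde{\mathcal P}_m$ denotes the homogeneous polynomials of degree $m$ and $A$ is an affine bijection with linear part $B$ that maps the reference tetrahedron (with vertices $0,e_1,e_2,e_3$) onto $K$. Then every $\tau\in\mathcal W_h$ has exactly one averaging projection $\mathcal P_h\tau\in\mathcal W_h^c$, characterized by $$\int_F(\mathcal P_h\tau)n_F\cdot\phi=\int_F\tau n_F\cdot\phi\ \ (F\in\mathcal F_h^\Gamma),\qquad \int_F(\mathcal P_h\tau)n_F\cdot\phi=0\ \ (F\in\mathcal F_h^\Sigma),\qquad \int_F(\mathcal P_h\tau)n_F\cdot\phi=\int_F\{\tau\}_Fn_F\cdot\phi\ \ (F\in\mathcal F_h^0)$$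 for all $\phi\in\mathcal P_k(F)^3$ and, if $k\ge2$, by $\int_K\mathcal P_h\tau:W=\int_K\tau:W$ for all $K\in\mathcal T_h$ and all $W$ with rows in $\mathcal N_{k-1}(K)$. Moreover, for every $\rho$ there are constants $\underline C,\overline C>0$, depending only on $\Omega,\Gamma,\Sigma,k,\rho$ (in particular not on $h$), such that for every such mesh that is shape regular with constant $\rho$ (each tetrahedron contains a ball such that the diameter of the tetrahedron is at most $\rho$ times that of the ball) and for all $\tau\in\mathcal W_h$, $$\underline C\,\|\tau\|_{\mathcal W(h)}\le\Big(\|\mathcal P_h\tau\|_{H(\mathrm{div})}^2+\|h_{\mathcal F}^{-1/2}[\![\tau]\!]\|_{0,\mathcal F_h^*}^2\Big)^{1/2}\le\overline C\,\|\tau\|_{\mathcal W(h)} .$$ -/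

import Mathlib

open MeasureTheory
open scoped ContDiff

noncomputable section

namespace DGElasticity

/-- Physical space. -/
abbrev E : Type := EuclideanSpace ℝ (Fin 3)

/-- Three by three real matrices. -/
abbrev Mat : Type := Matrix (Fin 3) (Fin 3) ℝ

/-- Real polynomials in the three space variables. -/
abbrev Poly : Type := MvPolynomial (Fin 3) ℝ

/-- The value of a polynomial at a point of space. -/
def peval (x : E) (p : Poly) : ℝ := MvPolynomial.eval (fun i => x i) p

/-- The partial derivative of a function on space in the direction of the `j`-th axis. -/
def partialDeriv (j : Fin 3) (φ : E → ℝ) (x : E) : ℝ :=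
  fderiv ℝ φ x (EuclideanSpace.single j 1)

/-- The squared Frobenius norm of a matrix. -/
def frobSq (A : Mat) : ℝ := ∑ i, ∑ j, A i j ^ 2

/-- The squared Euclidean norm of a coordinate vector. -/
def vecSq (v : Fin 3 → ℝ) : ℝ := ∑ i, v i ^ 2

/-! ### The space `H(div; Ω)` of tensor fields with row-wise divergence -/

/-- `g ∈ L²(Ω)³` is the weak row-wise divergence in `Ω` of the tensor field `τ`. -/
def HasWeakDiv (Ω : Set E) (τ : E → Mat) (g : E → Fin 3 → ℝ) : Prop :=
  (∀ i, MemLp (fun x => g x i) 2 (volume.restrict Ω)) ∧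
  ∀ (i : Fin 3) (φ : E → ℝ), ContDiff ℝ ∞ φ → HasCompactSupport φ → tsupport φ ⊆ Ω →
    ∫ x in Ω, g x i * φ x = - ∫ x in Ω, ∑ j, τ x i j * partialDeriv j φ x

open Classical in
/-- The weak row-wise divergence (unique almost everywhere in `Ω`); zero if there is none. -/
def weakDiv (Ω : Set E) (τ : E → Mat) : E → Fin 3 → ℝ :=
  if h : ∃ g, HasWeakDiv Ω τ g then h.choose else 0

/-- The space `H(div; Ω)`: square integrable tensor fields whose weak row-wise divergence
exists and is square integrable. -/
def Hdiv (Ω : Set E) : Set (E → Mat) :=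
  {τ | (∀ i j, MemLp (fun x => τ x i j) 2 (volume.restrict Ω)) ∧ ∃ g, HasWeakDiv Ω τ g}

/-- The squared norm of `H(div; Ω)`. -/
def hdivNormSq (Ω : Set E) (τ : E → Mat) : ℝ :=
  (∫ x in Ω, frobSq (τ x)) + ∫ x in Ω, vecSq (weakDiv Ω τ x)

/-- `τ n = 0` on the part `S` of the boundary, in the weak sense: the functional
`φ ↦ ∫_Ω (div τ · φ + τ : ∇φ)`, that is, the normal trace of `τ`, vanishes on the
test functions whose support meets the boundary inside `S` only. -/
def ZeroNormalTraceOn (Ω S : Set E) (τ : E → Mat) : Prop :=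
  ∀ (i : Fin 3) (φ : E → ℝ), ContDiff ℝ ∞ φ → HasCompactSupport φ →
    tsupport φ ∩ frontier Ω ⊆ S →
    ∫ x in Ω, (weakDiv Ω τ x i * φ x + ∑ j, τ x i j * partialDeriv j φ x) = 0

/-- The space `W` of the fields in `H(div; Ω)` with `τ n = 0` on `S`. -/
def spaceW (Ω S : Set E) : Set (E → Mat) :=
  {τ | τ ∈ Hdiv Ω ∧ ZeroNormalTraceOn Ω S τ}

/-! ### Tetrahedral meshes -/

/-- The closed simplex with the given vertices. -/
def hull (K : Finset E) : Set E := convexHull ℝ (K : Set E)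

/-- A (conforming) finite mesh of `closure Ω` into nondegenerate closed tetrahedra, each given
by its four vertices: two tetrahedra meet at most in the simplex spanned by their common
vertices. -/
structure TetMesh (Ω : Set E) where
  elements : Finset (Finset E)
  card_eq : ∀ K ∈ elements, K.card = 4
  indep : ∀ K ∈ elements, AffineIndependent ℝ ((↑) : K → E)
  cover : ⋃ K ∈ elements, hull K = closure Ω
  conforming : ∀ K ∈ elements, ∀ K' ∈ elements,
    hull K ∩ hull K' ⊆ convexHull ℝ ((K : Set E) ∩ (K' : Set E))

/-- The outward unit normal of the tetrahedron `K` on its face `F`: the normalized component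
orthogonal to `F` of the vector from the barycentre of `K` to the barycentre of `F`. -/
def outwardNormal (K F : Finset E) : E :=
  let w : E := ((vectorSpan ℝ (F : Set E))ᗮ).starProjection
    (F.centroid ℝ (id : E → E) - K.centroid ℝ (id : E → E))
  ‖w‖⁻¹ • w

/-- The reference tetrahedron with vertices at the origin and at the three unit vectors. -/
def refTet : Set E :=
  convexHull ℝ (insert 0 (Set.range fun i : Fin 3 => EuclideanSpace.single i (1 : ℝ)))

/-- The Nédélec space of order `m ≥ 1` on the tetrahedron `K`: the fields `w` with
`w ∘ A = B⁻ᵀ (p + s)`, where `A` is an affine map of the reference tetrahedron onto `K`, `B` is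
its linear part, `p` has components of degree at most `m - 1`, and `s` has components that are
homogeneous of degree `m` and satisfies `s(x) · x = 0`. -/
def nedelec (m : ℕ) (K : Finset E) : Set (E → E) :=
  {w | ∃ A : E ≃ᵃ[ℝ] E, A '' refTet = hull K ∧
    ∃ p s : Fin 3 → Poly, (∀ i, (p i).totalDegree < m) ∧ (∀ i, (s i).IsHomogeneous m) ∧
      ∑ i, MvPolynomial.X i * s i = 0 ∧
      ∀ x, w (A x) = LinearMap.adjoint (A.linear.symm : E →ₗ[ℝ] E)
        (WithLp.toLp 2 fun i => peval x (p i + s i))}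

namespace TetMesh

variable {Ω : Set E} (T : TetMesh Ω)

/-- Shape regularity with constant `ρ`: the diameter of every tetrahedron is at most `ρ` times
the diameter of some ball inscribed in it. -/
def ShapeRegular (ρ : ℝ) : Prop :=
  ∀ K ∈ T.elements, ∃ (x : E) (r : ℝ), 0 < r ∧ Metric.closedBall x r ⊆ hull K ∧
    Metric.diam (hull K) ≤ ρ * (2 * r)

open Classical in
/-- All triangles that are faces of a tetrahedron of the mesh, given by their vertices. -/
def faces : Finset (Finset E) := T.elements.biUnion fun K => K.powersetCard 3

open Classical in
/-- The faces that are the intersection of two different tetrahedra. -/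
def interiorFaces : Finset (Finset E) :=
  T.faces.filter fun F => ∃ K ∈ T.elements, ∃ K' ∈ T.elements, K ≠ K' ∧ hull F = hull K ∩ hull K'

open Classical in
/-- The faces that lie on the boundary. -/
def boundaryFaces : Finset (Finset E) := T.faces.filter fun F => hull F ⊆ frontier Ω

open Classical in
/-- The boundary faces that lie on the part `S` of the boundary. -/
def boundaryFacesIn (S : Set E) : Finset (Finset E) := T.boundaryFaces.filter fun F => hull F ⊆ S

/-- The part `S` of the boundary is a union of faces of the mesh. -/
def CompatibleWith (S : Set E) : Prop := ⋃ F ∈ T.boundaryFacesIn S, hull F = S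

open Classical in
/-- The interior faces together with the faces on `S`. -/
def starFaces (S : Set E) : Finset (Finset E) := T.interiorFaces ∪ T.boundaryFacesIn S

/-- Families, indexed by the tetrahedra of the mesh, of matrices of polynomials. -/
abbrev BrokenTensor : Type := T.elements → Matrix (Fin 3) (Fin 3) Poly

/-- The space `P_k(T_h)` of discontinuous piecewise polynomial tensors of degree at most `k`. -/
def spaceWh (k : ℕ) : Set T.BrokenTensor := {τ | ∀ K i j, (τ K i j).totalDegree ≤ k}

/-- The function given on the interior of each tetrahedron `K` by `f K`, and zero on the null set
outside these interiors. -/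
def glue {V : Type*} [AddCommMonoid V] (f : T.elements → E → V) (x : E) : V :=
  ∑ K : T.elements, (interior (hull K.1)).indicator (f K) x

variable {T}

/-- The value at `x` of the polynomial matrix of `τ` on the tetrahedron `K`. -/
def val (τ : T.BrokenTensor) (K : T.elements) (x : E) : Mat := (τ K).map (peval x)

/-- The tensor field on `Ω` (up to a null set) that corresponds to `τ`. -/
def toField (τ : T.BrokenTensor) : E → Mat := T.glue (val τ)

/-- The elementwise row-wise divergence of `τ`. -/
def brokenDiv (τ : T.BrokenTensor) : E → Fin 3 → ℝ :=
  T.glue fun K x i => ∑ j, peval x (MvPolynomial.pderiv j (τ K i j))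

open Classical in
/-- The jump of `τ` on a face `F`: the sum of `τ_K n_K` over the (two, or on the boundary one)
tetrahedra `K` with face `F`. -/
def jump (τ : T.BrokenTensor) (F : Finset E) (x : E) : Fin 3 → ℝ :=
  ∑ K : T.elements with F ⊆ K.1, Matrix.mulVec (val τ K x) (fun i => outwardNormal K.1 F i)

open Classical in
/-- The average of `τ` on a face `F`, over the (two, or on the boundary one) tetrahedra with
face `F`. -/
def mean (τ : T.BrokenTensor) (F : Finset E) (x : E) : Mat :=
  (((Finset.univ : Finset T.elements).filter fun K => F ⊆ K.1).card : ℝ)⁻¹ •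
    ∑ K : T.elements with F ⊆ K.1, val τ K x

/-- The integral over the face `F` of `A n · φ`, with respect to surface measure, where `n` is
the unit normal of `F` that is outward for `K`. -/
def faceMoment (K F : Finset E) (A : E → Mat) (φ : Fin 3 → Poly) : ℝ :=
  ∫ x in hull F, ∑ i, Matrix.mulVec (A x) (fun j => outwardNormal K F j) i * peval x (φ i)
    ∂(Measure.euclideanHausdorffMeasure 2)

/-- The square of the norm of `h^{-1/2} ⟦τ⟧` on the interior faces and the faces on `S`, where
`h` is on each face its diameter. -/
def jumpNormSq (S : Set E) (τ : T.BrokenTensor) : ℝ :=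
  ∑ F ∈ T.starFaces S, ∫ x in hull F, (Metric.diam (hull F))⁻¹ * vecSq (jump τ F x)
    ∂(Measure.euclideanHausdorffMeasure 2)

/-- The DG norm `‖τ‖_{W(h)}` of a piecewise polynomial tensor. -/
def dgNorm (S : Set E) (τ : T.BrokenTensor) : ℝ :=
  √((∫ x in Ω, vecSq (brokenDiv τ x)) + jumpNormSq S τ + ∫ x in Ω, frobSq (toField τ x))

variable (T) in
/-- The conforming Brezzi-Douglas-Marini space `P_k(T_h) ∩ W`. -/
def spaceWhc (S : Set E) (k : ℕ) : Set T.BrokenTensor :=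
  {τ | τ ∈ T.spaceWh k ∧ toField τ ∈ spaceW Ω S}

/-- `σ` is the averaging projection `P_h τ` of `τ`: it lies in the conforming space of degree
`k`, its normal moments are those of `τ` on the faces on `Γ`, zero on the faces on `S`, and those
of the average of `τ` on the interior faces, and its interior moments are those of `τ`. Face
moments are prescribed from every tetrahedron that has the face, so with both orientations of the
normal of an interior face. There are no interior moments for `k = 1`. -/
structure IsAveragingProjection (Γ S : Set E) (k : ℕ) (τ σ : T.BrokenTensor) : Prop where
  mem : σ ∈ T.spaceWhc S k
  on_Γ : ∀ F ∈ T.boundaryFacesIn Γ, ∀ K : T.elements, F ⊆ K.1 →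
    ∀ φ : Fin 3 → Poly, (∀ i, (φ i).totalDegree ≤ k) →
      faceMoment K.1 F (val σ K) φ = faceMoment K.1 F (val τ K) φ
  on_S : ∀ F ∈ T.boundaryFacesIn S, ∀ K : T.elements, F ⊆ K.1 →
    ∀ φ : Fin 3 → Poly, (∀ i, (φ i).totalDegree ≤ k) →
      faceMoment K.1 F (val σ K) φ = 0
  on_interior : ∀ F ∈ T.interiorFaces, ∀ K : T.elements, F ⊆ K.1 →
    ∀ φ : Fin 3 → Poly, (∀ i, (φ i).totalDegree ≤ k) →
      faceMoment K.1 F (val σ K) φ = faceMoment K.1 F (mean τ F) φ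
  on_element : 2 ≤ k → ∀ (K : T.elements) (w : Fin 3 → E → E),
    (∀ i, w i ∈ nedelec (k - 1) K.1) →
      ∫ x in hull K.1, ∑ i, ∑ j, val σ K x i j * w i x j =
        ∫ x in hull K.1, ∑ i, ∑ j, val τ K x i j * w i x j

end TetMesh

end DGElasticity

end

/-!
The averaging projection is computed tetrahedron by tetrahedron and row by row. On a tetrahedron, a
vector field of degree `k` is determined by its normal components on the four faces and by its
moments against the Nédélec space of order `k - 1`, and these can be prescribed arbitrarily
(`eq_of_normal_eq`, `exists_interpolant`). On the reference tetrahedron this is seen as follows. A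
field `q` with zero data is divergence free, as seen by testing with `∇ div q`; its `j`-th component
vanishes on the plane `x_j = 0`, so that `q_j = x_j ψ_j`; since `ψ` is the sum of a gradient and of
a Nédélec field, `∫ q · ψ = ∫ ∑ x_j ψ_j² = 0` and `q = 0`. Conversely, the interior moments are
prescribed by the bubble fields `x_i (w_i - x · w)`, whose pairing with `w` is positive definite,
and the normal components by an explicit formula in barycentric coordinates. The contravariant transport
`push` carries this over to any tetrahedron.

Since a polynomial on a face that is orthogonal to itself vanishes, the moments on the faces
prescribe the normal components of the projection pointwise: zero on the faces on `S`, and those of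
the average of `τ` on the other ones. In a conforming mesh a face belongs either to one tetrahedron
and lies on the boundary, or to two tetrahedra with opposite normals (`TetMesh.face_cases`).
Therefore the normal components of the interpolant match across the interior faces, and integration
by parts on each tetrahedron shows that it lies in `H(div; Ω)` with its elementwise divergence and
has zero normal trace on `S` (`TetMesh.toField_mem_spaceW`). The conditions thus reduce to
independent ones on the tetrahedra (`TetMesh.isAveragingProjection_iff`).

For the equivalence of norms, the difference between `τ` and its projection has no interior moments,
and its normal components on the faces are half the jump of `τ`, the jump, or zero. By unisolvence,
compactness on the reference tetrahedron and scaling, such a field and its divergence are bounded in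
`L²` by the normal components (`exists_bound`); shape regularity turns the reciprocal heights in
this bound into reciprocal face diameters. Hence the distance between `τ` and its projection in the
broken norm is bounded by the jumps of `τ` (`TetMesh.exists_brokenNormSq_sub_le`), and both inequalities
follow from the triangle inequality.
-/

namespace DGElasticity

/-! ### Polynomials as functions on space -/

@[simp] lemma peval_add (x : E) (p q : Poly) : peval x (p + q) = peval x p + peval x q := by
  simp [peval]

@[simp] lemma peval_sub (x : E) (p q : Poly) : peval x (p - q) = peval x p - peval x q := by
  simp [peval]

@[simp] lemma peval_mul (x : E) (p q : Poly) : peval x (p * q) = peval x p * peval x q := by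
  simp [peval]

@[simp] lemma peval_zero (x : E) : peval x 0 = 0 := by simp [peval]

@[simp] lemma peval_one (x : E) : peval x 1 = 1 := by simp [peval]

@[simp] lemma peval_C (x : E) (c : ℝ) : peval x (MvPolynomial.C c) = c := by simp [peval]

@[simp] lemma peval_X (x : E) (i : Fin 3) : peval x (MvPolynomial.X i) = x i := by simp [peval]

@[simp] lemma peval_smul (x : E) (c : ℝ) (p : Poly) : peval x (c • p) = c * peval x p := by
  simp [peval, MvPolynomial.smul_eval]

@[simp] lemma peval_sum {ι : Type*} (x : E) (s : Finset ι) (p : ι → Poly) :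
    peval x (∑ i ∈ s, p i) = ∑ i ∈ s, peval x (p i) := by
  simp [peval]

lemma hasFDerivAt_peval (p : Poly) (x : E) :
    HasFDerivAt (fun y => peval y p)
      (∑ j, peval x (MvPolynomial.pderiv j p) • (EuclideanSpace.proj j : E →L[ℝ] ℝ)) x := by
  induction p using MvPolynomial.induction_on with
  | C c => simpa using hasFDerivAt_const c x
  | add p q hp hq =>
    simpa [add_smul, Finset.sum_add_distrib] using hp.fun_add hq
  | mul_X p i hp =>
    have hX : HasFDerivAt (fun y : E => y i) (EuclideanSpace.proj i : E →L[ℝ] ℝ) x :=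
      (EuclideanSpace.proj i : E →L[ℝ] ℝ).hasFDerivAt
    have h := hp.mul hX
    simp only [peval_mul, peval_X]
    refine h.congr_fderiv ?_
    ext v
    simp [MvPolynomial.pderiv_X, Pi.single_apply, add_mul,
      Finset.sum_add_distrib, Finset.mul_sum, apply_ite (peval x)]
    ring_nf

lemma contDiff_peval (p : Poly) : ContDiff ℝ ∞ (fun x => peval x p) := by
  induction p using MvPolynomial.induction_on with
  | C c => simpa using contDiff_const
  | add p q hp hq => simpa using hp.add hq
  | mul_X p i hp =>
    simpa using hp.mul (EuclideanSpace.proj i : E →L[ℝ] ℝ).contDiff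

@[fun_prop]
lemma continuous_peval (p : Poly) : Continuous (fun x => peval x p) :=
  (contDiff_peval p).continuous

@[fun_prop]
lemma continuous_peval_comp {X : Type*} [TopologicalSpace X] (p : Poly) {f : X → E}
    (hf : Continuous f) : Continuous (fun x => peval (f x) p) :=
  (continuous_peval p).comp hf

@[simp] lemma partialDeriv_peval (j : Fin 3) (p : Poly) (x : E) :
    partialDeriv j (fun y => peval y p) x = peval x (MvPolynomial.pderiv j p) := by
  simp [partialDeriv, (hasFDerivAt_peval p x).fderiv]

lemma eq_of_peval_eq_on_isOpen {U : Set E} (hU : IsOpen U) (hne : U.Nonempty) {p q : Poly}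
    (h : ∀ x ∈ U, peval x p = peval x q) : p = q := by
  obtain ⟨x, hx⟩ := hne
  have hV : IsOpen ((fun y : Fin 3 → ℝ => (WithLp.toLp 2 y : E)) ⁻¹' U) :=
    hU.preimage (PiLp.continuous_toLp 2 _)
  obtain ⟨ε, hε, hball⟩ := Metric.isOpen_iff.1 hV x (by simpa using hx)
  refine MvPolynomial.funext_set (fun i => Metric.ball (x i) ε) (fun i => ?_) fun y hy => ?_
  · rw [Real.ball_eq_Ioo]
    exact Set.Ioo_infinite (by linarith)
  · have := h (WithLp.toLp 2 y) (hball (by rw [ball_pi _ hε]; exact hy))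
    simpa [peval] using this

/-! ### Degrees -/

lemma totalDegree_aeval_le {σ τ : Type*} {g : σ → MvPolynomial τ ℝ}
    (hg : ∀ i, (g i).totalDegree ≤ 1) (p : MvPolynomial σ ℝ) :
    (MvPolynomial.aeval g p).totalDegree ≤ p.totalDegree := by
  rw [MvPolynomial.aeval_def, MvPolynomial.eval₂_eq]
  refine MvPolynomial.totalDegree_finsetSum_le fun d hd => ?_
  refine (MvPolynomial.totalDegree_mul _ _).trans ?_
  have h1 : ((algebraMap ℝ (MvPolynomial τ ℝ)) (MvPolynomial.coeff d p)).totalDegree = 0 :=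
    MvPolynomial.totalDegree_C _
  rw [h1, zero_add]
  refine (MvPolynomial.totalDegree_finsetProd _ _).trans ?_
  refine le_trans ?_ (MvPolynomial.le_totalDegree hd)
  rw [Finsupp.sum]
  refine Finset.sum_le_sum fun i _ => (MvPolynomial.totalDegree_pow _ _).trans ?_
  simpa using Nat.mul_le_mul_left (d i) (hg i)

lemma totalDegree_pderiv_le {σ : Type*} (i : σ) (p : MvPolynomial σ ℝ) :
    (MvPolynomial.pderiv i p).totalDegree ≤ p.totalDegree - 1 := by
  rw [MvPolynomial.as_sum p, map_sum]
  refine MvPolynomial.totalDegree_finsetSum_le fun d hd => ?_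
  rw [← MvPolynomial.as_sum p, MvPolynomial.pderiv_monomial]
  by_cases hdi : d i = 0
  · simp [hdi]
  refine (MvPolynomial.totalDegree_monomial_le _ _).trans ?_
  have h1 : d.sum (fun _ e => e) ≤ p.totalDegree := MvPolynomial.le_totalDegree hd
  have h2 : Finsupp.degree (d - Finsupp.single i 1) + 1 = Finsupp.degree d := by
    have h3 : d - Finsupp.single i 1 + Finsupp.single i 1 = d :=
      tsub_add_cancel_of_le (by simpa [Finsupp.single_le_iff] using Nat.one_le_iff_ne_zero.2 hdi)
    conv_rhs => rw [← h3]
    rw [map_add, Finsupp.degree_single]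
  have h4 : Finsupp.degree d = d.sum (fun _ e => e) := rfl
  have h5 : Finsupp.degree (d - Finsupp.single i 1)
    = (d - Finsupp.single i 1).sum (fun _ e => e) := rfl
  have h6 : ((d - Finsupp.single i 1).sum fun _ => id)
    = (d - Finsupp.single i 1).sum (fun _ e => e) := rfl
  omega

lemma totalDegree_add_le_of_le {σ : Type*} {p q : MvPolynomial σ ℝ} {n : ℕ}
    (hp : p.totalDegree ≤ n) (hq : q.totalDegree ≤ n) : (p + q).totalDegree ≤ n :=
  (MvPolynomial.totalDegree_add p q).trans (max_le hp hq)

lemma totalDegree_sub_le_of_le {σ : Type*} {p q : MvPolynomial σ ℝ} {n : ℕ}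
    (hp : p.totalDegree ≤ n) (hq : q.totalDegree ≤ n) : (p - q).totalDegree ≤ n :=
  (MvPolynomial.totalDegree_sub p q).trans (max_le hp hq)

lemma totalDegree_mul_le_of_le {σ : Type*} {p q : MvPolynomial σ ℝ} {m n : ℕ}
    (hp : p.totalDegree ≤ m) (hq : q.totalDegree ≤ n) : (p * q).totalDegree ≤ m + n :=
  (MvPolynomial.totalDegree_mul p q).trans (add_le_add hp hq)

lemma totalDegree_C_mul_le_of_le {σ : Type*} {p : MvPolynomial σ ℝ} {n : ℕ} (c : ℝ)
    (hp : p.totalDegree ≤ n) : (MvPolynomial.C c * p).totalDegree ≤ n := by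
  simpa using totalDegree_mul_le_of_le (MvPolynomial.totalDegree_C c).le hp

lemma sum_range_homogeneousComponent {σ : Type*} {p : MvPolynomial σ ℝ} {k : ℕ}
    (hp : p.totalDegree ≤ k) :
    ∑ i ∈ Finset.range (k + 1), MvPolynomial.homogeneousComponent i p = p := by
  conv_rhs => rw [← MvPolynomial.sum_homogeneousComponent p]
  refine (Finset.sum_subset (Finset.range_subset_range.2 (by omega)) fun i _ hi => ?_).symm
  exact MvPolynomial.homogeneousComponent_eq_zero _ _ (by simpa using hi)

/-- Removing the top homogeneous component lowers the degree. -/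
lemma totalDegree_sub_homogeneousComponent {σ : Type*} {p : MvPolynomial σ ℝ} {m : ℕ}
    (hp : p.totalDegree ≤ m + 1) :
    (p - MvPolynomial.homogeneousComponent (m + 1) p).totalDegree ≤ m := by
  have h' := sum_range_homogeneousComponent hp
  rw [Finset.sum_range_succ] at h'
  rw [sub_eq_of_eq_add h'.symm]
  refine MvPolynomial.totalDegree_finsetSum_le fun i hi => ?_
  exact (MvPolynomial.homogeneousComponent_isHomogeneous i p).totalDegree_le.trans
    (by simpa [Nat.lt_succ_iff] using hi)

/-- A polynomial that vanishes on a relatively open part of the coordinate plane `x_j = 0` is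
divisible by `x_j`. -/
lemma exists_eq_X_mul {j : Fin 3} {k : ℕ} {q : Poly} (hq : q.totalDegree ≤ k + 1)
    (h : ∀ x : E, x j = 0 → (∀ i, i ≠ j → 0 < x i ∧ x i < 1 / 3) → peval x q = 0) :
    ∃ ψ : Poly, q = MvPolynomial.X j * ψ ∧ ψ.totalDegree ≤ k := by
  have hdvd : (MvPolynomial.X j : Poly) ∣ q := by
    rw [MvPolynomial.X_dvd_iff_modMonomial_eq_zero]
    set r := q.modMonomial (Finsupp.single j 1) with hr
    have hdec := MvPolynomial.divMonomial_add_modMonomial_single q j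
    -- the remainder does not involve the variable `x_j`
    have hind : MvPolynomial.aeval
        (fun i : Fin 3 => if i = j then 0 else (MvPolynomial.X i : Poly)) r = r := by
      rw [MvPolynomial.aeval_def, MvPolynomial.eval₂_eq]
      conv_rhs => rw [MvPolynomial.as_sum r]
      refine Finset.sum_congr rfl fun d hd => ?_
      have hdj : d j = 0 := by
        by_contra hne
        refine (MvPolynomial.mem_support_iff.1 hd) ?_
        rw [hr]
        refine MvPolynomial.coeff_modMonomial_of_le _ ?_
        simpa [Finsupp.single_le_iff] using Nat.one_le_iff_ne_zero.2 hne
      rw [MvPolynomial.monomial_eq, Finsupp.prod]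
      congr 1
      refine Finset.prod_congr rfl fun i hi => ?_
      have : i ≠ j := by
        rintro rfl
        exact (Finsupp.mem_support_iff.1 hi) hdj
      simp [this]
    have heval : ∀ x : E,
        peval x r = peval (WithLp.toLp 2 fun i => if i = j then 0 else x i) r := by
      intro x
      conv_lhs => rw [← hind]
      unfold peval
      rw [MvPolynomial.aeval_def, MvPolynomial.eval₂_eq, map_sum, MvPolynomial.eval_eq]
      refine Finset.sum_congr rfl fun d _ => ?_
      simp [MvPolynomial.algebraMap_eq, apply_ite]
    refine MvPolynomial.funext_set (fun _ => Set.Ioo (0 : ℝ) (1 / 3))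
      (fun i => Set.Ioo_infinite (by norm_num)) fun y hy => ?_
    have h1 := heval (WithLp.toLp 2 y)
    have h2 := h (WithLp.toLp 2 fun i => if i = j then 0 else y i) (by simp)
      (fun i hi => by simpa [hi] using hy i (Set.mem_univ i))
    rw [← hdec] at h2
    simp only [peval_add, peval_mul, peval_X, if_true, zero_mul, zero_add] at h2
    simp only [peval] at h1 h2 ⊢
    rw [map_zero]
    exact h1.trans h2
  obtain ⟨ψ, hψ⟩ := hdvd
  refine ⟨ψ, hψ, ?_⟩
  by_cases h0 : ψ = 0
  · simp [h0]
  have := MvPolynomial.totalDegree_mul_of_isDomain (MvPolynomial.X_ne_zero (R := ℝ) j) h0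
  rw [← hψ, MvPolynomial.totalDegree_X] at this
  omega

/-- The homogeneous form of degree `k` in four variables that restricts to `p` on the hyperplane
where the variables add up to one, the last three of them being the coordinates. -/
lemma exists_homogeneous_lift {k : ℕ} {p : Poly} (hp : p.totalDegree ≤ k) (lam : Fin 4 → Poly)
    (hsum : ∑ i, lam i = 1) (hlam : ∀ i : Fin 3, lam i.succ = MvPolynomial.X i) :
    ∃ G : MvPolynomial (Fin 4) ℝ, G.IsHomogeneous k ∧ MvPolynomial.aeval lam G = p := by
  have h' := sum_range_homogeneousComponent hp
  refine ⟨∑ d ∈ Finset.range (k + 1), MvPolynomial.rename Fin.succ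
    (MvPolynomial.homogeneousComponent d p) * (∑ i, MvPolynomial.X i) ^ (k - d), ?_, ?_⟩
  · refine MvPolynomial.IsHomogeneous.sum _ _ _ fun d hd => ?_
    have h1 : ((∑ i, MvPolynomial.X i : MvPolynomial (Fin 4) ℝ) ^ (k - d)).IsHomogeneous
        (1 * (k - d)) :=
      (MvPolynomial.IsHomogeneous.sum _ _ _ fun i _ => MvPolynomial.isHomogeneous_X ℝ i).pow _
    have h2 := ((MvPolynomial.homogeneousComponent_isHomogeneous d p).rename_isHomogeneous
      (f := (Fin.succ : Fin 3 → Fin 4))).mul h1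
    have : d + 1 * (k - d) = k := by
      have := Finset.mem_range.1 hd
      omega
    rwa [this] at h2
  · conv_rhs => rw [← h']
    simp only [map_sum, map_mul, map_pow, MvPolynomial.aeval_X, hsum, one_pow, mul_one,
      MvPolynomial.aeval_rename]
    refine Finset.sum_congr rfl fun d _ => ?_
    have : lam ∘ Fin.succ = MvPolynomial.X := funext hlam
    rw [this, MvPolynomial.aeval_X_left_apply]

/-! ### Barycentric coordinates of the reference tetrahedron -/

/-- The vertices of the reference tetrahedron. -/
noncomputable def refVert : Fin 4 → E :=
  Fin.cons 0 fun i : Fin 3 => EuclideanSpace.single i (1 : ℝ)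

/-- The barycentric coordinates of the reference tetrahedron, as polynomials. -/
noncomputable def lam : Fin 4 → Poly :=
  Fin.cons (1 - ∑ i, MvPolynomial.X i) fun i : Fin 3 => MvPolynomial.X i

/-- The gradients of the barycentric coordinates of the reference tetrahedron. -/
def nu : Fin 4 → Fin 3 → ℝ :=
  Fin.cons (fun _ => -1) fun i j : Fin 3 => if j = i then 1 else 0

@[simp] lemma refVert_zero : refVert 0 = 0 := rfl
@[simp] lemma refVert_succ (i : Fin 3) : refVert i.succ = EuclideanSpace.single i 1 := rfl
@[simp] lemma refVert_one : refVert 1 = EuclideanSpace.single 0 1 := rfl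
@[simp] lemma refVert_two : refVert 2 = EuclideanSpace.single 1 1 := rfl
@[simp] lemma refVert_three : refVert 3 = EuclideanSpace.single 2 1 := rfl
@[simp] lemma lam_zero : lam 0 = 1 - ∑ i, MvPolynomial.X i := rfl
@[simp] lemma lam_succ (i : Fin 3) : lam i.succ = MvPolynomial.X i := rfl
@[simp] lemma nu_zero (j : Fin 3) : nu 0 j = -1 := rfl
@[simp] lemma nu_succ (i j : Fin 3) : nu i.succ j = if j = i then 1 else 0 := rfl

lemma sum_lam : ∑ i, lam i = 1 := by
  rw [Fin.sum_univ_succ]; simp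

lemma totalDegree_lam_le (i : Fin 4) : (lam i).totalDegree ≤ 1 := by
  refine Fin.cases ?_ (fun i => ?_) i
  · rw [lam_zero]
    refine totalDegree_sub_le_of_le (by simp) ?_
    exact MvPolynomial.totalDegree_finsetSum_le fun i _ => (MvPolynomial.totalDegree_X i).le
  · exact (MvPolynomial.totalDegree_X i).le

lemma peval_lam_refVert (i j : Fin 4) : peval (refVert j) (lam i) = if i = j then 1 else 0 := by
  refine Fin.cases ?_ (fun i => ?_) i <;> refine Fin.cases ?_ (fun j => ?_) j
  · simp
  · rw [if_neg (Fin.succ_ne_zero j).symm]; simp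
  · rw [if_neg (Fin.succ_ne_zero i)]; simp
  · simp only [lam_succ, refVert_succ, peval_X, Fin.succ_inj]
    simp

/-- The barycentric coordinates are affine functions. -/
lemma peval_lam_add (i : Fin 4) (x u : E) :
    peval (x + u) (lam i) = peval x (lam i) + ∑ j, nu i j * u j := by
  refine Fin.cases ?_ (fun i => ?_) i
  · simp [Finset.sum_add_distrib]; ring
  · simp

lemma sum_peval_lam_smul (x : E) : ∑ i, peval x (lam i) • refVert i = x := by
  ext j
  rw [Fin.sum_univ_succ]
  simp [Pi.single_apply]

lemma sum_peval_lam (x : E) : ∑ i, peval x (lam i) = 1 := by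
  rw [← peval_sum, sum_lam, peval_one]

/-- A subsimplex of the reference tetrahedron in terms of barycentric coordinates. -/
lemma convexHull_image_refVert (s : Set (Fin 4)) :
    convexHull ℝ (refVert '' s) =
      {x | ∀ i, 0 ≤ peval x (lam i) ∧ (i ∉ s → peval x (lam i) = 0)} := by
  classical
  apply subset_antisymm
  · refine convexHull_min ?_ ?_
    · rintro _ ⟨j, hj, rfl⟩ i
      rw [peval_lam_refVert]
      refine ⟨by split_ifs <;> norm_num, fun hi => if_neg ?_⟩
      rintro rfl
      exact hi hj
    · intro x hx y hy a b ha hb hab i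
      have key : peval (a • x + b • y) (lam i) = a * peval x (lam i) + b * peval y (lam i) := by
        refine Fin.cases ?_ (fun i => ?_) i
        · simp [Finset.sum_add_distrib, ← Finset.mul_sum]
          linear_combination -hab
        · simp
      rw [key]
      refine ⟨add_nonneg (mul_nonneg ha (hx i).1) (mul_nonneg hb (hy i).1), fun hi => ?_⟩
      rw [(hx i).2 hi, (hy i).2 hi]; simp
  · intro x hx
    rw [← sum_peval_lam_smul x]
    have h1 : ∑ i, peval x (lam i) • refVert i
        = ∑ i with i ∈ s, peval x (lam i) • refVert i := by
      symm
      refine Finset.sum_subset (Finset.subset_univ _) fun i _ hi => ?_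
      rw [(hx i).2 (by simpa using hi), zero_smul]
    have h2 : ∑ i with i ∈ s, peval x (lam i) = 1 := by
      rw [← sum_peval_lam x]
      refine Finset.sum_subset (Finset.subset_univ _) fun i _ hi => ?_
      rw [(hx i).2 (by simpa using hi)]
    rw [h1]
    refine (convex_convexHull ℝ _).sum_mem (fun i _ => (hx i).1) h2 fun i hi => ?_
    exact subset_convexHull ℝ _ ⟨i, by simpa using hi, rfl⟩

lemma refTet_eq_convexHull : refTet = convexHull ℝ (refVert '' Set.univ) := by
  rw [refTet, Set.image_univ]
  congr 1
  ext x
  constructor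
  · rintro (rfl | ⟨i, rfl⟩)
    · exact ⟨0, rfl⟩
    · exact ⟨i.succ, rfl⟩
  · rintro ⟨i, rfl⟩
    refine Fin.cases ?_ (fun i => ?_) i
    · exact Or.inl rfl
    · exact Or.inr ⟨i, rfl⟩

lemma mem_refTet {x : E} : x ∈ refTet ↔ ∀ i, 0 ≤ peval x (lam i) := by
  rw [refTet_eq_convexHull, convexHull_image_refVert]
  simp

lemma isCompact_refTet : IsCompact refTet := by
  rw [refTet_eq_convexHull]
  exact (Set.toFinite _).isCompact_convexHull ℝ

/-- The points where all barycentric coordinates are positive. -/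
def refInt : Set E := {x | ∀ i, 0 < peval x (lam i)}

lemma isOpen_refInt : IsOpen refInt := by
  have : refInt = ⋂ i, {x | 0 < peval x (lam i)} := by ext; simp [refInt]
  rw [this]
  exact isOpen_iInter_of_finite fun i => isOpen_lt continuous_const (by fun_prop)

lemma refInt_nonempty : refInt.Nonempty := by
  refine ⟨WithLp.toLp 2 fun _ => 1 / 4, fun i => ?_⟩
  refine Fin.cases ?_ (fun i => ?_) i
  · simp; norm_num
  · simp

lemma refInt_subset_refTet : refInt ⊆ refTet := fun _ hx => mem_refTet.2 fun i => (hx i).le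

lemma measurableSet_refTet : MeasurableSet refTet := isCompact_refTet.isClosed.measurableSet

/-- A continuous nonnegative function with zero integral over the reference tetrahedron vanishes
in its interior. -/
lemma eq_zero_of_integral_refTet_eq_zero {f : E → ℝ} (hf : Continuous f)
    (h0 : ∀ x ∈ refTet, 0 ≤ f x) (hint : ∫ x in refTet, f x = 0) : ∀ x ∈ refInt, f x = 0 := by
  have h1 : f =ᵐ[volume.restrict refTet] 0 := by
    rwa [setIntegral_eq_zero_iff_of_nonneg_ae] at hint
    · exact (ae_restrict_iff' measurableSet_refTet).2 (Filter.Eventually.of_forall h0)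
    · exact hf.continuousOn.integrableOn_compact isCompact_refTet
  have h2 : f =ᵐ[volume.restrict refInt] 0 :=
    ae_mono (Measure.restrict_mono refInt_subset_refTet le_rfl) h1
  exact (Measure.eqOn_open_of_ae_eq h2 isOpen_refInt hf.continuousOn continuousOn_const)

/-! ### Triangles and their surface measure -/

/-- The reference triangle. -/
def refTri : Set (EuclideanSpace ℝ (Fin 2)) := {y | 0 ≤ y 0 ∧ 0 ≤ y 1 ∧ y 0 + y 1 ≤ 1}

/-- The affine map of the reference triangle onto the triangle with the given vertices. -/
noncomputable def triMap (v : Fin 3 → E) (y : EuclideanSpace ℝ (Fin 2)) : E :=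
  v 0 + (y 0 • (v 1 - v 0) + y 1 • (v 2 - v 0))

@[fun_prop]
lemma continuous_triMap (v : Fin 3 → E) : Continuous (triMap v) := by
  unfold triMap; fun_prop

lemma isCompact_refTri : IsCompact refTri := by
  have hc : IsClosed refTri := by
    have h0 : IsClosed {y : EuclideanSpace ℝ (Fin 2) | 0 ≤ y 0} :=
      isClosed_le continuous_const (by fun_prop)
    have h1 : IsClosed {y : EuclideanSpace ℝ (Fin 2) | 0 ≤ y 1} :=
      isClosed_le continuous_const (by fun_prop)
    have h2 : IsClosed {y : EuclideanSpace ℝ (Fin 2) | y 0 + y 1 ≤ 1} :=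
      isClosed_le (by fun_prop) continuous_const
    exact h0.inter (h1.inter h2)
  refine Metric.isCompact_of_isClosed_isBounded hc ?_
  refine (Metric.isBounded_closedBall (x := (0 : EuclideanSpace ℝ (Fin 2))) (r := 2)).subset ?_
  rintro y ⟨h0, h1, h2⟩
  rw [mem_closedBall_zero_iff, EuclideanSpace.norm_eq, Real.sqrt_le_left (by norm_num)]
  simp only [Fin.sum_univ_two, Real.norm_eq_abs, sq_abs]
  nlinarith

lemma measurableSet_refTri : MeasurableSet refTri := isCompact_refTri.isClosed.measurableSet

lemma image_triMap (v : Fin 3 → E) : triMap v '' refTri = convexHull ℝ (Set.range v) := by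
  apply subset_antisymm
  · rintro _ ⟨y, ⟨h0, h1, h2⟩, rfl⟩
    have : triMap v y = ∑ i, (![1 - y 0 - y 1, y 0, y 1] : Fin 3 → ℝ) i • v i := by
      simp only [triMap, Fin.sum_univ_three, Matrix.cons_val]
      module
    rw [this]
    refine (convex_convexHull ℝ _).sum_mem (fun i _ => ?_) ?_ fun i _ =>
      subset_convexHull ℝ _ ⟨i, rfl⟩
    · fin_cases i
      · simp; linarith
      · simpa using h0
      · simpa using h1
    · simp only [Fin.sum_univ_three, Matrix.cons_val]
      ring
  · refine convexHull_min ?_ ?_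
    · rintro _ ⟨i, rfl⟩
      fin_cases i
      · exact ⟨0, by simp [refTri], by simp [triMap]⟩
      · exact ⟨EuclideanSpace.single 0 1, by simp [refTri], by simp [triMap]⟩
      · exact ⟨EuclideanSpace.single 1 1, by simp [refTri], by simp [triMap]⟩
    · rintro _ ⟨y, ⟨hy0, hy1, hy2⟩, rfl⟩ _ ⟨z, ⟨hz0, hz1, hz2⟩, rfl⟩ a b ha hb hab
      refine ⟨a • y + b • z, ⟨?_, ?_, ?_⟩, ?_⟩
      · simp; positivity
      · simp; positivity
      · simp; nlinarith
      · obtain rfl : a = 1 - b := by linarith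
        simp only [triMap, PiLp.add_apply, PiLp.smul_apply, smul_eq_mul]
        module

/-- The area of the parallelogram spanned by two vectors. -/
noncomputable def parArea (e e' : E) : ℝ := √(‖e‖ ^ 2 * ‖e'‖ ^ 2 - inner ℝ e e' ^ 2)

lemma restrict_image_triMap (v : Fin 3 → E) (hinj : Function.Injective (triMap v)) :
    (Measure.euclideanHausdorffMeasure 2).restrict (triMap v '' refTri) =
      ENNReal.ofReal (parArea (v 1 - v 0) (v 2 - v 0)) •
        (volume.restrict refTri).map (triMap v) := by
  have hme : MeasurableEmbedding (triMap v) := (continuous_triMap v).measurableEmbedding hinj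
  let L : EuclideanSpace ℝ (Fin 2) →ₗ[ℝ] E :=
    (EuclideanSpace.projₗ (0 : Fin 2)).smulRight (v 1 - v 0) +
    (EuclideanSpace.projₗ (1 : Fin 2)).smulRight (v 2 - v 0)
  have hL : ∀ s : Set (EuclideanSpace ℝ (Fin 2)),
      Measure.euclideanHausdorffMeasure 2 (triMap v '' s) =
        ENNReal.ofReal L.normDet * volume s := by
    intro s
    have h1 : triMap v '' s = (fun x => v 0 + x) '' (L '' s) := by
      rw [Set.image_image]; rfl
    rw [h1, (isometry_add_left (v 0)).euclideanHausdorffMeasure_image,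
      ← L.euclideanHausdorffMeasure_image_eq_normDet_mul_volume, finrank_euclideanSpace_fin]
  have harea : L.normDet = parArea (v 1 - v 0) (v 2 - v 0) := by
    have h := L.normDet_sq_eq_det_gram (EuclideanSpace.basisFun (Fin 2) ℝ)
    have h0 : L (EuclideanSpace.basisFun (Fin 2) ℝ 0) = v 1 - v 0 := by simp [L]
    have h1 : L (EuclideanSpace.basisFun (Fin 2) ℝ 1) = v 2 - v 0 := by simp [L]
    rw [Matrix.det_fin_two] at h
    simp only [Matrix.gram_apply, h0, h1, real_inner_self_eq_norm_sq,
      real_inner_comm (v 1 - v 0) (v 2 - v 0)] at h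
    rw [parArea, ← Real.sqrt_sq L.normDet_nonneg]
    congr 1
    rw [sq (inner ℝ _ _)]
    exact h
  ext s hs
  rw [Measure.restrict_apply hs, Measure.smul_apply, Measure.map_apply (by fun_prop) hs,
    Measure.restrict_apply (hs.preimage (by fun_prop)), smul_eq_mul, ← harea, ← hL,
    Set.image_preimage_inter]

/-- The surface integral over a triangle by means of its affine parametrization. -/
lemma integral_image_triMap (v : Fin 3 → E) (hinj : Function.Injective (triMap v)) (f : E → ℝ) :
    ∫ x in triMap v '' refTri, f x ∂(Measure.euclideanHausdorffMeasure 2) =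
      parArea (v 1 - v 0) (v 2 - v 0) * ∫ y in refTri, f (triMap v y) := by
  rw [restrict_image_triMap v hinj, integral_smul_measure,
    ((continuous_triMap v).measurableEmbedding hinj).integral_map,
    ENNReal.toReal_ofReal (by exact Real.sqrt_nonneg _), smul_eq_mul]

lemma integrableOn_image_triMap (v : Fin 3 → E) (hinj : Function.Injective (triMap v)) {f : E → ℝ}
    (hf : Continuous f) :
    IntegrableOn f (triMap v '' refTri) (Measure.euclideanHausdorffMeasure 2) := by
  rw [IntegrableOn, restrict_image_triMap v hinj]
  refine Integrable.smul_measure ?_ ENNReal.ofReal_ne_top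
  rw [((continuous_triMap v).measurableEmbedding hinj).integrable_map_iff]
  exact (hf.comp (continuous_triMap v)).continuousOn.integrableOn_compact isCompact_refTri

/-- A covector `g` that vanishes on `e, e'` and is one on `w` measures the height of the
parallelepiped spanned by `e, e', w` over its base. -/
lemma sq_parArea_eq {e e' w g : E} (h1 : inner ℝ g e = 0) (h2 : inner ℝ g e' = 0)
    (h3 : inner ℝ g w = 1) :
    ‖e‖ ^ 2 * ‖e'‖ ^ 2 - inner ℝ e e' ^ 2 =
      (Matrix.of ![(e : Fin 3 → ℝ), e', w]).det ^ 2 * ‖g‖ ^ 2 := by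
  simp only [EuclideanSpace.norm_sq_eq, PiLp.inner_apply, Fin.sum_univ_three, Real.norm_eq_abs,
    sq_abs, RCLike.inner_apply, conj_trivial] at *
  rw [Matrix.det_fin_three]
  simp only [Matrix.of_apply, Matrix.cons_val]
  set D : ℝ := e 0 * e' 1 * w 2 - e 0 * e' 2 * w 1 - e 1 * e' 0 * w 2 + e 1 * e' 2 * w 0 +
    e 2 * e' 0 * w 1 - e 2 * e' 1 * w 0 with hD
  -- the cross product of `e` and `e'` is the determinant times `g`
  have c0 : e 1 * e' 2 - e 2 * e' 1 = D * g 0 := by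
    rw [hD]
    linear_combination (-(e 1 * e' 2 - e 2 * e' 1)) * h3 + (e 1 * w 2 - e 2 * w 1) * h2
      - (e' 1 * w 2 - e' 2 * w 1) * h1
  have c1 : e 2 * e' 0 - e 0 * e' 2 = D * g 1 := by
    rw [hD]
    linear_combination (-(e 2 * e' 0 - e 0 * e' 2)) * h3 + (e 2 * w 0 - e 0 * w 2) * h2
      - (e' 2 * w 0 - e' 0 * w 2) * h1
  have c2 : e 0 * e' 1 - e 1 * e' 0 = D * g 2 := by
    rw [hD]
    linear_combination (-(e 0 * e' 1 - e 1 * e' 0)) * h3 + (e 0 * w 1 - e 1 * w 0) * h2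
      - (e' 0 * w 1 - e' 1 * w 0) * h1
  calc _ = (e 1 * e' 2 - e 2 * e' 1) ^ 2 + (e 2 * e' 0 - e 0 * e' 2) ^ 2
        + (e 0 * e' 1 - e 1 * e' 0) ^ 2 := by ring
    _ = _ := by rw [c0, c1, c2]; ring

/-! ### The divergence theorem on a tetrahedron -/

lemma peval_lam_comb (i : Fin 4) (x y z : E) (a b : ℝ) :
    peval (x + (a • (y - x) + b • (z - x))) (lam i) =
      (1 - a - b) * peval x (lam i) + a * peval y (lam i) + b * peval z (lam i) := by
  refine Fin.cases ?_ (fun i => ?_) i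
  · simp [Finset.sum_add_distrib, ← Finset.mul_sum]; ring
  · simp; ring

lemma injective_triMap_refVert {σ : Fin 3 → Fin 4} (hσ : Function.Injective σ) :
    Function.Injective (triMap fun j => refVert (σ j)) := by
  have h01 : σ 0 ≠ σ 1 := hσ.ne (by decide)
  have h02 : σ 0 ≠ σ 2 := hσ.ne (by decide)
  have h12 : σ 1 ≠ σ 2 := hσ.ne (by decide)
  intro y z h
  have h1 := congrArg (fun x => peval x (lam (σ 1))) h
  have h2 := congrArg (fun x => peval x (lam (σ 2))) h
  simp only [triMap, peval_lam_comb, peval_lam_refVert] at h1 h2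
  simp [h01.symm, h12] at h1
  simp [h02.symm, h12.symm] at h2
  ext i
  fin_cases i
  · exact h1
  · exact h2

/-- The vertices of the face opposite to the vertex `i` of the tetrahedron `A '' refTet`. -/
noncomputable def faceVert (A : E ≃ᵃ[ℝ] E) (i : Fin 4) (j : Fin 3) : E :=
  A (refVert (i.succAbove j))

/-- The gradients of the barycentric coordinates of the tetrahedron `A '' refTet`. -/
noncomputable def gr (A : E ≃ᵃ[ℝ] E) (i : Fin 4) : E :=
  LinearMap.adjoint (A.linear.symm : E →ₗ[ℝ] E) (WithLp.toLp 2 (nu i))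

/-- The volume of `A '' refTet` divided by that of `refTet`. -/
noncomputable def vol (A : E ≃ᵃ[ℝ] E) : ℝ := |LinearMap.det (A.linear : E →ₗ[ℝ] E)|

/-- The integral over the face opposite to the vertex `i`, divided by twice the area. -/
noncomputable def triInt (A : E ≃ᵃ[ℝ] E) (i : Fin 4) (f : E → ℝ) : ℝ :=
  ∫ y in refTri, f (triMap (faceVert A i) y)

lemma vol_pos (A : E ≃ᵃ[ℝ] E) : 0 < vol A :=
  abs_pos.2 (LinearEquiv.isUnit_det' A.linear).ne_zero

lemma inner_gr (A : E ≃ᵃ[ℝ] E) (i : Fin 4) (u : E) :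
    inner ℝ (gr A i) u = ∑ j, nu i j * A.linear.symm u j := by
  rw [gr, LinearMap.adjoint_inner_left]
  simp [PiLp.inner_apply, mul_comm]

lemma map_sub_eq (A : E ≃ᵃ[ℝ] E) (x y : E) : A x - A y = A.linear (x - y) := by
  have := A.toAffineMap.linearMap_vsub x y
  simpa using this.symm

lemma inner_gr_map_sub (A : E ≃ᵃ[ℝ] E) (i : Fin 4) (x y : E) :
    inner ℝ (gr A i) (A x - A y) = peval x (lam i) - peval y (lam i) := by
  rw [inner_gr, map_sub_eq]
  simp only [LinearEquiv.symm_apply_apply]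
  have h := peval_lam_add i y (x - y)
  rw [add_sub_cancel] at h
  linarith

lemma gr_ne_zero (A : E ≃ᵃ[ℝ] E) (i : Fin 4) : gr A i ≠ 0 := by
  intro h
  have h1 := inner_gr_map_sub A i (refVert i) (refVert (i.succAbove 0))
  rw [h, inner_zero_left, peval_lam_refVert, peval_lam_refVert, if_pos rfl,
    if_neg (Fin.succAbove_ne i 0).symm] at h1
  norm_num at h1

lemma norm_gr_pos (A : E ≃ᵃ[ℝ] E) (i : Fin 4) : 0 < ‖gr A i‖ := norm_pos_iff.2 (gr_ne_zero A i)

lemma triMap_faceVert (A : E ≃ᵃ[ℝ] E) (i : Fin 4) (y : EuclideanSpace ℝ (Fin 2)) :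
    triMap (faceVert A i) y = A (triMap (fun j => refVert (i.succAbove j)) y) := by
  have h : ∀ x u : E, A (x + u) = A x + A.linear u := fun x u => by
    have := map_sub_eq A (x + u) x
    rw [add_sub_cancel_left] at this
    rw [← this]; abel
  simp only [triMap, faceVert, h, map_add, map_smul, map_sub_eq]

lemma injective_triMap_faceVert (A : E ≃ᵃ[ℝ] E) (i : Fin 4) :
    Function.Injective (triMap (faceVert A i)) := by
  have : triMap (faceVert A i) = A ∘ triMap fun j => refVert (i.succAbove j) :=
    funext (triMap_faceVert A i)
  rw [this]
  exact A.injective.comp (injective_triMap_refVert Fin.succAbove_right_injective)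

lemma det_rows_map (B : E ≃ₗ[ℝ] E) (u : Fin 3 → E) :
    (Matrix.of ![(B (u 0) : Fin 3 → ℝ), B (u 1), B (u 2)]).det =
      LinearMap.det (B : E →ₗ[ℝ] E) * (Matrix.of ![(u 0 : Fin 3 → ℝ), u 1, u 2]).det := by
  have key : ∀ w : Fin 3 → E, (EuclideanSpace.basisFun (Fin 3) ℝ).toBasis.det w
      = (Matrix.of ![(w 0 : Fin 3 → ℝ), w 1, w 2]).det := by
    intro w
    rw [Module.Basis.det_apply, ← Matrix.det_transpose]
    congr 1
    ext i j
    fin_cases i <;> simp [Module.Basis.toMatrix_apply]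
  rw [← key, ← key fun i => B (u i)]
  exact Module.Basis.det_comp _ (B : E →ₗ[ℝ] E) u

/-- The area of a face is the volume divided by the height, up to the factors for the reference
tetrahedron. -/
lemma parArea_faceVert (A : E ≃ᵃ[ℝ] E) (i : Fin 4) :
    parArea (faceVert A i 1 - faceVert A i 0) (faceVert A i 2 - faceVert A i 0) =
      vol A * ‖gr A i‖ := by
  rw [parArea, sq_parArea_eq (w := A (refVert i) - faceVert A i 0) (g := gr A i)]
  · simp only [faceVert, map_sub_eq]
    have h := det_rows_map A.linear ![refVert (i.succAbove 1) - refVert (i.succAbove 0),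
      refVert (i.succAbove 2) - refVert (i.succAbove 0), refVert i - refVert (i.succAbove 0)]
    simp only [Matrix.cons_val] at h
    rw [h, mul_pow]
    have h1 : (Matrix.of ![((refVert (i.succAbove 1) - refVert (i.succAbove 0) : E) : Fin 3 → ℝ),
      (refVert (i.succAbove 2) - refVert (i.succAbove 0) : E),
      (refVert i - refVert (i.succAbove 0) : E)]).det ^ 2 = 1 := by
      rw [Matrix.det_fin_three]
      fin_cases i <;> simp [Fin.succAbove, Fin.lt_def]
    rw [h1, mul_one, ← mul_pow, Real.sqrt_sq_eq_abs, abs_mul, abs_norm]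
    rfl
  all_goals
    simp only [faceVert, inner_gr_map_sub, peval_lam_refVert, if_true]
    simp [(Fin.succAbove_ne i _).symm]

/-- The surface integral over a face of a tetrahedron. -/
lemma integral_face (A : E ≃ᵃ[ℝ] E) (i : Fin 4) (f : E → ℝ) :
    ∫ x in convexHull ℝ (Set.range (faceVert A i)), f x ∂(Measure.euclideanHausdorffMeasure 2) =
      vol A * ‖gr A i‖ * triInt A i f := by
  rw [← image_triMap, integral_image_triMap _ (injective_triMap_faceVert A i), parArea_faceVert]
  rfl

lemma integrableOn_face (A : E ≃ᵃ[ℝ] E) (i : Fin 4) {f : E → ℝ} (hf : Continuous f) :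
    IntegrableOn f (convexHull ℝ (Set.range (faceVert A i)))
      (Measure.euclideanHausdorffMeasure 2) := by
  rw [← image_triMap]
  exact integrableOn_image_triMap _ (injective_triMap_faceVert A i) hf

lemma affineEquiv_eq (A : E ≃ᵃ[ℝ] E) :
    (A : E → E) = fun x => LinearMap.toContinuousLinearMap (A.linear : E →ₗ[ℝ] E) x + A 0 := by
  ext1 x
  have := map_sub_eq A x 0
  simp only [sub_zero] at this
  simp [← this]

lemma hasFDerivAt_affineEquiv (A : E ≃ᵃ[ℝ] E) (x : E) :
    HasFDerivAt A (LinearMap.toContinuousLinearMap (A.linear : E →ₗ[ℝ] E)) x := by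
  rw [affineEquiv_eq A]
  exact (ContinuousLinearMap.hasFDerivAt _).add_const _

lemma contDiff_affineEquiv (A : E ≃ᵃ[ℝ] E) : ContDiff ℝ ∞ A := by
  rw [affineEquiv_eq A]
  exact (ContinuousLinearMap.contDiff _).add contDiff_const

@[fun_prop]
lemma continuous_affineEquiv (A : E ≃ᵃ[ℝ] E) : Continuous A := (contDiff_affineEquiv A).continuous

lemma integral_image_affineEquiv (A : E ≃ᵃ[ℝ] E) {s : Set E} (hs : MeasurableSet s) (f : E → ℝ) :
    ∫ x in A '' s, f x = vol A * ∫ x in s, f (A x) := by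
  rw [integral_image_eq_integral_abs_det_fderiv_smul volume hs
    (fun x _ => (hasFDerivAt_affineEquiv A x).hasFDerivWithinAt) A.injective.injOn]
  simp only [smul_eq_mul]
  rw [integral_const_mul]
  rfl

/-- The parametrization of space by the `j`-th coordinate and the two others. -/
noncomputable def splitCoord (j : Fin 3) (p : ℝ × EuclideanSpace ℝ (Fin 2)) : E :=
  WithLp.toLp 2 (j.insertNth p.1 (WithLp.ofLp p.2))

lemma measurePreserving_splitCoord (j : Fin 3) : MeasurePreserving (splitCoord j) := by
  have h1 : MeasurePreserving (MeasurableEquiv.piFinSuccAbove (fun _ : Fin 3 => ℝ) j).symm :=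
    (volume_preserving_piFinSuccAbove (fun _ : Fin 3 => ℝ) j).symm
  have h2 : MeasurePreserving
      (Prod.map (id : ℝ → ℝ) (WithLp.ofLp : EuclideanSpace ℝ (Fin 2) → _)) :=
    (MeasurePreserving.id volume).prod (PiLp.volume_preserving_ofLp (Fin 2))
  exact (PiLp.volume_preserving_toLp (Fin 3)).comp (h1.comp h2)

lemma splitCoord_eq (j : Fin 3) (t : ℝ) (y : EuclideanSpace ℝ (Fin 2)) :
    splitCoord j (t, y) =
      triMap (fun i => refVert (j.succ.succAbove i)) y + t • EuclideanSpace.single j (1 : ℝ) := by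
  ext i
  fin_cases j <;> fin_cases i <;>
    simp [splitCoord, triMap, Fin.succAbove, Fin.lt_def, Fin.insertNth, Fin.succAboveCases]
  rfl

lemma injective_splitCoord (j : Fin 3) : Function.Injective (splitCoord j) := by
  rintro ⟨t, y⟩ ⟨t', y'⟩ h
  have h1 := congrArg WithLp.ofLp h
  simp only [splitCoord] at h1
  have h2 : t = t' := by simpa using congrFun h1 j
  have h3 : WithLp.ofLp y = WithLp.ofLp y' := by
    funext i
    simpa using congrFun h1 (j.succAbove i)
  rw [h2, WithLp.ofLp_injective 2 h3]

@[fun_prop]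
lemma continuous_splitCoord (j : Fin 3) : Continuous (splitCoord j) := by
  have : splitCoord j = fun p => triMap (fun i => refVert (j.succ.succAbove i)) p.2 +
      p.1 • EuclideanSpace.single j (1 : ℝ) := funext fun p => splitCoord_eq j p.1 p.2
  rw [this]
  fun_prop

lemma splitCoord_mem_refTet (j : Fin 3) (t : ℝ) (y : EuclideanSpace ℝ (Fin 2)) :
    splitCoord j (t, y) ∈ refTet ↔ y ∈ refTri ∧ 0 ≤ t ∧ t ≤ 1 - y 0 - y 1 := by
  rw [mem_refTet, splitCoord_eq, Fin.forall_fin_succ]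
  simp only [lam_zero, lam_succ, peval_X, peval_sub, peval_one, peval_sum]
  simp only [Fin.forall_fin_succ, refTri, Set.mem_ofPred_eq]
  fin_cases j <;> simp [triMap, Fin.succAbove, Fin.lt_def, Fin.sum_univ_three] <;>
  constructor <;> intro h <;> refine ⟨?_, ?_⟩ <;> grind

/-- Integration over the reference tetrahedron in lines parallel to a coordinate axis. -/
lemma integral_refTet_eq (j : Fin 3) {f : E → ℝ} (hf : Continuous f) :
    ∫ x in refTet, f x = ∫ y in refTri, ∫ t in (0 : ℝ)..(1 - y 0 - y 1),
      f (triMap (fun i => refVert (j.succ.succAbove i)) y +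
        t • EuclideanSpace.single j (1 : ℝ)) := by
  have hme : MeasurableEmbedding (splitCoord j) :=
    (continuous_splitCoord j).measurableEmbedding (injective_splitCoord j)
  have hint : Integrable (refTet.indicator f) :=
    (integrable_indicator_iff measurableSet_refTet).2
      (hf.continuousOn.integrableOn_compact isCompact_refTet)
  rw [← integral_indicator measurableSet_refTet,
    ← (measurePreserving_splitCoord j).integral_comp hme, Measure.volume_eq_prod,
    integral_prod_symm (fun p => refTet.indicator f (splitCoord j p))
      (((measurePreserving_splitCoord j).integrable_comp_emb hme).2 hint),
    ← integral_indicator measurableSet_refTri]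
  congr 1 with y
  by_cases hy : y ∈ refTri
  · rw [Set.indicator_of_mem hy, intervalIntegral.integral_of_le (by linarith [hy.2.2]),
      ← integral_Icc_eq_integral_Ioc, ← integral_indicator measurableSet_Icc]
    congr 1 with t
    by_cases ht : t ∈ Set.Icc 0 (1 - y 0 - y 1)
    · rw [Set.indicator_of_mem ht,
        Set.indicator_of_mem ((splitCoord_mem_refTet j t y).2 ⟨hy, ht⟩), splitCoord_eq]
    · rw [Set.indicator_of_notMem ht,
        Set.indicator_of_notMem fun h => ht ((splitCoord_mem_refTet j t y).1 h).2]
  · rw [Set.indicator_of_notMem hy]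
    rw [integral_eq_zero_of_ae]
    refine Filter.Eventually.of_forall fun t => ?_
    exact Set.indicator_of_notMem (fun h => hy ((splitCoord_mem_refTet j t y).1 h).1) _

/-- The surface integral over the face opposite to the origin does not depend on the order of
the vertices. -/
lemma integral_top_face (j : Fin 3) (f : E → ℝ) :
    ∫ y in refTri, f (triMap (fun i => refVert (j.succ.succAbove i)) y +
        (1 - y 0 - y 1) • EuclideanSpace.single j (1 : ℝ)) =
      ∫ y in refTri, f (triMap (fun i => refVert (Fin.succAbove 0 i)) y) := by
  -- both sides are `1 / √3` times the surface integral, for two orders `σ` of the vertices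
  let σ : Fin 3 → Fin 4 := ![j.succ, j.succ.succAbove 1, j.succ.succAbove 2]
  obtain ⟨hσ, hσ0, hrange⟩ : Function.Injective σ ∧ (∀ i, σ i ≠ 0) ∧
      ∀ i : Fin 4, (∃ l, σ l = i) ↔ i ≠ 0 := by
    revert j
    decide
  have h1 : ∀ y, triMap (fun i => refVert (j.succ.succAbove i)) y +
        (1 - y 0 - y 1) • EuclideanSpace.single j (1 : ℝ) = triMap (fun i => refVert (σ i)) y := by
    intro y
    have h0 : refVert (j.succ.succAbove 0) = 0 := by
      fin_cases j <;> simp [Fin.succAbove, Fin.lt_def]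
    simp only [triMap, σ, Matrix.cons_val, h0, refVert_succ]
    module
  have harea : ∀ τ : Fin 3 → Fin 4, Function.Injective τ → (∀ i, τ i ≠ 0) →
      parArea (refVert (τ 1) - refVert (τ 0)) (refVert (τ 2) - refVert (τ 0)) = √3 := by
    intro τ hτ h0
    obtain ⟨a, ha⟩ := Fin.exists_succ_eq.2 (h0 0)
    obtain ⟨b, hb⟩ := Fin.exists_succ_eq.2 (h0 1)
    obtain ⟨c, hc⟩ := Fin.exists_succ_eq.2 (h0 2)
    have hab : b ≠ a := fun h => hτ.ne (show (1 : Fin 3) ≠ 0 by decide) (by rw [← ha, ← hb, h])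
    have hac : c ≠ a := fun h => hτ.ne (show (2 : Fin 3) ≠ 0 by decide) (by rw [← ha, ← hc, h])
    have hbc : b ≠ c := fun h => hτ.ne (show (1 : Fin 3) ≠ 2 by decide) (by rw [← hb, ← hc, h])
    rw [← ha, ← hb, ← hc, parArea]
    congr 1
    simp only [refVert_succ, ← real_inner_self_eq_norm_sq, inner_sub_left, inner_sub_right,
      EuclideanSpace.inner_single_left]
    simp [hab, hac, hbc, hab.symm, hac.symm]
    norm_num
  have hset : Set.range (fun i => refVert (σ i)) =
      Set.range fun i => refVert (Fin.succAbove 0 i) := by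
    have : Set.range σ = Set.range (Fin.succAbove (0 : Fin 4)) := by
      rw [Fin.range_succAbove]
      exact Set.ext hrange
    rw [show (fun i => refVert (σ i)) = refVert ∘ σ from rfl,
      show (fun i => refVert (Fin.succAbove 0 i)) = refVert ∘ Fin.succAbove 0 from rfl,
      Set.range_comp, Set.range_comp, this]
  simp_rw [h1]
  have e1 := integral_image_triMap _ (injective_triMap_refVert hσ) f
  have e2 := integral_image_triMap _
    (injective_triMap_refVert (Fin.succAbove_right_injective (p := (0 : Fin 4)))) f
  rw [image_triMap, harea σ hσ hσ0] at e1
  rw [image_triMap, harea _ Fin.succAbove_right_injective fun i => Fin.succAbove_ne 0 i] at e2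
  rw [hset, e2] at e1
  exact (mul_left_cancel₀ (by positivity) e1).symm

lemma hasDerivAt_line {f : E → ℝ} (hf : ContDiff ℝ 1 f) (j : Fin 3) (x : E) (t : ℝ) :
    HasDerivAt (fun t => f (x + t • EuclideanSpace.single j (1 : ℝ)))
      (partialDeriv j f (x + t • EuclideanSpace.single j 1)) t := by
  have h1 : HasDerivAt (fun t : ℝ => x + t • (EuclideanSpace.single j (1 : ℝ) : E))
      (EuclideanSpace.single j 1) t := by
    simpa using ((hasDerivAt_id t).smul_const (EuclideanSpace.single j (1 : ℝ) : E)).const_add x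
  exact ((hf.differentiable (by simp)).differentiableAt.hasFDerivAt).comp_hasDerivAt t h1

lemma continuous_partialDeriv {f : E → ℝ} (hf : ContDiff ℝ 1 f) (j : Fin 3) :
    Continuous (partialDeriv j f) :=
  (hf.continuous_fderiv (by simp)).clm_apply continuous_const

lemma integral_refTet_partialDeriv {f : E → ℝ} (hf : ContDiff ℝ 1 f) (j : Fin 3) :
    ∫ x in refTet, partialDeriv j f x =
      (∫ y in refTri, f (triMap (fun i => refVert (Fin.succAbove 0 i)) y)) -
        ∫ y in refTri, f (triMap (fun i => refVert (j.succ.succAbove i)) y) := by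
  have hc := hf.continuous
  rw [integral_refTet_eq j (continuous_partialDeriv hf j), ← integral_top_face j f,
    ← integral_sub]
  · refine setIntegral_congr_fun measurableSet_refTri fun y _ => ?_
    have hcd := continuous_partialDeriv hf j
    simp only
    rw [intervalIntegral.integral_eq_sub_of_hasDerivAt
      (fun t _ => hasDerivAt_line hf j _ t) (by
        refine Continuous.intervalIntegrable ?_ _ _
        fun_prop)]
    simp
  · refine ContinuousOn.integrableOn_compact isCompact_refTri ?_
    fun_prop
  · refine ContinuousOn.integrableOn_compact isCompact_refTri ?_
    fun_prop

/-- The divergence theorem on the tetrahedron `A '' refTet`. -/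
lemma integral_partialDeriv (A : E ≃ᵃ[ℝ] E) {f : E → ℝ} (hf : ContDiff ℝ 1 f) (l : Fin 3) :
    ∫ x in A '' refTet, partialDeriv l f x = - vol A * ∑ i, gr A i l * triInt A i f := by
  rw [integral_image_affineEquiv A measurableSet_refTet]
  have hfA : ContDiff ℝ 1 (f ∘ A) := hf.comp ((contDiff_affineEquiv A).of_le (by simp))
  set c : Fin 3 → ℝ := fun j => A.linear.symm (EuclideanSpace.single l 1) j with hc
  have hl : EuclideanSpace.single l (1 : ℝ) = ∑ j, c j • A.linear (EuclideanSpace.single j 1) := by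
    have h1 : A.linear.symm (EuclideanSpace.single l 1) =
        ∑ j, c j • EuclideanSpace.single j (1 : ℝ) := by
      ext i
      simp [hc, Pi.single_apply]
    have h2 := congrArg A.linear h1
    simpa using h2
  have hchain : ∀ x, partialDeriv l f (A x) = ∑ j, c j * partialDeriv j (f ∘ A) x := by
    intro x
    have hd : HasFDerivAt (f ∘ A) _ x :=
      ((hf.differentiable (by simp)).differentiableAt.hasFDerivAt).comp x
        (hasFDerivAt_affineEquiv A x)
    simp only [partialDeriv, hd.fderiv]
    rw [hl, map_sum]
    simp
  simp_rw [hchain]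
  rw [integral_finsetSum _ fun j _ =>
    ((continuous_partialDeriv hfA j).continuousOn.integrableOn_compact
      isCompact_refTet).const_mul _]
  simp_rw [integral_const_mul, integral_refTet_partialDeriv hfA, Function.comp_apply,
    ← triMap_faceVert]
  have hg : ∀ i, gr A i l = ∑ j, nu i j * c j := by
    intro i
    rw [← inner_gr]
    simp [EuclideanSpace.inner_single_right]
  rw [Fin.sum_univ_succ (n := 3)]
  simp only [hg, nu_zero, nu_succ, triInt]
  simp [Finset.sum_sub_distrib, mul_sub, ← Finset.sum_mul]
  ring

/-! ### Unisolvence on the reference tetrahedron -/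

/-- Polynomial vector fields of degree at most `k`. -/
noncomputable def polyV (k : ℕ) : Submodule ℝ (Fin 3 → Poly) :=
  Submodule.pi Set.univ fun _ => MvPolynomial.restrictTotalDegree (Fin 3) ℝ k

lemma mem_polyV {k : ℕ} {q : Fin 3 → Poly} : q ∈ polyV k ↔ ∀ i, (q i).totalDegree ≤ k := by
  simp [polyV, Submodule.mem_pi, MvPolynomial.mem_restrictTotalDegree]

instance (k : ℕ) : FiniteDimensional ℝ (polyV k) := by
  let f : polyV k →ₗ[ℝ] (Fin 3 → MvPolynomial.restrictTotalDegree (Fin 3) ℝ k) :=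
    LinearMap.pi fun i => LinearMap.codRestrict _ (LinearMap.proj i ∘ₗ (polyV k).subtype)
      fun q => (MvPolynomial.mem_restrictTotalDegree _ _ _).2 (mem_polyV.1 q.2 i)
  refine FiniteDimensional.of_injective f fun p q h => ?_
  ext1
  funext i
  exact congrArg Subtype.val (congrFun h i)

/-- The inner product of `L²(refTet)³` on polynomial vector fields. -/
noncomputable def refInner : (Fin 3 → Poly) →ₗ[ℝ] (Fin 3 → Poly) →ₗ[ℝ] ℝ :=
  LinearMap.mk₂ ℝ (fun p q => ∫ x in refTet, ∑ i, peval x (p i) * peval x (q i))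
    (fun p p' q => by
      rw [← integral_add]
      · simp [add_mul, Finset.sum_add_distrib]
      all_goals exact ContinuousOn.integrableOn_compact isCompact_refTet (by fun_prop))
    (fun c p q => by
      rw [smul_eq_mul, ← integral_const_mul]
      simp [mul_assoc, Finset.mul_sum])
    (fun p q q' => by
      rw [← integral_add]
      · simp [mul_add, Finset.sum_add_distrib]
      all_goals exact ContinuousOn.integrableOn_compact isCompact_refTet (by fun_prop))
    (fun c p q => by
      rw [smul_eq_mul, ← integral_const_mul]
      simp [mul_left_comm, Finset.mul_sum])

lemma refInner_apply (p q : Fin 3 → Poly) :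
    refInner p q = ∫ x in refTet, ∑ i, peval x (p i) * peval x (q i) := rfl

/-- The fields `w` of degree at most `m` for which `x · w(x)` is of degree at most `m`: the Nédélec
space of order `m` on the reference tetrahedron, in a form that shows its affine invariance; it is
zero for `m = 0`. -/
noncomputable def refNedelec (m : ℕ) : Submodule ℝ (Fin 3 → Poly) where
  carrier := {w | (∀ i, (w i).totalDegree ≤ m) ∧
    (∑ i, MvPolynomial.X i * w i).totalDegree ≤ m}
  add_mem' := by
    rintro v w ⟨hv, hv'⟩ ⟨hw, hw'⟩
    refine ⟨fun i => totalDegree_add_le_of_le (hv i) (hw i), ?_⟩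
    simp only [Pi.add_apply, mul_add, Finset.sum_add_distrib]
    exact totalDegree_add_le_of_le hv' hw'
  zero_mem' := by simp
  smul_mem' := by
    rintro c w ⟨hw, hw'⟩
    refine ⟨fun i => (MvPolynomial.totalDegree_smul_le _ _).trans (hw i), ?_⟩
    simp only [Pi.smul_apply, mul_smul_comm, ← Finset.smul_sum]
    exact (MvPolynomial.totalDegree_smul_le _ _).trans hw'

lemma refNedelec_le_polyV (m : ℕ) : refNedelec m ≤ polyV m := fun _ hw => mem_polyV.2 hw.1

instance (m : ℕ) : FiniteDimensional ℝ (refNedelec m) :=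
  Submodule.finiteDimensional_of_le (refNedelec_le_polyV m)

/-- The splitting that defines the Nédélec space in terms of degrees. -/
lemma mem_refNedelec_iff_exists {m : ℕ} (hm : 1 ≤ m) {w : Fin 3 → Poly} :
    w ∈ refNedelec m ↔ ∃ p s : Fin 3 → Poly, (∀ i, (p i).totalDegree < m) ∧
      (∀ i, (s i).IsHomogeneous m) ∧ ∑ i, MvPolynomial.X i * s i = 0 ∧ ∀ i, w i = p i + s i := by
  obtain ⟨m, rfl⟩ : ∃ n, m = n + 1 := ⟨m - 1, by omega⟩
  constructor
  · rintro ⟨h1, h2⟩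
    refine ⟨fun i => w i - MvPolynomial.homogeneousComponent (m + 1) (w i),
      fun i => MvPolynomial.homogeneousComponent (m + 1) (w i), fun i => ?_, fun i => ?_, ?_,
      fun i => by ring⟩
    · exact Nat.lt_succ_of_le (totalDegree_sub_homogeneousComponent (h1 i))
    · exact MvPolynomial.homogeneousComponent_isHomogeneous _ _
    · set s := fun i => MvPolynomial.homogeneousComponent (m + 1) (w i) with hs
      have hhom : (∑ i, MvPolynomial.X i * s i).IsHomogeneous (1 + (m + 1)) :=
        MvPolynomial.IsHomogeneous.sum _ _ _ fun i _ => (MvPolynomial.isHomogeneous_X ℝ i).mul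
          (MvPolynomial.homogeneousComponent_isHomogeneous _ _)
      by_contra hne
      have hdeg := hhom.totalDegree hne
      have h3 : ∑ i, MvPolynomial.X i * s i = ∑ i, MvPolynomial.X i * w i
          - ∑ i, MvPolynomial.X i * (w i - s i) := by
        rw [← Finset.sum_sub_distrib]
        exact Finset.sum_congr rfl fun i _ => by ring
      have h4 : (∑ i, MvPolynomial.X i * s i).totalDegree ≤ m + 1 := by
        rw [h3]
        refine totalDegree_sub_le_of_le h2 (MvPolynomial.totalDegree_finsetSum_le fun i _ => ?_)
        rw [add_comm]
        exact totalDegree_mul_le_of_le (MvPolynomial.totalDegree_X i).le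
          (totalDegree_sub_homogeneousComponent (h1 i))
      omega
  · rintro ⟨p, s, hp, hs, h0, hw⟩
    refine ⟨fun i => ?_, ?_⟩
    · rw [hw]
      exact totalDegree_add_le_of_le (hp i).le (hs i).totalDegree_le
    · simp only [hw, mul_add, Finset.sum_add_distrib, h0, add_zero]
      refine MvPolynomial.totalDegree_finsetSum_le fun i _ => ?_
      rw [add_comm]
      exact totalDegree_mul_le_of_le (MvPolynomial.totalDegree_X i).le (Nat.lt_succ_iff.1 (hp i))

/-- The divergence of a polynomial vector field. -/
noncomputable def dvg : (Fin 3 → Poly) →ₗ[ℝ] Poly :=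
  ∑ j, (MvPolynomial.pderiv j).toLinearMap ∘ₗ LinearMap.proj j

lemma dvg_apply (q : Fin 3 → Poly) : dvg q = ∑ j, MvPolynomial.pderiv j (q j) := by
  simp [dvg]

/-- The normal component of `q` vanishes on all faces of the reference tetrahedron. -/
def ZeroTrace (q : Fin 3 → Poly) : Prop :=
  ∀ i, ∀ x ∈ refTet, peval x (lam i) = 0 → ∑ j, nu i j * peval x (q j) = 0

lemma triMap_mem_refTet (i : Fin 4) {y : EuclideanSpace ℝ (Fin 2)} (hy : y ∈ refTri) :
    triMap (fun j => refVert (i.succAbove j)) y ∈ refTet ∧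
      peval (triMap (fun j => refVert (i.succAbove j)) y) (lam i) = 0 := by
  have h1 : triMap (fun j => refVert (i.succAbove j)) y ∈ convexHull ℝ (refVert '' {i}ᶜ) := by
    have := Set.mem_image_of_mem (triMap fun j => refVert (i.succAbove j)) hy
    rw [image_triMap] at this
    convert! this using 2
    rw [← Fin.range_succAbove, ← Set.range_comp]
    rfl
  rw [convexHull_image_refVert] at h1
  exact ⟨mem_refTet.2 fun j => (h1 j).1, (h1 i).2 (by simp)⟩

/-- Integration by parts against a field without normal component on the boundary. -/
lemma ZeroTrace.integral_dvg_mul {q : Fin 3 → Poly} (hq : ZeroTrace q) (v : Poly) :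
    (∫ x in refTet, peval x (dvg q) * peval x v) +
      refInner q (fun j => MvPolynomial.pderiv j v) = 0 := by
  have h1 : ∀ j, ∫ x in refTet, peval x (MvPolynomial.pderiv j (q j * v)) =
      ∫ y in refTri, peval (triMap (fun i => refVert (Fin.succAbove 0 i)) y) (q j) *
        peval (triMap (fun i => refVert (Fin.succAbove 0 i)) y) v := by
    intro j
    have h := integral_refTet_partialDeriv
      ((contDiff_peval (q j * v)).of_le (by simp) : ContDiff ℝ 1 _) j
    simp only [partialDeriv_peval] at h
    rw [h, sub_eq_self.2]
    · simp
    · refine setIntegral_eq_zero_of_forall_eq_zero fun y hy => ?_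
      obtain ⟨hx, hl⟩ := triMap_mem_refTet j.succ hy
      have := hq j.succ _ hx hl
      simp only [nu_succ, ite_mul, one_mul, zero_mul, Finset.sum_ite_eq', Finset.mem_univ,
        if_true] at this
      rw [peval_mul, this, zero_mul]
  rw [refInner_apply, ← integral_add]
  · have h2 : ∀ x, peval x (dvg q) * peval x v +
        ∑ j, peval x (q j) * peval x (MvPolynomial.pderiv j v) =
        ∑ j, peval x (MvPolynomial.pderiv j (q j * v)) := by
      intro x
      simp only [dvg_apply, peval_sum, Finset.sum_mul, ← Finset.sum_add_distrib,
        MvPolynomial.pderiv_mul, peval_add, peval_mul]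
    simp_rw [h2]
    rw [integral_finsetSum _ fun j _ =>
      ContinuousOn.integrableOn_compact isCompact_refTet (by fun_prop)]
    simp_rw [h1]
    rw [← integral_finsetSum _ fun j _ =>
      ContinuousOn.integrableOn_compact isCompact_refTri (by fun_prop)]
    refine setIntegral_eq_zero_of_forall_eq_zero fun y hy => ?_
    obtain ⟨hx, hl⟩ := triMap_mem_refTet 0 hy
    have := hq 0 _ hx hl
    simp only [nu_zero, neg_mul, one_mul, Finset.sum_neg_distrib, neg_eq_zero] at this
    rw [← Finset.sum_mul, this, zero_mul]
  all_goals exact ContinuousOn.integrableOn_compact isCompact_refTet (by fun_prop)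

lemma eq_zero_of_peval_eq_zero {p : Poly} (h : ∀ x ∈ refInt, peval x p = 0) : p = 0 :=
  eq_of_peval_eq_on_isOpen isOpen_refInt refInt_nonempty fun x hx => by simp [h x hx]

lemma totalDegree_sum_X_mul_pderiv_le (p : Poly) :
    (∑ i, MvPolynomial.X i * MvPolynomial.pderiv i p).totalDegree ≤ p.totalDegree := by
  by_cases h : p.totalDegree = 0
  · obtain hp := MvPolynomial.totalDegree_eq_zero_iff_eq_C.1 h
    rw [hp]
    simp
  · refine MvPolynomial.totalDegree_finsetSum_le fun i _ => ?_
    refine (totalDegree_mul_le_of_le (MvPolynomial.totalDegree_X i).le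
      (totalDegree_pderiv_le i p)).trans ?_
    omega

/-- A vector field of degree `m` is a gradient plus an element of the Nédélec space of
order `m`. -/
lemma exists_eq_refNedelec_add_grad {m : ℕ} {ψ : Fin 3 → Poly} (hψ : ψ ∈ polyV m) :
    ∃ w ∈ refNedelec m, ∃ v : Poly, ψ = w + fun j => MvPolynomial.pderiv j v := by
  -- by Euler's identity, `v = x · h / (m + 1)` with the leading part `h` of `ψ` satisfies
  -- `x · ∇v = x · h`
  set h : Fin 3 → Poly := fun i => MvPolynomial.homogeneousComponent m (ψ i) with hh
  set v : Poly := MvPolynomial.C ((m + 1 : ℝ)⁻¹) * ∑ i, MvPolynomial.X i * h i with hv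
  have hvhom : v.IsHomogeneous (m + 1) := by
    refine MvPolynomial.IsHomogeneous.C_mul ?_ _
    refine MvPolynomial.IsHomogeneous.sum _ _ _ fun i _ => ?_
    rw [add_comm]
    exact (MvPolynomial.isHomogeneous_X ℝ i).mul
      (MvPolynomial.homogeneousComponent_isHomogeneous _ _)
  refine ⟨ψ - fun j => MvPolynomial.pderiv j v, ⟨fun i => ?_, ?_⟩, v, by simp⟩
  · exact totalDegree_sub_le_of_le (mem_polyV.1 hψ i) (hvhom.pderiv.totalDegree_le)
  · have hE := hvhom.sum_X_mul_pderiv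
    have h1 : ∑ i, MvPolynomial.X i * (ψ - fun j => MvPolynomial.pderiv j v) i =
        ∑ i, MvPolynomial.X i * (ψ i - h i) := by
      simp only [Pi.sub_apply, mul_sub, Finset.sum_sub_distrib, hE]
      congr 1
      rw [hv, nsmul_eq_mul, ← mul_assoc]
      have : ((m + 1 : ℕ) : Poly) * MvPolynomial.C ((m + 1 : ℝ)⁻¹) = 1 := by
        rw [← MvPolynomial.C_eq_coe_nat, ← MvPolynomial.C_mul, ← MvPolynomial.C_1]
        congr 1
        push_cast
        field_simp
      rw [this, one_mul]
    rw [h1]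
    refine MvPolynomial.totalDegree_finsetSum_le fun i _ => ?_
    cases m with
    | zero =>
      have h2 : ψ i = MvPolynomial.C (MvPolynomial.coeff 0 (ψ i)) :=
        MvPolynomial.totalDegree_eq_zero_iff_eq_C.1 (Nat.le_zero.1 (mem_polyV.1 hψ i))
      have h3 : ψ i - h i = 0 := by
        simp only [hh, MvPolynomial.homogeneousComponent_zero]
        rw [sub_eq_zero]; exact h2
      simp [h3]
    | succ m =>
      rw [add_comm]
      exact totalDegree_mul_le_of_le (MvPolynomial.totalDegree_X i).le
        (totalDegree_sub_homogeneousComponent (mem_polyV.1 hψ i))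

/-- Unisolvence: a field without normal component on the boundary and without interior
moments is zero. -/
lemma eq_zero_of_zeroTrace {m : ℕ} {q : Fin 3 → Poly} (hdeg : q ∈ polyV (m + 1))
    (htr : ZeroTrace q) (hmom : ∀ w ∈ refNedelec m, refInner q w = 0) : q = 0 := by
  -- testing with the gradient of the divergence shows that `q` is divergence free
  have hdiv : dvg q = 0 := by
    have hd : (dvg q).totalDegree ≤ m := by
      rw [dvg_apply]
      refine MvPolynomial.totalDegree_finsetSum_le fun j _ =>
        (totalDegree_pderiv_le j _).trans ?_
      have := mem_polyV.1 hdeg j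
      omega
    have h1 := htr.integral_dvg_mul (dvg q)
    rw [hmom _ ⟨fun i => (totalDegree_pderiv_le i _).trans (by omega),
      (totalDegree_sum_X_mul_pderiv_le _).trans hd⟩, add_zero] at h1
    refine eq_zero_of_peval_eq_zero fun x hx => ?_
    have := eq_zero_of_integral_refTet_eq_zero (by fun_prop)
      (fun x _ => mul_self_nonneg _) h1 x hx
    exact mul_self_eq_zero.1 this
  -- on the coordinate planes `q_j` vanishes, hence is divisible by `x_j`
  have hψ : ∀ j, ∃ ψ : Poly, q j = MvPolynomial.X j * ψ ∧ ψ.totalDegree ≤ m := by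
    intro j
    refine exists_eq_X_mul (mem_polyV.1 hdeg j) fun x hxj hx => ?_
    have hmem : x ∈ refTet := by
      have hb : ∀ i, 0 ≤ x i ∧ x i < 1 / 3 := fun i => by
        by_cases hij : i = j
        · rw [hij, hxj]; norm_num
        · exact ⟨(hx i hij).1.le, (hx i hij).2⟩
      refine mem_refTet.2 fun i => ?_
      refine Fin.cases ?_ (fun i => ?_) i
      · simp [Fin.sum_univ_three]
        linarith [(hb 0).2, (hb 1).2, (hb 2).2]
      · simpa using (hb i).1
    simpa using htr j.succ x hmem (by simpa using hxj)
  choose ψ hqψ hψdeg using hψ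
  -- `q` is orthogonal to gradients and to the Nédélec space, hence to `ψ`
  obtain ⟨w, hw, v, hwv⟩ := exists_eq_refNedelec_add_grad (mem_polyV.2 hψdeg)
  have h0 : refInner q ψ = 0 := by
    have h1 := htr.integral_dvg_mul v
    rw [hdiv] at h1
    simp only [peval_zero, zero_mul, integral_zero, zero_add] at h1
    rw [hwv, map_add, hmom w hw, h1, add_zero]
  -- the pairing with `ψ` is a weighted sum of squares
  rw [refInner_apply] at h0
  have hpt : ∀ x, ∑ i, peval x (q i) * peval x (ψ i) = ∑ i, x i * peval x (ψ i) ^ 2 := by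
    intro x
    refine Finset.sum_congr rfl fun i _ => ?_
    rw [hqψ, peval_mul, peval_X]; ring
  simp_rw [hpt] at h0
  have hz := eq_zero_of_integral_refTet_eq_zero (by fun_prop) (fun x hx => Finset.sum_nonneg
    fun i _ => mul_nonneg (by simpa using mem_refTet.1 hx i.succ) (sq_nonneg _)) h0
  funext j
  have : ψ j = 0 := by
    refine eq_zero_of_peval_eq_zero fun x hx => ?_
    have hpos : ∀ i : Fin 3, 0 < x i := fun i => by simpa using hx i.succ
    have := (Finset.sum_eq_zero_iff_of_nonneg fun i _ =>
      mul_nonneg (hpos i).le (sq_nonneg _)).1 (hz x hx) j (Finset.mem_univ j)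
    exact pow_eq_zero_iff (two_ne_zero) |>.1 ((mul_eq_zero.1 this).resolve_left (hpos j).ne')
  rw [hqψ, this, mul_zero]; rfl

/-- The bubble field `x_i (w_i - x · w)` of a vector field `w`. -/
noncomputable def bubble : (Fin 3 → Poly) →ₗ[ℝ] (Fin 3 → Poly) where
  toFun w i := MvPolynomial.X i * (w i - ∑ j, MvPolynomial.X j * w j)
  map_add' v w := by
    funext i
    simp only [Pi.add_apply, mul_add, Finset.sum_add_distrib]
    ring
  map_smul' c w := by
    funext i
    simp only [Pi.smul_apply, mul_smul_comm, ← Finset.smul_sum, ← smul_sub, RingHom.id_apply]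

lemma bubble_apply (w : Fin 3 → Poly) (i : Fin 3) :
    bubble w i = MvPolynomial.X i * (w i - ∑ j, MvPolynomial.X j * w j) := rfl

lemma zeroTrace_bubble (w : Fin 3 → Poly) : ZeroTrace (bubble w) := by
  intro i x _ hx
  revert hx
  refine Fin.cases (fun hx => ?_) (fun i hx => ?_) i
  · simp only [lam_zero, peval_sub, peval_one, peval_sum, peval_X] at hx
    simp only [bubble_apply, nu_zero, peval_mul, peval_X, peval_sub, peval_sum]
    simp only [mul_sub, Finset.sum_sub_distrib, neg_mul, one_mul, Finset.sum_neg_distrib,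
      ← Finset.sum_mul]
    linear_combination (-∑ j, x j * peval x (w j)) * hx
  · simp only [lam_succ, peval_X] at hx
    simp [bubble_apply, hx]

lemma bubble_mem_polyV {m : ℕ} {w : Fin 3 → Poly} (hw : w ∈ refNedelec m) :
    bubble w ∈ polyV (m + 1) := by
  refine mem_polyV.2 fun i => ?_
  rw [add_comm]
  exact totalDegree_mul_le_of_le (MvPolynomial.totalDegree_X i).le
    (totalDegree_sub_le_of_le (hw.1 i) hw.2)

/-- The pairing of a field with its bubble is positive definite, by the Cauchy-Schwarz
inequality. -/
lemma eq_zero_of_refInner_bubble {w : Fin 3 → Poly} (h : refInner (bubble w) w = 0) : w = 0 := by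
  rw [refInner_apply] at h
  have hle : ∀ x ∈ refTet, (1 - ∑ j, x j) * ∑ j, x j * peval x (w j) ^ 2 ≤
      ∑ i, peval x (bubble w i) * peval x (w i) := by
    intro x hx
    have hpos : ∀ i : Fin 3, 0 ≤ x i := fun i => by simpa using mem_refTet.1 hx i.succ
    have hcs : (∑ j, x j * peval x (w j)) ^ 2 ≤ (∑ j, x j) * ∑ j, x j * peval x (w j) ^ 2 := by
      refine Finset.sum_sq_le_sum_mul_sum_of_sq_le_mul _ (fun i _ => hpos i)
        (fun i _ => mul_nonneg (hpos i) (sq_nonneg _)) fun i _ => le_of_eq (by ring)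
    have heq : ∑ i, peval x (bubble w i) * peval x (w i) =
        ∑ j, x j * peval x (w j) ^ 2 - (∑ j, x j * peval x (w j)) ^ 2 := by
      simp only [bubble_apply, peval_mul, peval_X, peval_sub, peval_sum, sq (∑ j, _)]
      rw [Finset.sum_mul, ← Finset.sum_sub_distrib]
      exact Finset.sum_congr rfl fun i _ => by ring
    rw [heq]
    linarith
  have hnn : ∀ x ∈ refTet, 0 ≤ (1 - ∑ j, x j) * ∑ j, x j * peval x (w j) ^ 2 := by
    intro x hx
    have hpos : ∀ i : Fin 3, 0 ≤ x i := fun i => by simpa using mem_refTet.1 hx i.succ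
    exact mul_nonneg (by simpa using mem_refTet.1 hx 0)
      (Finset.sum_nonneg fun i _ => mul_nonneg (hpos i) (sq_nonneg _))
  have hz := eq_zero_of_integral_refTet_eq_zero (by fun_prop)
    (fun x hx => (hnn x hx).trans (hle x hx)) h
  funext j
  refine eq_zero_of_peval_eq_zero fun x hx => ?_
  have hpos : ∀ i : Fin 3, 0 < x i := fun i => by simpa using hx i.succ
  have h0 : 0 < 1 - ∑ j, x j := by simpa using hx 0
  have h1 := hle x (refInt_subset_refTet hx)
  rw [hz x hx] at h1
  have h2 : ∑ j, x j * peval x (w j) ^ 2 = 0 :=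
    le_antisymm (nonpos_of_mul_nonpos_right h1 h0)
      (Finset.sum_nonneg fun i _ => mul_nonneg (hpos i).le (sq_nonneg _))
  have := (Finset.sum_eq_zero_iff_of_nonneg fun i _ =>
      mul_nonneg (hpos i).le (sq_nonneg _)).1 h2 j (Finset.mem_univ j)
  exact pow_eq_zero_iff (two_ne_zero) |>.1 ((mul_eq_zero.1 this).resolve_left (hpos j).ne')

/-- The interior moments can be prescribed by bubble fields. -/
lemma exists_zeroTrace_refInner_eq (m : ℕ) (ℓ : (Fin 3 → Poly) →ₗ[ℝ] ℝ) :
    ∃ q ∈ polyV (m + 1), ZeroTrace q ∧ ∀ w ∈ refNedelec m, refInner q w = ℓ w := by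
  let Φ : refNedelec m →ₗ[ℝ] Module.Dual ℝ (refNedelec m) :=
    refInner.compl₁₂ (bubble ∘ₗ (refNedelec m).subtype) (refNedelec m).subtype
  have hinj : Function.Injective Φ := by
    refine (injective_iff_map_eq_zero Φ).2 fun w hw => ?_
    have : refInner (bubble w) w = 0 := LinearMap.congr_fun hw w
    exact Subtype.ext (eq_zero_of_refInner_bubble this)
  have hsurj : Function.Surjective Φ :=
    (LinearMap.injective_iff_surjective_of_finrank_eq_finrank
      (Subspace.dual_finrank_eq (K := ℝ) (V := refNedelec m)).symm).1 hinj
  obtain ⟨w, hw⟩ := hsurj (ℓ ∘ₗ (refNedelec m).subtype)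
  exact ⟨bubble w, bubble_mem_polyV w.2, zeroTrace_bubble w,
    fun v hv => LinearMap.congr_fun hw ⟨v, hv⟩⟩

lemma sum_nu_mul_refVert_sub (m i j : Fin 4) :
    ∑ l, nu m l * (refVert j l - refVert i l) =
      (if m = j then 1 else 0) - if m = i then 1 else 0 := by
  have h := peval_lam_add m (refVert i) (refVert j - refVert i)
  rw [add_sub_cancel, peval_lam_refVert, peval_lam_refVert] at h
  simp only [PiLp.sub_apply] at h
  linarith

/-- The normal component can be prescribed on one face and set to zero on the other ones. -/
lemma exists_trace_eq_single {k : ℕ} (hk : 1 ≤ k) (i : Fin 4) {g : Poly} (hg : g.totalDegree ≤ k) :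
    ∃ q ∈ polyV k, ∀ m, ∀ x : E, peval x (lam m) = 0 →
      ∑ l, nu m l * peval x (q l) = if m = i then peval x g else 0 := by
  -- With `g = G(λ)` for a form `G` of degree `k`, take `-(1/k) ∑ j, λ_j ∂_j G(λ) (r_j - r_i)`,
  -- where `r_j` are the vertices: its component normal to the face `m ≠ i` is a multiple of `λ_m`, and on
  -- the face `i` it is `g` by Euler's identity.
  obtain ⟨G, hG, hGg⟩ := exists_homogeneous_lift hg lam sum_lam lam_succ
  set D : Fin 4 → Poly := fun j => MvPolynomial.aeval lam (MvPolynomial.pderiv j G) with hD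
  have hEuler : ∑ j, lam j * D j = (k : ℝ) • g := by
    have h := congrArg (MvPolynomial.aeval lam) hG.sum_X_mul_pderiv
    simp only [map_sum, map_mul, MvPolynomial.aeval_X, map_nsmul, hGg] at h
    rw [h, Nat.cast_smul_eq_nsmul]
  refine ⟨fun l => MvPolynomial.C (-(k : ℝ)⁻¹) *
    ∑ j, (MvPolynomial.C (refVert j l - refVert i l) * (lam j * D j)), ?_, fun m x hx => ?_⟩
  · refine mem_polyV.2 fun l => totalDegree_C_mul_le_of_le _ ?_
    refine MvPolynomial.totalDegree_finsetSum_le fun j _ => totalDegree_C_mul_le_of_le _ ?_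
    have h1 : (D j).totalDegree ≤ k - 1 :=
      (totalDegree_aeval_le totalDegree_lam_le _).trans hG.pderiv.totalDegree_le
    refine (totalDegree_mul_le_of_le (totalDegree_lam_le j) h1).trans (by omega)
  · have h1 : ∀ l, nu m l * peval x (MvPolynomial.C (-(k : ℝ)⁻¹) *
        ∑ j, (MvPolynomial.C (refVert j l - refVert i l) * (lam j * D j))) =
        -(k : ℝ)⁻¹ * ∑ j, (nu m l * (refVert j l - refVert i l)) * peval x (lam j * D j) := by
      intro l
      simp only [peval_mul, peval_C, peval_sum, Finset.mul_sum]
      exact Finset.sum_congr rfl fun j _ => by ring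
    simp_rw [h1]
    rw [← Finset.mul_sum, Finset.sum_comm]
    simp_rw [← Finset.sum_mul, sum_nu_mul_refVert_sub, sub_mul, Finset.sum_sub_distrib]
    rw [← Finset.mul_sum, ← peval_sum, hEuler]
    simp only [ite_mul, one_mul, zero_mul, Finset.sum_ite_eq, Finset.mem_univ, if_true, peval_mul,
      peval_smul, hx]
    have hk0 : (k : ℝ) ≠ 0 := by positivity
    split_ifs
    · field_simp; ring
    · simp

/-- All normal components and all interior moments can be prescribed. -/
lemma exists_ref_interpolant {m : ℕ} {g : Fin 4 → Poly} (hg : ∀ i, (g i).totalDegree ≤ m + 1)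
    (ℓ : (Fin 3 → Poly) →ₗ[ℝ] ℝ) :
    ∃ q ∈ polyV (m + 1), (∀ i, ∀ x ∈ refTet, peval x (lam i) = 0 →
      ∑ j, nu i j * peval x (q j) = peval x (g i)) ∧
      ∀ w ∈ refNedelec m, refInner q w = ℓ w := by
  choose p hp hptr using fun i => exists_trace_eq_single (Nat.le_add_left 1 m) i (hg i)
  obtain ⟨b, hb, hbtr, hbmom⟩ := exists_zeroTrace_refInner_eq m (ℓ - refInner (∑ i, p i))
  refine ⟨∑ i, p i + b, Submodule.add_mem _ (Submodule.sum_mem _ fun i _ => hp i) hb,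
    fun i x hx hi => ?_, fun w hw => ?_⟩
  · simp only [Pi.add_apply, peval_add, mul_add, Finset.sum_add_distrib, hbtr i x hx hi, add_zero,
      Finset.sum_apply, peval_sum, Finset.mul_sum]
    rw [Finset.sum_comm]
    simp_rw [hptr _ i x hi]
    simp
  · rw [map_add, LinearMap.add_apply, hbmom w hw]
    simp

/-! ### The stability bound on the reference tetrahedron -/

/-- On a finite-dimensional space every quadratic form is bounded by a multiple of a given
positive definite one. -/
lemma exists_bound_of_posDef {V : Type*} [AddCommGroup V] [Module ℝ V] [FiniteDimensional ℝ V]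
    (B₁ B₂ : V →ₗ[ℝ] V →ₗ[ℝ] ℝ) (h : ∀ x, x ≠ 0 → 0 < B₂ x x) :
    ∃ C : ℝ, 0 < C ∧ ∀ x, B₁ x x ≤ C * B₂ x x := by
  let b := Module.finBasis ℝ V
  let e := b.equivFun
  have hcont : ∀ B : V →ₗ[ℝ] V →ₗ[ℝ] ℝ, Continuous fun y => B (e.symm y) (e.symm y) := by
    intro B
    have : (fun y => B (e.symm y) (e.symm y)) =
        fun y : Fin (Module.finrank ℝ V) → ℝ => ∑ i, ∑ j, y i * y j * B (b i) (b j) := by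
      funext y
      simp only [e, Module.Basis.equivFun_symm_apply, map_sum, LinearMap.sum_apply, map_smul,
        LinearMap.smul_apply, smul_eq_mul]
      rw [Finset.sum_comm]
      refine Finset.sum_congr rfl fun i _ => ?_
      rw [Finset.mul_sum]
      exact Finset.sum_congr rfl fun j _ => by ring
    rw [this]
    fun_prop
  have hpos : ∀ y ∈ Metric.sphere (0 : Fin (Module.finrank ℝ V) → ℝ) 1,
      0 < B₂ (e.symm y) (e.symm y) := by
    intro y hy
    refine h _ fun h0 => ?_
    have : y = 0 := by simpa using h0
    simp [this] at hy
  have hbdd : BddAbove ((fun y => B₁ (e.symm y) (e.symm y) / B₂ (e.symm y) (e.symm y)) ''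
      Metric.sphere 0 1) :=
    (isCompact_sphere _ _).bddAbove_image
      ((hcont B₁).continuousOn.div (hcont B₂).continuousOn fun y hy => (hpos y hy).ne')
  obtain ⟨C, hC⟩ := hbdd
  refine ⟨max C 1, by positivity, fun x => ?_⟩
  by_cases hx : x = 0
  · simp [hx]
  have hn : 0 < ‖e x‖ := norm_pos_iff.2 (by simpa using hx)
  set y := ‖e x‖⁻¹ • e x with hy
  have hys : y ∈ Metric.sphere (0 : Fin (Module.finrank ℝ V) → ℝ) 1 := by
    rw [mem_sphere_zero_iff_norm, hy, norm_smul, norm_inv, norm_norm, inv_mul_cancel₀ hn.ne']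
  have h1 := hC ⟨y, hys, rfl⟩
  have hxy : x = ‖e x‖ • e.symm y := by
    rw [hy, map_smul, smul_smul, mul_inv_cancel₀ hn.ne', one_smul, LinearEquiv.symm_apply_apply]
  simp only at h1
  rw [div_le_iff₀ (hpos y hys)] at h1
  have h2 : B₁ (e.symm y) (e.symm y) ≤ max C 1 * B₂ (e.symm y) (e.symm y) :=
    h1.trans (mul_le_mul_of_nonneg_right (le_max_left _ _) (hpos y hys).le)
  rw [hxy]
  simp only [map_smul, LinearMap.smul_apply, smul_eq_mul]
  nlinarith [mul_le_mul_of_nonneg_left h2 (mul_self_nonneg ‖e x‖)]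

/-- The normal component of `q` on the face opposite to the vertex `i` of the reference
tetrahedron, up to normalization. -/
noncomputable def refTrace (i : Fin 4) : (Fin 3 → Poly) →ₗ[ℝ] Poly :=
  ∑ j, nu i j • LinearMap.proj j

lemma peval_refTrace (i : Fin 4) (q : Fin 3 → Poly) (x : E) :
    peval x (refTrace i q) = ∑ j, nu i j * peval x (q j) := by
  simp [refTrace]

/-- The inner product of two polynomials on a face of the reference tetrahedron. -/
noncomputable def triInner (i : Fin 4) : Poly →ₗ[ℝ] Poly →ₗ[ℝ] ℝ :=
  LinearMap.mk₂ ℝ (fun p q => ∫ y in refTri,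
      peval (triMap (fun j => refVert (i.succAbove j)) y) p *
        peval (triMap (fun j => refVert (i.succAbove j)) y) q)
    (fun p p' q => by
      rw [← integral_add]
      · simp [add_mul]
      all_goals exact ContinuousOn.integrableOn_compact isCompact_refTri (by fun_prop))
    (fun c p q => by
      rw [smul_eq_mul, ← integral_const_mul]
      simp [mul_assoc])
    (fun p q q' => by
      rw [← integral_add]
      · simp [mul_add]
      all_goals exact ContinuousOn.integrableOn_compact isCompact_refTri (by fun_prop))
    (fun c p q => by
      rw [smul_eq_mul, ← integral_const_mul]
      simp [mul_left_comm])

lemma triInner_apply (i : Fin 4) (p q : Poly) : triInner i p q = ∫ y in refTri,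
    peval (triMap (fun j => refVert (i.succAbove j)) y) p *
      peval (triMap (fun j => refVert (i.succAbove j)) y) q := rfl

/-- A continuous nonnegative function with zero integral over the reference triangle vanishes
there. -/
lemma eq_zero_of_integral_refTri_eq_zero {f : EuclideanSpace ℝ (Fin 2) → ℝ} (hf : Continuous f)
    (h0 : ∀ x ∈ refTri, 0 ≤ f x) (hint : ∫ x in refTri, f x = 0) : ∀ x ∈ refTri, f x = 0 := by
  have h1 : f =ᵐ[volume.restrict refTri] 0 := by
    rwa [setIntegral_eq_zero_iff_of_nonneg_ae] at hint
    · exact (ae_restrict_iff' measurableSet_refTri).2 (Filter.Eventually.of_forall h0)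
    · exact hf.continuousOn.integrableOn_compact isCompact_refTri
  set U : Set (EuclideanSpace ℝ (Fin 2)) := {y | 0 < y 0 ∧ 0 < y 1 ∧ y 0 + y 1 < 1} with hU
  have hUo : IsOpen U := by
    have h0 : IsOpen {y : EuclideanSpace ℝ (Fin 2) | 0 < y 0} :=
      isOpen_lt continuous_const (by fun_prop)
    have h1 : IsOpen {y : EuclideanSpace ℝ (Fin 2) | 0 < y 1} :=
      isOpen_lt continuous_const (by fun_prop)
    have h2 : IsOpen {y : EuclideanSpace ℝ (Fin 2) | y 0 + y 1 < 1} :=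
      isOpen_lt (by fun_prop) continuous_const
    exact h0.inter (h1.inter h2)
  have hUsub : U ⊆ refTri := fun y hy => ⟨hy.1.le, hy.2.1.le, hy.2.2.le⟩
  have h2 : f =ᵐ[volume.restrict U] 0 := ae_mono (Measure.restrict_mono hUsub le_rfl) h1
  have h3 := Measure.eqOn_open_of_ae_eq h2 hUo hf.continuousOn continuousOn_const
  -- the triangle is contained in the closure of its interior
  have hcl : refTri ⊆ closure U := by
    intro y hy
    let p : EuclideanSpace ℝ (Fin 2) := WithLp.toLp 2 fun _ => 1 / 3
    have hlim : Filter.Tendsto (fun t : ℝ => y + t • (p - y)) (nhdsWithin 0 (Set.Ioi 0))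
        (nhds y) := by
      have : Continuous fun t : ℝ => y + t • (p - y) := by fun_prop
      simpa using (this.tendsto 0).mono_left nhdsWithin_le_nhds
    refine mem_closure_of_tendsto hlim ?_
    filter_upwards [Ioo_mem_nhdsGT (show (0 : ℝ) < 1 by norm_num)] with t ht
    obtain ⟨ht0, ht1⟩ := ht
    obtain ⟨hy0, hy1, hy2⟩ := hy
    refine ⟨?_, ?_, ?_⟩ <;> simp [p] <;> nlinarith
  intro x hx
  have := Set.EqOn.closure (f := f) (g := 0) h3 hf continuous_const
  exact this (hcl hx)

lemma exists_triMap_eq (i : Fin 4) {x : E} (hx : x ∈ refTet) (hi : peval x (lam i) = 0) :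
    ∃ y ∈ refTri, triMap (fun j => refVert (i.succAbove j)) y = x := by
  have h1 : x ∈ convexHull ℝ (refVert '' {i}ᶜ) := by
    rw [convexHull_image_refVert]
    refine fun j => ⟨mem_refTet.1 hx j, fun hj => ?_⟩
    have : j = i := by simpa using hj
    rw [this, hi]
  have h2 : triMap (fun j => refVert (i.succAbove j)) '' refTri =
      convexHull ℝ (refVert '' {i}ᶜ) := by
    rw [image_triMap, ← Fin.range_succAbove, ← Set.range_comp]
    rfl
  rw [← h2] at h1
  exact h1

lemma zeroTrace_of_triInner_eq_zero {q : Fin 3 → Poly}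
    (h : ∀ i, triInner i (refTrace i q) (refTrace i q) = 0) : ZeroTrace q := by
  intro i x hx hi
  obtain ⟨y, hy, rfl⟩ := exists_triMap_eq i hx hi
  have := eq_zero_of_integral_refTri_eq_zero (by fun_prop) (fun y _ => mul_self_nonneg _) (h i) y hy
  rw [← peval_refTrace]
  exact mul_self_eq_zero.1 this

lemma triInner_self_nonneg (i : Fin 4) (p : Poly) : 0 ≤ triInner i p p :=
  integral_nonneg fun _ => mul_self_nonneg _

/-- For fields without interior moments, the norm of the field and of its divergence is bounded
by the norm of the normal components on the faces. -/
lemma exists_ref_bound (m : ℕ) : ∃ C : ℝ, 0 < C ∧ ∀ q ∈ polyV (m + 1),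
    (∀ w ∈ refNedelec m, refInner q w = 0) →
    refInner q q ≤ C * ∑ i, triInner i (refTrace i q) (refTrace i q) ∧
    ∫ x in refTet, peval x (dvg q) ^ 2 ≤ C * ∑ i, triInner i (refTrace i q) (refTrace i q) := by
  -- on the space of the fields without interior moments the right side is positive definite,
  -- by unisolvence
  let V : Submodule ℝ (Fin 3 → Poly) := polyV (m + 1) ⊓
    { carrier := {q | ∀ w ∈ refNedelec m, refInner q w = 0}
      add_mem' := fun hp hq w hw => by simp [hp w hw, hq w hw]
      zero_mem' := fun w _ => by simp
      smul_mem' := fun c q hq w hw => by simp [hq w hw] }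
  have : FiniteDimensional ℝ V := Submodule.finiteDimensional_of_le inf_le_left
  let emb : Poly →ₗ[ℝ] (Fin 3 → Poly) := LinearMap.single ℝ (fun _ => Poly) 0
  have hemb : ∀ p, refInner (emb p) (emb p) = ∫ x in refTet, peval x p ^ 2 := by
    intro p
    simp [refInner_apply, Fin.sum_univ_three, emb, sq]
  let B₁ : V →ₗ[ℝ] V →ₗ[ℝ] ℝ := (refInner + refInner.compl₁₂ (emb ∘ₗ dvg) (emb ∘ₗ dvg)).compl₁₂
    V.subtype V.subtype
  let B₂ : V →ₗ[ℝ] V →ₗ[ℝ] ℝ := (∑ i, (triInner i).compl₁₂ (refTrace i) (refTrace i)).compl₁₂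
    V.subtype V.subtype
  have hB₁ : ∀ q : V, B₁ q q = refInner q q + ∫ x in refTet, peval x (dvg q) ^ 2 := fun q => by
    rw [← hemb]; rfl
  have hB₂ : ∀ q : V, B₂ q q = ∑ i, triInner i (refTrace i q) (refTrace i q) := fun q => by
    simp [B₂, LinearMap.sum_apply]
  obtain ⟨C, hC, hb⟩ := exists_bound_of_posDef B₁ B₂ fun q hq => by
    rw [hB₂]
    refine lt_of_le_of_ne (Finset.sum_nonneg fun i _ => triInner_self_nonneg _ _) fun h0 => hq ?_
    have h1 := (Finset.sum_eq_zero_iff_of_nonneg fun i _ => triInner_self_nonneg i _).1 h0.symm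
    exact Subtype.ext (eq_zero_of_zeroTrace q.2.1
      (zeroTrace_of_triInner_eq_zero fun i => h1 i (Finset.mem_univ i)) q.2.2)
  refine ⟨C, hC, fun q hq hmom => ?_⟩
  have h1 := hb ⟨q, hq, hmom⟩
  rw [hB₁, hB₂] at h1
  have h2 : 0 ≤ refInner q q :=
    integral_nonneg fun x => Finset.sum_nonneg fun i _ => mul_self_nonneg _
  have h3 : 0 ≤ ∫ x in refTet, peval x (dvg q) ^ 2 := integral_nonneg fun x => sq_nonneg _
  exact ⟨by linarith, by linarith⟩

/-! ### Transfer to an arbitrary tetrahedron -/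

/-- The composition of a polynomial with an affine map. -/
noncomputable def affComp (A : E ≃ᵃ[ℝ] E) : Poly →ₐ[ℝ] Poly :=
  MvPolynomial.aeval fun i => MvPolynomial.C (A 0 i) +
    ∑ j, MvPolynomial.C (A.linear (EuclideanSpace.single j 1) i) * MvPolynomial.X j

lemma affineEquiv_apply (A : E ≃ᵃ[ℝ] E) (x : E) (i : Fin 3) :
    A x i = A 0 i + ∑ j, A.linear (EuclideanSpace.single j 1) i * x j := by
  have h := map_sub_eq A x 0
  have hx : x = ∑ j, x j • EuclideanSpace.single j (1 : ℝ) := by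
    ext l
    simp [Pi.single_apply]
  have h2 : A.linear x = ∑ j, x j • A.linear (EuclideanSpace.single j 1) := by
    conv_lhs => rw [hx]
    simp
  have h3 : A x = A 0 + ∑ j, x j • A.linear (EuclideanSpace.single j 1) := by
    rw [← h2, ← sub_zero x, ← h, sub_zero]; abel
  rw [h3]
  simp [mul_comm]

@[simp] lemma peval_affComp (A : E ≃ᵃ[ℝ] E) (p : Poly) (x : E) :
    peval x (affComp A p) = peval (A x) p := by
  induction p using MvPolynomial.induction_on with
  | C c => simp [affComp, MvPolynomial.algebraMap_eq]
  | add p q hp hq => rw [map_add, peval_add, peval_add, hp, hq]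
  | mul_X p i hp =>
    rw [map_mul, peval_mul, peval_mul, hp, peval_X, affineEquiv_apply]
    simp [affComp]

lemma totalDegree_affComp_le (A : E ≃ᵃ[ℝ] E) (p : Poly) :
    (affComp A p).totalDegree ≤ p.totalDegree := by
  refine totalDegree_aeval_le (fun i => totalDegree_add_le_of_le (by simp) ?_) p
  exact MvPolynomial.totalDegree_finsetSum_le fun j _ =>
    totalDegree_C_mul_le_of_le _ (MvPolynomial.totalDegree_X j).le

lemma eq_of_forall_peval_eq {p q : Poly} (h : ∀ x, peval x p = peval x q) : p = q :=
  eq_of_peval_eq_on_isOpen isOpen_univ Set.univ_nonempty fun x _ => h x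

lemma peval_pderiv_affComp (A : E ≃ᵃ[ℝ] E) (p : Poly) (l : Fin 3) (x : E) :
    peval x (MvPolynomial.pderiv l (affComp A p)) =
      ∑ j, A.linear (EuclideanSpace.single l 1) j * peval (A x) (MvPolynomial.pderiv j p) := by
  rw [← partialDeriv_peval]
  simp_rw [peval_affComp]
  have h := (hasFDerivAt_peval p (A x)).comp x (hasFDerivAt_affineEquiv A x)
  rw [partialDeriv, show (fun y => peval (A y) p) = (fun y => peval y p) ∘ A from rfl, h.fderiv]
  simp [mul_comm]

/-- The value of a polynomial vector field as a vector. -/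
noncomputable def evec (q : Fin 3 → Poly) (x : E) : E := WithLp.toLp 2 fun i => peval x (q i)

@[simp] lemma evec_apply (q : Fin 3 → Poly) (x : E) (i : Fin 3) : evec q x i = peval x (q i) := rfl

@[fun_prop]
lemma continuous_evec (q : Fin 3 → Poly) : Continuous (evec q) :=
  (PiLp.continuous_toLp 2 _).comp (continuous_pi fun i => continuous_peval (q i))

/-- The contravariant transport of a vector field by an affine map, without the normalization of
the Piola transform. -/
noncomputable def push (A : E ≃ᵃ[ℝ] E) : (Fin 3 → Poly) →ₗ[ℝ] (Fin 3 → Poly) where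
  toFun q i := ∑ j, MvPolynomial.C (A.linear (EuclideanSpace.single j 1) i) * affComp A.symm (q j)
  map_add' p q := by
    funext i
    simp [mul_add, Finset.sum_add_distrib]
  map_smul' c q := by
    funext i
    simp [Finset.smul_sum]

lemma evec_push (A : E ≃ᵃ[ℝ] E) (q : Fin 3 → Poly) (x : E) :
    evec (push A q) (A x) = A.linear (evec q x) := by
  have h : evec q x = ∑ j, peval x (q j) • EuclideanSpace.single j (1 : ℝ) := by
    ext i
    simp [Pi.single_apply]
  ext i
  rw [h]
  simp [push, mul_comm]

lemma push_push_symm (A : E ≃ᵃ[ℝ] E) (q : Fin 3 → Poly) : push A (push A.symm q) = q := by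
  funext i
  refine eq_of_forall_peval_eq fun x => ?_
  obtain ⟨y, rfl⟩ := A.surjective x
  obtain ⟨z, rfl⟩ := A.symm.surjective y
  have h1 := evec_push A (push A.symm q) (A.symm z)
  rw [evec_push A.symm] at h1
  have h2 : A.linear (A.symm.linear (evec q z)) = evec q z := A.linear.apply_symm_apply _
  rw [h2] at h1
  simpa using congrFun (congrArg WithLp.ofLp h1) i

lemma push_mem_polyV (A : E ≃ᵃ[ℝ] E) {k : ℕ} {q : Fin 3 → Poly} (hq : q ∈ polyV k) :
    push A q ∈ polyV k := by
  refine mem_polyV.2 fun i => MvPolynomial.totalDegree_finsetSum_le fun j _ => ?_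
  exact totalDegree_C_mul_le_of_le _ ((totalDegree_affComp_le _ _).trans (mem_polyV.1 hq j))

lemma peval_dvg_push (A : E ≃ᵃ[ℝ] E) (q : Fin 3 → Poly) (x : E) :
    peval (A x) (dvg (push A q)) = peval x (dvg q) := by
  have h : ∀ j m : Fin 3, ∑ l, A.linear (EuclideanSpace.single j 1) l *
      A.symm.linear (EuclideanSpace.single l 1) m = if j = m then 1 else 0 := by
    intro j m
    have h1 : A.linear (EuclideanSpace.single j 1) =
        ∑ l, A.linear (EuclideanSpace.single j 1) l • EuclideanSpace.single l (1 : ℝ) := by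
      ext i
      simp [Pi.single_apply]
    have h2 : A.symm.linear (A.linear (EuclideanSpace.single j 1)) = EuclideanSpace.single j 1 :=
      A.linear.symm_apply_apply _
    rw [h1] at h2
    have h3 := congrFun (congrArg WithLp.ofLp h2) m
    simp only [map_sum, map_smul] at h3
    simpa [Pi.single_apply, eq_comm] using h3
  rw [dvg_apply, dvg_apply, peval_sum, peval_sum]
  have h1 : ∀ l, peval (A x) (MvPolynomial.pderiv l (push A q l)) = ∑ j, ∑ m,
      (A.linear (EuclideanSpace.single j 1) l * A.symm.linear (EuclideanSpace.single l 1) m) *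
        peval x (MvPolynomial.pderiv m (q j)) := by
    intro l
    simp only [push, LinearMap.coe_mk, AddHom.coe_mk, map_sum, MvPolynomial.pderiv_C_mul, peval_sum,
      peval_mul, peval_C, peval_pderiv_affComp, AffineEquiv.symm_apply_apply, Finset.mul_sum,
      mul_assoc]
  simp_rw [h1]
  rw [Finset.sum_comm]
  refine Finset.sum_congr rfl fun j _ => ?_
  rw [Finset.sum_comm]
  simp_rw [← Finset.sum_mul, h]
  simp

/-- The outward unit normal of the tetrahedron `A '' refTet` on the face opposite to the
vertex `i`. -/
noncomputable def normal (A : E ≃ᵃ[ℝ] E) (i : Fin 4) : E := (-‖gr A i‖⁻¹) • gr A i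

lemma norm_normal (A : E ≃ᵃ[ℝ] E) (i : Fin 4) : ‖normal A i‖ = 1 := by
  rw [normal, norm_smul, norm_neg, norm_inv, norm_norm, inv_mul_cancel₀ (norm_gr_pos A i).ne']

lemma gr_eq_smul_normal (A : E ≃ᵃ[ℝ] E) (i : Fin 4) : gr A i = (-‖gr A i‖) • normal A i := by
  rw [normal, smul_smul, neg_mul_neg, mul_inv_cancel₀ (norm_gr_pos A i).ne', one_smul]

lemma peval_refTrace_push_symm (A : E ≃ᵃ[ℝ] E) (q : Fin 3 → Poly) (i : Fin 4) (x : E) :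
    peval x (refTrace i (push A.symm q)) = inner ℝ (gr A i) (evec q (A x)) := by
  have h := evec_push A.symm q (A x)
  rw [AffineEquiv.symm_apply_apply] at h
  have h2 : A.symm.linear (evec q (A x)) = A.linear.symm (evec q (A x)) := rfl
  rw [inner_gr, peval_refTrace, ← h2, ← h]
  rfl

/-- The interior moments of `q` on the tetrahedron `A '' refTet` are those of `f`. -/
def SameMoments (A : E ≃ᵃ[ℝ] E) (m : ℕ) (q f : Fin 3 → Poly) : Prop :=
  ∀ w ∈ refNedelec m, refInner (push A.symm q) w = refInner (push A.symm f) w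

/-- The duality between the contravariant transport `push` and the covariant transport of the
Nédélec space. -/
lemma integral_mul_covariant (A : E ≃ᵃ[ℝ] E) (q ŵ : Fin 3 → Poly) {w : E → E}
    (hw : ∀ x, w (A x) = LinearMap.adjoint (A.linear.symm : E →ₗ[ℝ] E) (evec ŵ x)) :
    ∫ x in A '' refTet, ∑ j, peval x (q j) * w x j = vol A * refInner (push A.symm q) ŵ := by
  rw [integral_image_affineEquiv A measurableSet_refTet, refInner_apply]
  congr 2
  funext x
  have h1 : ∑ j, peval (A x) (q j) * w (A x) j = inner ℝ (w (A x)) (evec q (A x)) := by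
    simp [PiLp.inner_apply]
  have h := evec_push A.symm q (A x)
  rw [AffineEquiv.symm_apply_apply] at h
  have h2 : A.symm.linear (evec q (A x)) = A.linear.symm (evec q (A x)) := rfl
  rw [h1, hw, LinearMap.adjoint_inner_left]
  rw [LinearEquiv.coe_coe, ← h2, ← h]
  simp [PiLp.inner_apply]

/-- The Nédélec space on a tetrahedron does not depend on the choice of the affine map. -/
lemma exists_of_mem_nedelec {m : ℕ} (hm : 1 ≤ m) {K : Finset E} {w : E → E} (hw : w ∈ nedelec m K)
    (A : E ≃ᵃ[ℝ] E) : ∃ ŵ ∈ refNedelec m,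
      ∀ x, w (A x) = LinearMap.adjoint (A.linear.symm : E →ₗ[ℝ] E) (evec ŵ x) := by
  obtain ⟨A', -, p, s, hp, hs, h0, hw⟩ := hw
  have hmem := (mem_refNedelec_iff_exists hm).2 ⟨p, s, hp, hs, h0, fun i => rfl⟩
  set w' : Fin 3 → Poly := fun i => p i + s i with hw'
  let S : E ≃ᵃ[ℝ] E := A.trans A'.symm
  refine ⟨fun i => ∑ j, MvPolynomial.C (S.linear (EuclideanSpace.single i 1) j) * affComp S (w' j),
    ⟨fun i => ?_, ?_⟩, fun x => ?_⟩
  · exact MvPolynomial.totalDegree_finsetSum_le fun j _ => totalDegree_C_mul_le_of_le _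
      ((totalDegree_affComp_le _ _).trans (hmem.1 j))
  · have key : ∑ i, MvPolynomial.X i *
        ∑ j, MvPolynomial.C (S.linear (EuclideanSpace.single i 1) j) * affComp S (w' j) =
        affComp S (∑ j, MvPolynomial.X j * w' j) -
          ∑ j, MvPolynomial.C (S 0 j) * affComp S (w' j) := by
      have hX : ∀ j, affComp S (MvPolynomial.X j) = MvPolynomial.C (S 0 j) +
          ∑ i, MvPolynomial.C (S.linear (EuclideanSpace.single i 1) j) * MvPolynomial.X i :=
        fun j => by rw [affComp, MvPolynomial.aeval_X]
      simp only [map_sum, map_mul, hX, add_mul, Finset.sum_add_distrib, Finset.sum_mul,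
        Finset.mul_sum, add_sub_cancel_left]
      rw [Finset.sum_comm]
      exact Finset.sum_congr rfl fun i _ => Finset.sum_congr rfl fun j _ => by ring
    rw [key]
    refine totalDegree_sub_le_of_le ((totalDegree_affComp_le _ _).trans hmem.2) ?_
    exact MvPolynomial.totalDegree_finsetSum_le fun j _ => totalDegree_C_mul_le_of_le _
      ((totalDegree_affComp_le _ _).trans (hmem.1 j))
  · have h1 : A x = A' (S x) := by simp [S]
    rw [h1, hw]
    refine ext_inner_right ℝ fun u => ?_
    rw [LinearMap.adjoint_inner_left, LinearMap.adjoint_inner_left]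
    obtain ⟨v, rfl⟩ := A.linear.surjective u
    have h2 : A'.linear.symm (A.linear v) = S.linear v := rfl
    rw [LinearEquiv.coe_coe, LinearEquiv.coe_coe, LinearEquiv.symm_apply_apply, h2]
    have hv : v = ∑ i, v i • EuclideanSpace.single i (1 : ℝ) := by
      ext l
      simp [Pi.single_apply]
    have h3 : ∀ j, S.linear v j = ∑ i, v i * S.linear (EuclideanSpace.single i 1) j := by
      intro j
      conv_lhs => rw [hv]
      simp
    simp only [PiLp.inner_apply, RCLike.inner_apply, conj_trivial, h3, evec_apply, peval_sum,
      peval_mul, peval_C, peval_affComp, Finset.sum_mul, Finset.mul_sum]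
    rw [Finset.sum_comm]
    exact Finset.sum_congr rfl fun i _ => Finset.sum_congr rfl fun j _ => by ring

/-- The transport of the reference Nédélec space by any parametrization of `K` lies in the Nédélec
space of `K`. -/
lemma mem_nedelec_of_mem_refNedelec {m : ℕ} (hm : 1 ≤ m) {K : Finset E} {A : E ≃ᵃ[ℝ] E}
    (hA : A '' refTet = hull K) {ŵ : Fin 3 → Poly} (h : ŵ ∈ refNedelec m) :
    (fun x => LinearMap.adjoint (A.linear.symm : E →ₗ[ℝ] E) (evec ŵ (A.symm x))) ∈ nedelec m K := by
  obtain ⟨p, s, hp, hs, h0, hw⟩ := (mem_refNedelec_iff_exists hm).1 h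
  refine ⟨A, hA, p, s, hp, hs, h0, fun x => ?_⟩
  simp only [AffineEquiv.symm_apply_apply, evec, hw]

lemma refNedelec_zero {w : Fin 3 → Poly} (hw : w ∈ refNedelec 0) : w = 0 := by
  have h : ∀ i, w i = MvPolynomial.C (MvPolynomial.coeff 0 (w i)) := fun i =>
    MvPolynomial.totalDegree_eq_zero_iff_eq_C.1 (Nat.le_zero.1 (hw.1 i))
  have h2 := MvPolynomial.totalDegree_eq_zero_iff_eq_C.1 (Nat.le_zero.1 hw.2)
  have h3 : ∀ x : E, ∑ i, x i * MvPolynomial.coeff 0 (w i) = 0 := by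
    intro x
    have e1 := congrArg (peval x) h2
    have e2 := congrArg (peval 0) h2
    simp only [peval_sum, peval_mul, peval_X, peval_C] at e1 e2
    rw [← e2] at e1
    simp only [PiLp.zero_apply, zero_mul, Finset.sum_const_zero] at e1
    rw [← e1]
    refine Finset.sum_congr rfl fun i _ => ?_
    conv_rhs => rw [h i, peval_C]
  funext j
  have := h3 (EuclideanSpace.single j 1)
  simp at this
  rw [h j, this]
  simp

/-- The interior moments on a tetrahedron in terms of the reference tetrahedron. -/
lemma sameMoments_iff {m : ℕ} (hm : 1 ≤ m) {K : Finset E} {A : E ≃ᵃ[ℝ] E}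
    (hA : A '' refTet = hull K) (q f : Fin 3 → Poly) :
    SameMoments A m q f ↔ ∀ w ∈ nedelec m K, ∫ x in hull K, ∑ j, peval x (q j) * w x j =
      ∫ x in hull K, ∑ j, peval x (f j) * w x j := by
  rw [← hA]
  constructor
  · intro h w hw
    obtain ⟨ŵ, hŵ, hwŵ⟩ := exists_of_mem_nedelec hm hw A
    rw [integral_mul_covariant A q ŵ hwŵ, integral_mul_covariant A f ŵ hwŵ, h ŵ hŵ]
  · intro h ŵ hŵ
    have h1 := h _ (mem_nedelec_of_mem_refNedelec hm hA hŵ)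
    rw [integral_mul_covariant A q ŵ fun x => by simp,
      integral_mul_covariant A f ŵ fun x => by simp] at h1
    exact mul_left_cancel₀ (vol_pos A).ne' h1

/-- The face opposite to the vertex `i` of the tetrahedron `A '' refTet`. -/
def faceHull (A : E ≃ᵃ[ℝ] E) (i : Fin 4) : Set E := convexHull ℝ (Set.range (faceVert A i))

lemma mem_faceHull {A : E ≃ᵃ[ℝ] E} {i : Fin 4} {x : E} :
    A x ∈ faceHull A i ↔ x ∈ refTet ∧ peval x (lam i) = 0 := by
  constructor
  · intro h
    rw [faceHull, ← image_triMap] at h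
    obtain ⟨y, hy, hyx⟩ := h
    rw [triMap_faceVert] at hyx
    rw [← A.injective hyx]
    exact triMap_mem_refTet i hy
  · rintro ⟨h1, h2⟩
    obtain ⟨y, hy, rfl⟩ := exists_triMap_eq i h1 h2
    rw [faceHull, ← image_triMap, ← triMap_faceVert]
    exact ⟨y, hy, rfl⟩

/-- Unisolvence on a tetrahedron: the normal components on the faces and the interior moments
determine a field of degree `m + 1`. -/
lemma eq_of_normal_eq {m : ℕ} (A : E ≃ᵃ[ℝ] E) {q f : Fin 3 → Poly} (hq : q ∈ polyV (m + 1))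
    (hf : f ∈ polyV (m + 1)) (hmom : SameMoments A m q f)
    (htr : ∀ i, ∀ x ∈ faceHull A i, inner ℝ (normal A i) (evec q x) =
      inner ℝ (normal A i) (evec f x)) : q = f := by
  have h0 : push A.symm (q - f) = 0 := by
    refine eq_zero_of_zeroTrace (push_mem_polyV _ (Submodule.sub_mem _ hq hf))
      (fun i x hx hi => ?_) fun w hw => ?_
    · rw [← peval_refTrace, map_sub, map_sub, peval_sub, peval_refTrace_push_symm,
        peval_refTrace_push_symm, gr_eq_smul_normal, inner_smul_left, inner_smul_left,
        htr i _ (mem_faceHull.2 ⟨hx, hi⟩), sub_self]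
    · rw [map_sub, map_sub, LinearMap.sub_apply, hmom w hw, sub_self]
  have h1 := push_push_symm A (q - f)
  rw [h0, map_zero] at h1
  exact (sub_eq_zero.1 h1.symm)

/-- Interpolation on a tetrahedron: a field of degree `m + 1` with given normal components on the
faces and given interior moments. -/
lemma exists_interpolant {m : ℕ} (A : E ≃ᵃ[ℝ] E) {g : Fin 4 → Poly}
    (hg : ∀ i, (g i).totalDegree ≤ m + 1) (f : Fin 3 → Poly) :
    ∃ q ∈ polyV (m + 1), SameMoments A m q f ∧
      ∀ i, ∀ x ∈ faceHull A i, inner ℝ (normal A i) (evec q x) = peval x (g i) := by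
  obtain ⟨q, hq, htr, hmom⟩ := exists_ref_interpolant (m := m)
    (g := fun i => MvPolynomial.C (-‖gr A i‖) * affComp A (g i))
    (fun i => totalDegree_C_mul_le_of_le _ ((totalDegree_affComp_le _ _).trans (hg i)))
    (refInner (push A.symm f))
  have hpq : push A.symm (push A q) = q := push_push_symm A.symm q
  refine ⟨push A q, push_mem_polyV A hq, fun w hw => ?_, fun i x hx => ?_⟩
  · rw [hpq]; exact hmom w hw
  · obtain ⟨y, rfl⟩ := A.surjective x
    obtain ⟨hy, hi⟩ := mem_faceHull.1 hx
    have h1 := htr i y hy hi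
    have h2 : inner ℝ (gr A i) (evec (push A q) (A y)) =
        -‖gr A i‖ * inner ℝ (normal A i) (evec (push A q) (A y)) := by
      conv_lhs => rw [gr_eq_smul_normal]
      rw [inner_smul_left, conj_trivial]
    rw [← peval_refTrace, ← hpq, peval_refTrace_push_symm, h2] at h1
    simp only [peval_mul, peval_C, peval_affComp] at h1
    exact mul_left_cancel₀ (neg_ne_zero.2 (norm_gr_pos A i).ne') h1

/-- The stability bound on a tetrahedron: `D` bounds the lengths of the edges from one vertex,
and the norms of the gradients of the barycentric coordinates are the reciprocal heights. -/
lemma exists_bound (m : ℕ) : ∃ C : ℝ, 0 < C ∧ ∀ (A : E ≃ᵃ[ℝ] E) (q : Fin 3 → Poly) (D : ℝ),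
    q ∈ polyV (m + 1) → SameMoments A m q 0 →
    (∀ j, ‖A.linear (EuclideanSpace.single j 1)‖ ≤ D) →
    ∫ x in A '' refTet, ‖evec q x‖ ^ 2 ≤ C * D ^ 2 * ∑ i, ‖gr A i‖ *
      ∫ x in faceHull A i, inner ℝ (normal A i) (evec q x) ^ 2
        ∂(Measure.euclideanHausdorffMeasure 2) ∧
    ∫ x in A '' refTet, peval x (dvg q) ^ 2 ≤ C * ∑ i, ‖gr A i‖ *
      ∫ x in faceHull A i, inner ℝ (normal A i) (evec q x) ^ 2
        ∂(Measure.euclideanHausdorffMeasure 2) := by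
  obtain ⟨C, hC, hb⟩ := exists_ref_bound m
  refine ⟨3 * C, by positivity, fun A q D hq hmom hD => ?_⟩
  set p := push A.symm q with hp
  have hpq : push A p = q := push_push_symm A q
  obtain ⟨h1, h2⟩ := hb p (push_mem_polyV _ hq) fun w hw => by
    have := hmom w hw
    rwa [map_zero, map_zero, LinearMap.zero_apply] at this
  have hface : ∀ i, ‖gr A i‖ * ∫ x in faceHull A i, inner ℝ (normal A i) (evec q x) ^ 2
      ∂(Measure.euclideanHausdorffMeasure 2) =
      vol A * triInner i (refTrace i p) (refTrace i p) := by
    intro i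
    have h3 : ∀ y, inner ℝ (normal A i) (evec q (triMap (faceVert A i) y)) ^ 2 = (‖gr A i‖ ^ 2)⁻¹ *
        (peval (triMap (fun j => refVert (i.succAbove j)) y) (refTrace i p) *
        peval (triMap (fun j => refVert (i.succAbove j)) y) (refTrace i p)) := by
      intro y
      rw [hp, peval_refTrace_push_symm, ← triMap_faceVert, normal, inner_smul_left]
      simp only [conj_trivial]
      ring
    have hg := (norm_gr_pos A i).ne'
    rw [faceHull, integral_face, triInt, triInner_apply]
    simp_rw [h3]
    rw [integral_const_mul]
    field_simp
  simp_rw [hface]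
  rw [← Finset.mul_sum]
  set s := ∑ i, triInner i (refTrace i p) (refTrace i p) with hs
  have hs0 : 0 ≤ s := Finset.sum_nonneg fun i _ => triInner_self_nonneg _ _
  have hv := vol_pos A
  have hD0 : 0 ≤ D := (norm_nonneg _).trans (hD 0)
  rw [integral_image_affineEquiv A measurableSet_refTet,
    integral_image_affineEquiv A measurableSet_refTet]
  constructor
  · have hpt : ∀ x, ‖evec q (A x)‖ ^ 2 ≤ 3 * D ^ 2 * ∑ i, peval x (p i) * peval x (p i) := by
      intro x
      rw [← hpq, evec_push]
      have hx : evec p x = ∑ j, peval x (p j) • EuclideanSpace.single j (1 : ℝ) := by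
        ext l
        simp [Pi.single_apply]
      rw [hx, map_sum]
      have hle : ‖∑ j, A.linear (peval x (p j) • EuclideanSpace.single j (1 : ℝ))‖ ≤
          D * ∑ j, |peval x (p j)| := by
        rw [Finset.mul_sum]
        refine (norm_sum_le _ _).trans (Finset.sum_le_sum fun j _ => ?_)
        rw [map_smul, norm_smul, Real.norm_eq_abs, mul_comm]
        exact mul_le_mul_of_nonneg_right (hD j) (abs_nonneg _)
      have hcs : (∑ j, |peval x (p j)|) ^ 2 ≤ 3 * ∑ i, peval x (p i) * peval x (p i) := by
        have := sq_sum_le_card_mul_sum_sq (s := (Finset.univ : Finset (Fin 3)))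
          (f := fun j => |peval x (p j)|)
        simpa [sq] using this
      calc _ ≤ (D * ∑ j, |peval x (p j)|) ^ 2 := by gcongr
        _ = D ^ 2 * (∑ j, |peval x (p j)|) ^ 2 := by ring
        _ ≤ D ^ 2 * (3 * ∑ i, peval x (p i) * peval x (p i)) := by gcongr
        _ = _ := by ring
    have hint : ∫ x in refTet, ‖evec q (A x)‖ ^ 2 ≤ 3 * D ^ 2 * refInner p p := by
      rw [refInner_apply, ← integral_const_mul]
      refine integral_mono ?_ ?_ hpt
      all_goals exact ContinuousOn.integrableOn_compact isCompact_refTet (by fun_prop)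
    calc _ ≤ vol A * (3 * D ^ 2 * refInner p p) := by gcongr
      _ ≤ vol A * (3 * D ^ 2 * (C * s)) := by gcongr
      _ = _ := by ring
  · have hdv : ∀ x, peval (A x) (dvg q) = peval x (dvg p) := fun x => by
      rw [← hpq, peval_dvg_push]
    simp_rw [hdv]
    calc _ ≤ vol A * (C * s) := by gcongr
      _ ≤ 3 * C * (vol A * s) := by nlinarith [mul_nonneg hv.le (mul_nonneg hC.le hs0)]

/-- A height of a tetrahedron is at least the diameter of an inscribed ball. -/
lemma norm_gr_le (A : E ≃ᵃ[ℝ] E) (i : Fin 4) {x : E} {r : ℝ} (hr : 0 < r)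
    (h : Metric.closedBall x r ⊆ A '' refTet) : ‖gr A i‖ * (2 * r) ≤ 1 := by
  -- the barycentric coordinate takes values in the unit interval along a diameter of the ball
  set u := ‖gr A i‖⁻¹ • gr A i with hu
  have hun : ‖u‖ = 1 := by
    rw [hu, norm_smul, norm_inv, norm_norm, inv_mul_cancel₀ (norm_gr_pos A i).ne']
  obtain ⟨y, hy, hy'⟩ := h (show x + r • u ∈ Metric.closedBall x r by
    simp [norm_smul, hun, abs_of_pos hr])
  obtain ⟨z, hz, hz'⟩ := h (show x - r • u ∈ Metric.closedBall x r by
    simp [norm_smul, hun, abs_of_pos hr])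
  have h1 := inner_gr_map_sub A i y z
  have h2 : A y - A z = (2 * r) • u := by
    rw [hy', hz', two_mul, add_smul]; abel
  have h3 : inner ℝ (gr A i) u = ‖gr A i‖ := by
    have := (norm_gr_pos A i).ne'
    rw [hu, inner_smul_right, real_inner_self_eq_norm_sq]
    field_simp
  rw [h2, inner_smul_right, h3] at h1
  have h4 : peval y (lam i) ≤ 1 := by
    rw [← sum_peval_lam y]
    exact Finset.single_le_sum (fun j _ => mem_refTet.1 hy j) (Finset.mem_univ i)
  linarith [mem_refTet.1 hz i]

/-! ### Tetrahedra in barycentric coordinates -/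

/-- `A` maps the vertices of the reference tetrahedron onto those of `K`. -/
def Frame (A : E ≃ᵃ[ℝ] E) (K : Finset E) : Prop := (K : Set E) = Set.range fun i => A (refVert i)

lemma exists_frame {K : Finset E} (hcard : K.card = 4)
    (hind : AffineIndependent ℝ ((↑) : K → E)) : ∃ A : E ≃ᵃ[ℝ] E, Frame A K := by
  let e : Fin 4 ≃ K := (K.equivFinOfCardEq hcard).symm
  let v : Fin 4 → E := fun i => e i
  have hv : AffineIndependent ℝ v := hind.comp_embedding e.toEmbedding
  have hlin := (affineIndependent_iff_linearIndependent_vsub ℝ v 0).1 hv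
  have hlin2 : LinearIndependent ℝ fun i : Fin 3 => v i.succ - v 0 :=
    hlin.comp (fun i : Fin 3 => (⟨i.succ, Fin.succ_ne_zero i⟩ : {x : Fin 4 // x ≠ 0}))
      fun i j h => by simpa using h
  let b := basisOfLinearIndependentOfCardEqFinrank hlin2 (by simp)
  let L : E ≃ₗ[ℝ] E := (EuclideanSpace.basisFun (Fin 3) ℝ).toBasis.equiv b (Equiv.refl _)
  have hL : ∀ i : Fin 3, L (EuclideanSpace.single i 1) = v i.succ - v 0 := by
    intro i
    have := (EuclideanSpace.basisFun (Fin 3) ℝ).toBasis.equiv_apply i b (Equiv.refl _)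
    simpa [b] using this
  refine ⟨L.toAffineEquiv.trans (AffineEquiv.constVAdd ℝ E (v 0)), ?_⟩
  have h : ∀ i, (L.toAffineEquiv.trans (AffineEquiv.constVAdd ℝ E (v 0))) (refVert i) = v i := by
    intro i
    refine Fin.cases ?_ (fun i => ?_) i
    · simp
    · simp [hL]
  rw [Frame]
  simp_rw [h]
  ext x
  constructor
  · intro hx
    exact ⟨e.symm ⟨x, hx⟩, by simp [v]⟩
  · rintro ⟨i, rfl⟩
    exact (e i).2

/-- The barycentric coordinates of the tetrahedron `A '' refTet`. -/
noncomputable def bary (A : E ≃ᵃ[ℝ] E) (i : Fin 4) (x : E) : ℝ := peval (A.symm x) (lam i)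

lemma bary_sub (A : E ≃ᵃ[ℝ] E) (i : Fin 4) (x y : E) :
    bary A i x - bary A i y = inner ℝ (gr A i) (x - y) := by
  have := inner_gr_map_sub A i (A.symm x) (A.symm y)
  simp only [AffineEquiv.apply_symm_apply] at this
  exact this.symm

@[fun_prop]
lemma continuous_bary (A : E ≃ᵃ[ℝ] E) (i : Fin 4) : Continuous (bary A i) :=
  (continuous_peval (lam i)).comp (continuous_affineEquiv A.symm)

lemma bary_vertex (A : E ≃ᵃ[ℝ] E) (i j : Fin 4) :
    bary A i (A (refVert j)) = if i = j then 1 else 0 := by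
  rw [bary, AffineEquiv.symm_apply_apply, peval_lam_refVert]

lemma bary_sum (A : E ≃ᵃ[ℝ] E) (i : Fin 4) {F : Finset E} {w : E → ℝ} (hw : ∑ v ∈ F, w v = 1) :
    bary A i (∑ v ∈ F, w v • v) = ∑ v ∈ F, w v * bary A i v := by
  set x := ∑ v ∈ F, w v • v with hx
  have h1 : ∑ v ∈ F, w v * (bary A i v - bary A i x) = 0 := by
    simp_rw [bary_sub, ← inner_smul_right]
    rw [← inner_sum]
    simp_rw [smul_sub]
    rw [Finset.sum_sub_distrib, ← Finset.sum_smul, hw, one_smul, ← hx, sub_self, inner_zero_right]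
  simp_rw [mul_sub] at h1
  rw [Finset.sum_sub_distrib, ← Finset.sum_mul, hw, one_mul] at h1
  linarith

lemma sum_bary (A : E ≃ᵃ[ℝ] E) (x : E) : ∑ i, bary A i x = 1 := sum_peval_lam _

lemma sum_bary_smul (A : E ≃ᵃ[ℝ] E) (x : E) : ∑ i, bary A i x • A (refVert i) = x := by
  have h : A.symm x = ∑ i, bary A i x • refVert i := (sum_peval_lam_smul _).symm
  have h1 : ∑ i, bary A i x • (A (refVert i) - A 0) = x - A 0 := by
    simp_rw [map_sub_eq, sub_zero]
    have : A.linear (A.symm x) = x - A 0 := by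
      have := map_sub_eq A (A.symm x) 0
      simpa using this.symm
    rw [← this, h]
    simp
  simp_rw [smul_sub] at h1
  rw [Finset.sum_sub_distrib, ← Finset.sum_smul, sum_bary, one_smul] at h1
  exact sub_left_injective h1

/-- A subsimplex of a tetrahedron in terms of barycentric coordinates. -/
lemma mem_convexHull_iff_bary {A : E ≃ᵃ[ℝ] E} {G : Set E}
    (hG : G ⊆ Set.range fun i => A (refVert i)) {x : E} : x ∈ convexHull ℝ G ↔
      ∀ i, 0 ≤ bary A i x ∧ (A (refVert i) ∉ G → bary A i x = 0) := by
  have h1 : G = A '' (refVert '' {i | A (refVert i) ∈ G}) := by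
    ext y
    constructor
    · intro hy
      obtain ⟨i, rfl⟩ := hG hy
      exact ⟨refVert i, ⟨i, hy, rfl⟩, rfl⟩
    · rintro ⟨_, ⟨i, hi, rfl⟩, rfl⟩
      exact hi
  have h2 := A.toAffineMap.image_convexHull (refVert '' {i | A (refVert i) ∈ G})
  have h3 : convexHull ℝ G = A '' convexHull ℝ (refVert '' {i | A (refVert i) ∈ G}) := by
    conv_lhs => rw [h1]
    exact h2.symm
  rw [h3, convexHull_image_refVert]
  constructor
  · rintro ⟨y, hy, rfl⟩ i
    simpa [bary] using hy i
  · intro h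
    exact ⟨A.symm x, h, by simp⟩

namespace Frame

variable {A : E ≃ᵃ[ℝ] E} {K : Finset E}

lemma mem_hull (hA : Frame A K) {x : E} : x ∈ hull K ↔ ∀ i, 0 ≤ bary A i x := by
  rw [hull, mem_convexHull_iff_bary hA.subset]
  refine ⟨fun h i => (h i).1, fun h i => ⟨h i, fun hi => absurd ?_ hi⟩⟩
  rw [hA]
  exact ⟨i, rfl⟩

lemma image_refTet (hA : Frame A K) : A '' refTet = hull K := by
  ext x
  rw [hA.mem_hull]
  constructor
  · rintro ⟨y, hy, rfl⟩ i
    simpa [bary] using mem_refTet.1 hy i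
  · intro h
    exact ⟨A.symm x, mem_refTet.2 h, by simp⟩

lemma vertex_mem (hA : Frame A K) (i : Fin 4) : A (refVert i) ∈ K := by
  have : A (refVert i) ∈ (K : Set E) := by rw [hA]; exact ⟨i, rfl⟩
  exact this

lemma exists_vertex (hA : Frame A K) {v : E} (hv : v ∈ K) : ∃ i, A (refVert i) = v := by
  have : v ∈ (K : Set E) := hv
  rw [hA] at this
  exact this

end Frame

lemma injective_vertex (A : E ≃ᵃ[ℝ] E) : Function.Injective fun i => A (refVert i) := by
  intro i j h
  have := congrArg (bary A i) h
  simp only [bary_vertex, if_true] at this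
  by_contra hne
  rw [if_neg hne] at this
  norm_num at this

/-- `F` is the set of the vertices of the face opposite to the vertex `i`. -/
def IsFace (A : E ≃ᵃ[ℝ] E) (i : Fin 4) (F : Finset E) : Prop :=
  (F : Set E) = Set.range (faceVert A i)

lemma IsFace.mem_iff {A : E ≃ᵃ[ℝ] E} {i : Fin 4} {F : Finset E} (hF : IsFace A i F) (j : Fin 4) :
    A (refVert j) ∈ F ↔ j ≠ i := by
  rw [← Finset.mem_coe, hF]
  constructor
  · rintro ⟨l, hl⟩ rfl
    exact Fin.succAbove_ne j l (injective_vertex A hl)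
  · intro h
    obtain ⟨l, rfl⟩ := Fin.exists_succAbove_eq h
    exact ⟨l, rfl⟩

lemma Frame.exists_isFace {A : E ≃ᵃ[ℝ] E} {K F : Finset E} (hA : Frame A K) (hFK : F ⊆ K)
    (hF : F.card = 3) : ∃ i, IsFace A i F := by
  classical
  set s : Finset (Fin 4) := Finset.univ.filter fun i => A (refVert i) ∈ F with hs
  have h1 : s.image (fun i => A (refVert i)) = F := by
    ext x
    simp only [Finset.mem_image, hs, Finset.mem_filter, Finset.mem_univ, true_and]
    constructor
    · rintro ⟨i, hi, rfl⟩
      exact hi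
    · intro hx
      obtain ⟨i, rfl⟩ := hA.exists_vertex (hFK hx)
      exact ⟨i, hx, rfl⟩
  have h2 : s.card = 3 := by
    rw [← hF, ← h1, Finset.card_image_of_injective _ (injective_vertex A)]
  have h3 : sᶜ.card = 1 := by
    rw [Finset.card_compl, h2]; rfl
  obtain ⟨i, hi⟩ := Finset.card_eq_one.1 h3
  refine ⟨i, ?_⟩
  rw [IsFace, ← h1, Finset.coe_image, ← compl_compl s, hi]
  have : faceVert A i = (fun j => A (refVert j)) ∘ i.succAbove := rfl
  rw [this, Set.range_comp, Fin.range_succAbove]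
  simp

lemma Frame.isFace_image {A : E ≃ᵃ[ℝ] E} {K : Finset E} (hA : Frame A K) (i : Fin 4) :
    ∃ F ⊆ K, F.card = 3 ∧ IsFace A i F := by
  classical
  have hinj : Function.Injective (faceVert A i) :=
    (injective_vertex A).comp Fin.succAbove_right_injective
  refine ⟨Finset.univ.image (faceVert A i), ?_, ?_, ?_⟩
  · intro x hx
    obtain ⟨j, -, rfl⟩ := Finset.mem_image.1 hx
    exact hA.vertex_mem _
  · rw [Finset.card_image_of_injective _ hinj]; rfl
  · simp [IsFace]

lemma IsFace.hull_eq {A : E ≃ᵃ[ℝ] E} {i : Fin 4} {F : Finset E} (hF : IsFace A i F) :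
    hull F = faceHull A i := by
  rw [hull, hF]; rfl

lemma IsFace.bary_eq_zero {A : E ≃ᵃ[ℝ] E} {i : Fin 4} {F : Finset E} (hF : IsFace A i F) {x : E}
    (hx : x ∈ hull F) : bary A i x = 0 := by
  rw [hF.hull_eq, ← A.apply_symm_apply x, mem_faceHull] at hx
  exact hx.2

lemma IsFace.unique {A : E ≃ᵃ[ℝ] E} {i j : Fin 4} {F : Finset E} (hi : IsFace A i F)
    (hj : IsFace A j F) : i = j := by
  by_contra h
  exact (hi.mem_iff i).1 ((hj.mem_iff i).2 h) rfl

lemma centroid_eq_sum (F : Finset E) (hF : F.Nonempty) :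
    F.centroid ℝ (id : E → E) = ∑ v ∈ F, (F.card : ℝ)⁻¹ • v := by
  rw [Finset.centroid_def, Finset.affineCombination_eq_linear_combination]
  · simp [Finset.centroidWeights_apply]
  · exact F.sum_centroidWeights_eq_one_of_nonempty ℝ hF

lemma sum_inv_card {F : Finset E} (hF : F.Nonempty) : ∑ _v ∈ F, (F.card : ℝ)⁻¹ = 1 := by
  have : (F.card : ℝ) ≠ 0 := by exact_mod_cast hF.card_pos.ne'
  rw [Finset.sum_const, nsmul_eq_mul, mul_inv_cancel₀ this]

lemma Frame.nonempty {A : E ≃ᵃ[ℝ] E} {K : Finset E} (hA : Frame A K) : K.Nonempty :=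
  ⟨_, hA.vertex_mem 0⟩

lemma Frame.card_eq {A : E ≃ᵃ[ℝ] E} {K : Finset E} (hA : Frame A K) : K.card = 4 := by
  have h : (K : Set E).ncard = 4 := by
    rw [hA, ← Set.image_univ, Set.ncard_image_of_injective _ (injective_vertex A)]
    simp
  rwa [Set.ncard_coe_finset] at h

lemma Frame.bary_centroid {A : E ≃ᵃ[ℝ] E} {K : Finset E} (hA : Frame A K) (i : Fin 4) :
    bary A i (K.centroid ℝ (id : E → E)) = 1 / 4 := by
  classical
  have hK : K = Finset.univ.image fun i => A (refVert i) := by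
    apply Finset.coe_injective
    rw [hA]; simp
  rw [centroid_eq_sum K hA.nonempty, bary_sum A i (sum_inv_card hA.nonempty), hA.card_eq,
    ← Finset.mul_sum]
  conv_lhs => rw [hK]
  rw [Finset.sum_image fun i _ j _ h => injective_vertex A h]
  simp [bary_vertex]

lemma mem_orthogonal_vectorSpan {F : Set E} {u : E} :
    u ∈ (vectorSpan ℝ F)ᗮ ↔ ∀ a ∈ F, ∀ b ∈ F, inner ℝ (a - b) u = 0 := by
  rw [Submodule.mem_orthogonal]
  constructor
  · intro h a ha b hb
    exact h _ (vsub_mem_vectorSpan ℝ ha hb)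
  · intro h w hw
    rw [vectorSpan_def] at hw
    induction hw using Submodule.span_induction with
    | mem x hx =>
      obtain ⟨a, ha, b, hb, rfl⟩ := hx
      exact h a ha b hb
    | zero => simp
    | add x y _ _ hx hy => rw [inner_add_left, hx, hy, add_zero]
    | smul c x _ hx => rw [inner_smul_left, hx, mul_zero]

lemma IsFace.gr_mem {A : E ≃ᵃ[ℝ] E} {i : Fin 4} {F : Finset E} (hF : IsFace A i F) :
    gr A i ∈ (vectorSpan ℝ (F : Set E))ᗮ := by
  rw [mem_orthogonal_vectorSpan]
  intro a ha b hb
  rw [real_inner_comm, ← bary_sub, hF.bary_eq_zero (subset_convexHull ℝ _ ha),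
    hF.bary_eq_zero (subset_convexHull ℝ _ hb), sub_self]

/-- The vectors normal to a face are the multiples of the gradient of the barycentric
coordinate that vanishes on it. -/
lemma IsFace.exists_eq_smul_gr {A : E ≃ᵃ[ℝ] E} {i : Fin 4} {F : Finset E} (hF : IsFace A i F)
    {u : E} (hu : u ∈ (vectorSpan ℝ (F : Set E))ᗮ) : ∃ c : ℝ, u = c • gr A i := by
  rw [mem_orthogonal_vectorSpan] at hu
  obtain ⟨j₀, hj₀⟩ : ∃ j₀ : Fin 4, j₀ ≠ i := ⟨i.succAbove 0, Fin.succAbove_ne i 0⟩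
  set a := A (refVert j₀) with ha
  have haF : a ∈ (F : Set E) := (hF.mem_iff j₀).2 hj₀
  refine ⟨inner ℝ (A (refVert i) - a) u, ext_inner_left ℝ fun y => ?_⟩
  have h1 : y = ∑ j, (bary A j (y + a) - bary A j a) • (A (refVert j) - a) := by
    have e1 := sum_bary_smul A (y + a)
    have e2 := sum_bary_smul A a
    have e3 := sum_bary A (y + a)
    have e4 := sum_bary A a
    simp_rw [sub_smul, smul_sub]
    simp only [Finset.sum_sub_distrib, ← Finset.sum_smul, e1, e2, e3, e4]
    simp
  have h2 : inner ℝ y u = (bary A i (y + a) - bary A i a) * inner ℝ (A (refVert i) - a) u := by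
    conv_lhs => rw [h1]
    rw [sum_inner, Finset.sum_eq_single i]
    · rw [inner_smul_left]; simp
    · intro j _ hj
      rw [inner_smul_left, hu _ ((hF.mem_iff j).2 hj) _ haF, mul_zero]
    · simp
  rw [h2, bary_sub, inner_smul_right, add_sub_cancel_right, real_inner_comm]
  ring

lemma outwardNormal_eq {A : E ≃ᵃ[ℝ] E} {K F : Finset E} (hA : Frame A K) {i : Fin 4}
    (hF : IsFace A i F) : outwardNormal K F = normal A i := by
  have hne : F.Nonempty := by
    rw [← Finset.coe_nonempty, hF]
    exact Set.range_nonempty _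
  set w' := F.centroid ℝ (id : E → E) - K.centroid ℝ (id : E → E) with hw'
  have hg := norm_gr_pos A i
  set c : ℝ := (4 * ‖gr A i‖ ^ 2)⁻¹ with hc
  have hin : inner ℝ (gr A i) w' = -(1 / 4) := by
    rw [hw', ← bary_sub, hA.bary_centroid, hF.bary_eq_zero]
    · norm_num
    · rw [centroid_eq_sum F hne]
      exact (convex_convexHull ℝ _).sum_mem (fun _ _ => by positivity) (sum_inv_card hne)
        fun v hv => subset_convexHull ℝ _ hv
  have hproj : ((vectorSpan ℝ (F : Set E))ᗮ).starProjection w' = -c • gr A i := by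
    refine Submodule.eq_starProjection_of_mem_orthogonal' (z := w' + c • gr A i)
      (Submodule.smul_mem _ _ hF.gr_mem) ?_ (by rw [neg_smul]; abel)
    rw [Submodule.mem_orthogonal]
    intro u hu
    obtain ⟨d, rfl⟩ := hF.exists_eq_smul_gr hu
    rw [inner_smul_left, inner_add_right, hin, inner_smul_right, real_inner_self_eq_norm_sq, hc]
    simp only [conj_trivial]
    field_simp
    ring
  have hcpos : 0 < c := by positivity
  rw [outwardNormal]
  rw [hproj, normal, norm_smul, Real.norm_eq_abs, abs_neg, abs_of_pos hcpos, smul_smul]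
  congr 1
  field_simp

/-- The relative interior of the simplex spanned by `F`. -/
def relInt (F : Finset E) : Set E :=
  {x | ∃ w : E → ℝ, (∀ v ∈ F, 0 < w v) ∧ ∑ v ∈ F, w v = 1 ∧ ∑ v ∈ F, w v • v = x}

lemma centroid_mem_relInt {F : Finset E} (hF : F.Nonempty) : F.centroid ℝ (id : E → E) ∈ relInt F :=
  ⟨fun _ => (F.card : ℝ)⁻¹, fun _ _ => inv_pos.2 (by exact_mod_cast hF.card_pos),
    sum_inv_card hF, (centroid_eq_sum F hF).symm⟩

lemma relInt_subset_hull (F : Finset E) : relInt F ⊆ hull F := by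
  rintro _ ⟨w, hw, h1, rfl⟩
  exact (convex_convexHull ℝ _).sum_mem (fun v hv => (hw v hv).le) h1
    fun v hv => subset_convexHull ℝ _ hv

lemma hull_subset_closure_relInt {F : Finset E} (hF : F.Nonempty) :
    hull F ⊆ closure (relInt F) := by
  intro x hx
  obtain ⟨u, hu, hu1, rfl⟩ := Finset.mem_convexHull'.1 hx
  set x := ∑ v ∈ F, u v • v
  obtain ⟨w, hw, hw1, hwc⟩ := centroid_mem_relInt hF
  set p := F.centroid ℝ (id : E → E)
  have hlim : Filter.Tendsto (fun t : ℝ => x + t • (p - x)) (nhdsWithin 0 (Set.Ioi 0))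
      (nhds x) := by
    have : Continuous fun t : ℝ => x + t • (p - x) := by fun_prop
    simpa using (this.tendsto 0).mono_left nhdsWithin_le_nhds
  refine mem_closure_of_tendsto hlim ?_
  filter_upwards [Ioo_mem_nhdsGT (show (0 : ℝ) < 1 by norm_num)] with t ht
  refine ⟨fun v => (1 - t) * u v + t * w v, fun v hv => ?_, ?_, ?_⟩
  · have := mul_nonneg (sub_nonneg.2 ht.2.le) (hu v hv)
    have := mul_pos ht.1 (hw v hv)
    linarith
  · rw [Finset.sum_add_distrib, ← Finset.mul_sum, ← Finset.mul_sum, hu1, hw1]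
    ring
  · simp_rw [add_smul, mul_smul]
    rw [Finset.sum_add_distrib, ← Finset.smul_sum, ← Finset.smul_sum, hwc]
    module

namespace Frame

variable {A : E ≃ᵃ[ℝ] E} {K : Finset E}

lemma bary_pos_of_mem_relInt (hA : Frame A K) {F : Finset E} (hFK : F ⊆ K) {x : E}
    (hx : x ∈ relInt F) {j : Fin 4} (hj : A (refVert j) ∈ F) : 0 < bary A j x := by
  obtain ⟨w, hw, h1, rfl⟩ := hx
  rw [bary_sum A j h1]
  have hnn : ∀ v ∈ F, 0 ≤ w v * bary A j v := by
    intro v hv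
    obtain ⟨i, rfl⟩ := hA.exists_vertex (hFK hv)
    rw [bary_vertex]
    exact mul_nonneg (hw _ hv).le (by split_ifs <;> norm_num)
  refine Finset.sum_pos' hnn ⟨_, hj, ?_⟩
  rw [bary_vertex, if_pos rfl, mul_one]
  exact hw _ hj

/-- A subsimplex that meets the relative interior of `F` contains `F`. -/
lemma subset_of_mem_relInt (hA : Frame A K) {F : Finset E} (hFK : F ⊆ K) {x : E} (hx : x ∈ relInt F)
    {G : Set E} (hG : G ⊆ K) (hxG : x ∈ convexHull ℝ G) : (F : Set E) ⊆ G := by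
  intro v hv
  obtain ⟨j, rfl⟩ := hA.exists_vertex (hFK hv)
  by_contra hvG
  have h1 := ((mem_convexHull_iff_bary (A := A) (hG.trans hA.subset)).1 hxG j).2 hvG
  exact (hA.bary_pos_of_mem_relInt hFK hx hv).ne' h1

/-- Near a relatively interior point of a face the tetrahedron is a half space. -/
lemma eventually_mem_hull (hA : Frame A K) {F : Finset E} (hFK : F ⊆ K) {i : Fin 4}
    (hF : IsFace A i F) {x : E} (hx : x ∈ relInt F) :
    ∀ᶠ y in nhds x, inner ℝ (normal A i) (y - x) ≤ 0 → y ∈ hull K := by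
  have h1 : ∀ j, ∀ᶠ y in nhds x, j ≠ i → 0 < bary A j y := by
    intro j
    by_cases hj : j = i
    · exact Filter.Eventually.of_forall fun y h => absurd hj h
    · filter_upwards [(continuous_bary A j).continuousAt.eventually
        (lt_mem_nhds (hA.bary_pos_of_mem_relInt hFK hx ((hF.mem_iff j).2 hj)))] with y hy _
      exact hy
  filter_upwards [Filter.eventually_all.2 h1] with y hy hle
  rw [hA.mem_hull]
  intro j
  by_cases hj : j = i
  · subst hj
    have h2 := bary_sub A j y x
    rw [hF.bary_eq_zero (relInt_subset_hull F hx), sub_zero] at h2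
    rw [h2, gr_eq_smul_normal, inner_smul_left, conj_trivial]
    nlinarith [norm_gr_pos A j]
  · exact (hy j hj).le

lemma inner_normal_nonpos (hA : Frame A K) {F : Finset E} {i : Fin 4} (hF : IsFace A i F) {x y : E}
    (hx : x ∈ hull F) (hy : y ∈ hull K) : inner ℝ (normal A i) (y - x) ≤ 0 := by
  have h2 := bary_sub A i y x
  rw [hF.bary_eq_zero hx, sub_zero, gr_eq_smul_normal, inner_smul_left, conj_trivial] at h2
  have h3 := hA.mem_hull.1 hy i
  rw [h2] at h3
  nlinarith [norm_gr_pos A i]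

end Frame

namespace TetMesh

/-! ### Faces of a mesh -/

variable {Ω : Set E} (T : TetMesh Ω)

/-- An affine parametrization of a tetrahedron of the mesh. -/
noncomputable def frame (K : T.elements) : E ≃ᵃ[ℝ] E :=
  (exists_frame (T.card_eq K.1 K.2) (T.indep K.1 K.2)).choose

lemma frame_spec (K : T.elements) : Frame (T.frame K) K.1 :=
  (exists_frame (T.card_eq K.1 K.2) (T.indep K.1 K.2)).choose_spec

lemma mem_faces {F : Finset E} : F ∈ T.faces ↔ ∃ K : T.elements, F ⊆ K.1 ∧ F.card = 3 := by
  simp only [faces, Finset.mem_biUnion, Finset.mem_powersetCard]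
  constructor
  · rintro ⟨K, hK, h⟩
    exact ⟨⟨K, hK⟩, h⟩
  · rintro ⟨K, h⟩
    exact ⟨K.1, K.2, h⟩

lemma hull_subset_closure (K : T.elements) : hull K.1 ⊆ closure Ω := by
  rw [← T.cover]
  exact Set.subset_biUnion_of_mem (u := fun K => hull K) K.2

lemma isCompact_hull (K : Finset E) : IsCompact (hull K) :=
  (Finset.finite_toSet K).isCompact_convexHull ℝ

lemma hull_mono {F K : Finset E} (h : F ⊆ K) : hull F ⊆ hull K :=
  convexHull_mono (Finset.coe_subset.2 h)

lemma nonempty_of_card {F : Finset E} (hF : F.card = 3) : F.Nonempty :=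
  Finset.card_pos.1 (by omega)

/-- A tetrahedron that contains a relatively interior point of a face has this face. -/
lemma subset_of_mem_relInt {F : Finset E} {K K' : T.elements} (hFK : F ⊆ K.1) {x : E}
    (hx : x ∈ relInt F) (hx' : x ∈ hull K'.1) : F ⊆ K'.1 := by
  have h1 : x ∈ convexHull ℝ ((K.1 : Set E) ∩ K'.1) :=
    T.conforming K.1 K.2 K'.1 K'.2 ⟨hull_mono hFK (relInt_subset_hull F hx), hx'⟩
  have h2 := (T.frame_spec K).subset_of_mem_relInt hFK hx Set.inter_subset_left h1
  exact fun v hv => (h2 hv).2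

/-- Near a point the mesh consists of the tetrahedra that contain the point. -/
lemma eventually_exists_mem_hull (x : E) :
    ∀ᶠ y in nhds x, y ∈ closure Ω → ∃ K : T.elements, x ∈ hull K.1 ∧ y ∈ hull K.1 := by
  have h1 : ∀ K : T.elements, ∀ᶠ y in nhds x, y ∈ hull K.1 → x ∈ hull K.1 := by
    intro K
    by_cases hx : x ∈ hull K.1
    · exact Filter.Eventually.of_forall fun _ _ => hx
    · filter_upwards [(isCompact_hull K.1).isClosed.isOpen_compl.mem_nhds hx] with y hy h
      exact absurd h hy
  filter_upwards [Filter.eventually_all.2 h1] with y hy hcl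
  rw [← T.cover] at hcl
  obtain ⟨K, hK, hyK⟩ := Set.mem_iUnion₂.1 hcl
  exact ⟨⟨K, hK⟩, hy ⟨K, hK⟩ hyK, hyK⟩

/-- Two different tetrahedra with a common face have no further common vertices. -/
lemma inter_eq {F : Finset E} (hF : F.card = 3) {K K' : T.elements} (hne : K ≠ K')
    (hK : F ⊆ K.1) (hK' : F ⊆ K'.1) : (K.1 : Set E) ∩ K'.1 = F := by
  classical
  have hFe : K.1 ∩ K'.1 = F := by
    refine (Finset.eq_of_subset_of_card_le (Finset.subset_inter hK hK') ?_).symm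
    rw [hF]
    have h4 : (K.1 ∩ K'.1).card < K.1.card := by
      refine Finset.card_lt_card (Finset.ssubset_iff_subset_ne.2 ⟨Finset.inter_subset_left, ?_⟩)
      intro h
      refine hne (Subtype.ext (Finset.eq_of_subset_of_card_le (Finset.inter_eq_left.1 h) ?_))
      rw [T.card_eq _ K.2, T.card_eq _ K'.2]
    rw [T.card_eq _ K.2] at h4
    omega
  rw [← Finset.coe_inter, hFe]

/-- Two different tetrahedra with a common face lie on different sides of it. -/
lemma outwardNormal_eq_neg {F : Finset E} (hF : F.card = 3) {K K' : T.elements} (hne : K ≠ K')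
    (hK : F ⊆ K.1) (hK' : F ⊆ K'.1) : outwardNormal K'.1 F = -outwardNormal K.1 F := by
  classical
  have hA := T.frame_spec K
  have hA' := T.frame_spec K'
  obtain ⟨i, hi⟩ := hA.exists_isFace hK hF
  obtain ⟨i', hi'⟩ := hA'.exists_isFace hK' hF
  rw [outwardNormal_eq hA hi, outwardNormal_eq hA' hi']
  set n := normal (T.frame K) i
  set n' := normal (T.frame K') i'
  obtain ⟨c, hc⟩ : ∃ c : ℝ, n' = c • n := by
    have h1 : n' ∈ (vectorSpan ℝ (F : Set E))ᗮ := Submodule.smul_mem _ _ hi'.gr_mem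
    obtain ⟨c, hc⟩ := hi.exists_eq_smul_gr h1
    exact ⟨c * (-‖gr (T.frame K) i‖), by rw [mul_smul, ← gr_eq_smul_normal, hc]⟩
  have hc1 : |c| = 1 := by
    have := congrArg norm hc
    rw [norm_smul, norm_normal, norm_normal, mul_one] at this
    exact this.symm
  rcases (abs_eq (by norm_num : (0 : ℝ) ≤ 1)).1 hc1 with rfl | rfl
  · -- if both are on the same side, they overlap near the barycentre `x` of the face, whereas
    -- conformity allows them to meet in the face only
    exfalso
    rw [one_smul] at hc
    set x := F.centroid ℝ (id : E → E)
    have hx : x ∈ relInt F := centroid_mem_relInt (nonempty_of_card hF)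
    have hlim : Filter.Tendsto (fun t : ℝ => x + t • (-n)) (nhdsWithin 0 (Set.Ioi 0))
        (nhds x) := by
      have : Continuous fun t : ℝ => x + t • (-n) := by fun_prop
      simpa using (this.tendsto 0).mono_left nhdsWithin_le_nhds
    obtain ⟨t, ⟨ht1, ht2⟩, ht⟩ := ((hlim.eventually ((hA.eventually_mem_hull hK hi hx).and
      (hA'.eventually_mem_hull hK' hi' hx))).and self_mem_nhdsWithin).exists
    have ht : 0 < t := ht
    have hin : inner ℝ n (x + t • (-n) - x) = -t := by
      rw [add_sub_cancel_left, smul_neg, inner_neg_right, inner_smul_right,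
        real_inner_self_eq_norm_sq, norm_normal]
      ring
    have e1 := ht1 (by rw [hin]; linarith)
    have e2 := ht2 (by
      change inner ℝ n' _ ≤ 0
      rw [hc, hin]; linarith)
    have e3 := T.conforming K.1 K.2 K'.1 K'.2 ⟨e1, e2⟩
    rw [T.inter_eq hF hne hK hK'] at e3
    have h5 := bary_sub (T.frame K) i (x + t • (-n)) x
    rw [hi.bary_eq_zero e3, hi.bary_eq_zero (relInt_subset_hull F hx), gr_eq_smul_normal,
      inner_smul_left, hin] at h5
    have := norm_gr_pos (T.frame K) i
    simp only [conj_trivial] at h5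
    nlinarith
  · rw [hc, neg_smul, one_smul]

/-- A face of one tetrahedron only lies on the boundary. -/
lemma hull_subset_frontier (hopen : IsOpen Ω) {F : Finset E} (hF : F.card = 3) {K : T.elements}
    (hK : F ⊆ K.1) (huniq : ∀ K' : T.elements, F ⊆ K'.1 → K' = K) : hull F ⊆ frontier Ω := by
  have hA := T.frame_spec K
  obtain ⟨i, hi⟩ := hA.exists_isFace hK hF
  refine (hull_subset_closure_relInt (nonempty_of_card hF)).trans
    (closure_minimal (fun x hx => ?_) isClosed_frontier)
  have hxK : x ∈ hull K.1 := hull_mono hK (relInt_subset_hull F hx)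
  rw [frontier, hopen.interior_eq]
  refine ⟨T.hull_subset_closure K hxK, fun hxΩ => ?_⟩
  set n := normal (T.frame K) i
  have hlim : Filter.Tendsto (fun t : ℝ => x + t • n) (nhdsWithin 0 (Set.Ioi 0)) (nhds x) := by
    have : Continuous fun t : ℝ => x + t • n := by fun_prop
    simpa using (this.tendsto 0).mono_left nhdsWithin_le_nhds
  -- otherwise a point slightly outside of `K` would be covered by another tetrahedron at `x`
  have hev : ∀ᶠ y in nhds x, y ∈ Ω := hopen.mem_nhds hxΩ
  obtain ⟨t, ⟨ht1, ht2⟩, ht⟩ := ((hlim.eventually (hev.and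
    (T.eventually_exists_mem_hull x))).and self_mem_nhdsWithin).exists
  have ht : 0 < t := ht
  obtain ⟨K', hxK', hyK'⟩ := ht2 (subset_closure ht1)
  obtain rfl := huniq K' (T.subset_of_mem_relInt hK hx hxK')
  have h1 := hA.inner_normal_nonpos hi (relInt_subset_hull F hx) hyK'
  rw [add_sub_cancel_left, inner_smul_right, real_inner_self_eq_norm_sq, norm_normal] at h1
  linarith

/-- A face of two tetrahedra does not lie on the boundary. -/
lemma centroid_notMem_frontier (hopen : IsOpen Ω) (hreg : interior (closure Ω) = Ω) {F : Finset E}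
    (hF : F.card = 3) {K K' : T.elements} (hne : K ≠ K') (hK : F ⊆ K.1) (hK' : F ⊆ K'.1) :
    F.centroid ℝ (id : E → E) ∉ frontier Ω := by
  have hA := T.frame_spec K
  have hA' := T.frame_spec K'
  obtain ⟨i, hi⟩ := hA.exists_isFace hK hF
  obtain ⟨i', hi'⟩ := hA'.exists_isFace hK' hF
  have hn := T.outwardNormal_eq_neg hF hne hK hK'
  rw [outwardNormal_eq hA hi, outwardNormal_eq hA' hi'] at hn
  have hx := centroid_mem_relInt (nonempty_of_card hF)
  set x := F.centroid ℝ (id : E → E)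
  -- the two tetrahedra cover the two half balls around the barycentre
  have h1 : closure Ω ∈ nhds x := by
    filter_upwards [hA.eventually_mem_hull hK hi hx, hA'.eventually_mem_hull hK' hi' hx]
      with y hy hy'
    rcases le_total (inner ℝ (normal (T.frame K) i) (y - x)) 0 with h | h
    · exact T.hull_subset_closure K (hy h)
    · refine T.hull_subset_closure K' (hy' ?_)
      rw [hn, inner_neg_left]
      linarith
  have h2 : x ∈ Ω := by
    rw [← hreg]
    exact mem_interior_iff_mem_nhds.2 h1
  rw [frontier, hopen.interior_eq]
  exact fun h => h.2 h2

/-- The interior faces in terms of the vertices. -/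
lemma mem_interiorFaces {F : Finset E} : F ∈ T.interiorFaces ↔
    F.card = 3 ∧ ∃ K K' : T.elements, K ≠ K' ∧ F ⊆ K.1 ∧ F ⊆ K'.1 := by
  classical
  rw [interiorFaces, Finset.mem_filter]
  constructor
  · rintro ⟨hF, K, hK, K', hK', hne, heq⟩
    obtain ⟨K₀, hFK₀, hF3⟩ := T.mem_faces.1 hF
    have hx := centroid_mem_relInt (nonempty_of_card hF3)
    have hx' := relInt_subset_hull F hx
    rw [heq] at hx'
    refine ⟨hF3, ⟨K, hK⟩, ⟨K', hK'⟩, fun h => hne (congrArg Subtype.val h), ?_, ?_⟩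
    · exact T.subset_of_mem_relInt (K' := ⟨K, hK⟩) hFK₀ hx hx'.1
    · exact T.subset_of_mem_relInt (K' := ⟨K', hK'⟩) hFK₀ hx hx'.2
  · rintro ⟨hF, K, K', hne, hK, hK'⟩
    refine ⟨T.mem_faces.2 ⟨K, hK, hF⟩, K.1, K.2, K'.1, K'.2, fun h => hne (Subtype.ext h), ?_⟩
    refine subset_antisymm (Set.subset_inter (hull_mono hK) (hull_mono hK')) ?_
    refine (T.conforming K.1 K.2 K'.1 K'.2).trans ?_
    rw [T.inter_eq hF hne hK hK']
    exact subset_rfl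

lemma mem_boundaryFaces {F : Finset E} :
    F ∈ T.boundaryFaces ↔ F ∈ T.faces ∧ hull F ⊆ frontier Ω := by
  classical
  rw [boundaryFaces, Finset.mem_filter]

lemma mem_boundaryFacesIn {S : Set E} {F : Finset E} :
    F ∈ T.boundaryFacesIn S ↔ F ∈ T.boundaryFaces ∧ hull F ⊆ S := by
  classical
  rw [boundaryFacesIn, Finset.mem_filter]

/-- Every face belongs to one tetrahedron and lies on the boundary, or it is the interface
of two tetrahedra. -/
lemma face_cases (hopen : IsOpen Ω) (hreg : interior (closure Ω) = Ω) {F : Finset E}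
    (hF : F.card = 3) {K : T.elements} (hK : F ⊆ K.1) :
    (F ∈ T.boundaryFaces ∧ F ∉ T.interiorFaces ∧ ∀ K' : T.elements, F ⊆ K'.1 ↔ K' = K) ∨
    (F ∈ T.interiorFaces ∧ F ∉ T.boundaryFaces ∧ ∃ K' : T.elements, K' ≠ K ∧
      outwardNormal K'.1 F = -outwardNormal K.1 F ∧
      ∀ K'' : T.elements, F ⊆ K''.1 ↔ K'' = K ∨ K'' = K') := by
  by_cases h : ∀ K' : T.elements, F ⊆ K'.1 → K' = K
  · refine Or.inl ⟨T.mem_boundaryFaces.2 ⟨T.mem_faces.2 ⟨K, hK, hF⟩,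
      T.hull_subset_frontier hopen hF hK h⟩, fun hint => ?_, fun K' => ⟨h K', fun e => e ▸ hK⟩⟩
    obtain ⟨-, K₁, K₂, hne, h1, h2⟩ := T.mem_interiorFaces.1 hint
    exact hne ((h K₁ h1).trans (h K₂ h2).symm)
  · push Not at h
    obtain ⟨K', hK', hne⟩ := h
    refine Or.inr ⟨T.mem_interiorFaces.2 ⟨hF, K', K, hne, hK', hK⟩, fun hb => ?_, K', hne,
      T.outwardNormal_eq_neg hF hne.symm hK hK', fun K'' => ⟨fun hK'' => ?_, ?_⟩⟩
    · exact T.centroid_notMem_frontier hopen hreg hF hne hK' hK ((T.mem_boundaryFaces.1 hb).2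
        (relInt_subset_hull F (centroid_mem_relInt (nonempty_of_card hF))))
    · -- a third tetrahedron would be on the same side as one of the two
      by_contra hcon
      push Not at hcon
      have e1 := T.outwardNormal_eq_neg hF hne.symm hK hK'
      have e2 := T.outwardNormal_eq_neg hF hcon.1.symm hK hK''
      have e3 := T.outwardNormal_eq_neg hF hcon.2.symm hK' hK''
      rw [e2, e1, neg_neg] at e3
      obtain ⟨i, hi⟩ := (T.frame_spec K).exists_isFace hK hF
      have h0 : outwardNormal K.1 F = 0 := by
        have h := congrArg (inner ℝ (outwardNormal K.1 F)) e3
        rw [inner_neg_right] at h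
        exact (inner_self_eq_zero (𝕜 := ℝ)).1 (by linarith)
      rw [outwardNormal_eq (T.frame_spec K) hi] at h0
      have := norm_normal (T.frame K) i
      rw [h0, norm_zero] at this
      norm_num at this
    · rintro (rfl | rfl)
      exacts [hK, hK']

/-- A boundary face with a relatively interior point on `S` lies on `S`. -/
lemma mem_boundaryFacesIn_of_mem_relInt {S : Set E} (hS : T.CompatibleWith S) {F : Finset E}
    (hF : F ∈ T.faces) {x : E} (hx : x ∈ relInt F) (hxS : x ∈ S) : F ∈ T.boundaryFacesIn S := by
  rw [← hS] at hxS
  obtain ⟨F', hF', hxF'⟩ := Set.mem_iUnion₂.1 hxS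
  obtain ⟨K, hK, hF3⟩ := T.mem_faces.1 hF
  obtain ⟨K', hK', hF'3⟩ := T.mem_faces.1
    (T.mem_boundaryFaces.1 (T.mem_boundaryFacesIn.1 hF').1).1
  have h1 : F ⊆ K'.1 := T.subset_of_mem_relInt hK hx (hull_mono hK' hxF')
  have h2 : F ⊆ F' := fun v hv => (T.frame_spec K').subset_of_mem_relInt h1 hx
    (Finset.coe_subset.2 hK') hxF' hv
  have h3 : F = F' := Finset.eq_of_subset_of_card_le h2 (by omega)
  rwa [h3]

lemma mem_boundaryFacesIn_or {Γ S : Set E} (hΓS : Γ ∪ S = frontier Ω) (hΓ : T.CompatibleWith Γ)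
    (hS : T.CompatibleWith S) {F : Finset E} (hF : F ∈ T.boundaryFaces) :
    F ∈ T.boundaryFacesIn Γ ∨ F ∈ T.boundaryFacesIn S := by
  obtain ⟨hFf, hFb⟩ := T.mem_boundaryFaces.1 hF
  obtain ⟨K, hK, hF3⟩ := T.mem_faces.1 hFf
  have hx := centroid_mem_relInt (nonempty_of_card hF3)
  have h1 := hFb (relInt_subset_hull F hx)
  rw [← hΓS] at h1
  exact h1.imp (T.mem_boundaryFacesIn_of_mem_relInt hΓ hFf hx)
    (T.mem_boundaryFacesIn_of_mem_relInt hS hFf hx)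

/-- Near a relatively interior point of a boundary face the boundary consists of this face, so
that no face lies on both parts of the boundary. -/
lemma notMem_boundaryFacesIn {Γ S : Set E} (hΓS : Γ ∪ S = frontier Ω)
    (hdisj : Disjoint (interior (Subtype.val ⁻¹' Γ : Set (frontier Ω)))
      (interior (Subtype.val ⁻¹' S : Set (frontier Ω))))
    (hΓ : T.CompatibleWith Γ) (hS : T.CompatibleWith S) {F : Finset E}
    (hFΓ : F ∈ T.boundaryFacesIn Γ) : F ∉ T.boundaryFacesIn S := by
  intro hFS
  obtain ⟨hFb, hFΓ'⟩ := T.mem_boundaryFacesIn.1 hFΓ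
  obtain ⟨-, hFS'⟩ := T.mem_boundaryFacesIn.1 hFS
  obtain ⟨hFf, hFfr⟩ := T.mem_boundaryFaces.1 hFb
  obtain ⟨K, hK, hF3⟩ := T.mem_faces.1 hFf
  have hx := centroid_mem_relInt (nonempty_of_card hF3)
  set x := F.centroid ℝ (id : E → E)
  have hxF := relInt_subset_hull F hx
  have hev : ∀ᶠ y in nhds x, y ∈ frontier Ω → y ∈ hull F := by
    have h1 : ∀ F' : T.boundaryFaces, ∀ᶠ y in nhds x, y ∈ hull F'.1 → x ∈ hull F'.1 := by
      intro F'
      by_cases hx : x ∈ hull F'.1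
      · exact Filter.Eventually.of_forall fun _ _ => hx
      · filter_upwards [(isCompact_hull F'.1).isClosed.isOpen_compl.mem_nhds hx] with y hy h
        exact absurd h hy
    filter_upwards [Filter.eventually_all.2 h1] with y hy hyf
    obtain ⟨F', hF', hyF'⟩ : ∃ F' ∈ T.boundaryFaces, y ∈ hull F' := by
      rw [← hΓS, ← hΓ, ← hS] at hyf
      rcases hyf with h | h
      all_goals
        obtain ⟨F', hF', hyF'⟩ := Set.mem_iUnion₂.1 h
        exact ⟨F', (T.mem_boundaryFacesIn.1 hF').1, hyF'⟩
    have hxF' := hy ⟨F', hF'⟩ hyF'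
    obtain ⟨K', hK', hF'3⟩ := T.mem_faces.1 (T.mem_boundaryFaces.1 hF').1
    have h1 : F ⊆ K'.1 := T.subset_of_mem_relInt hK hx (hull_mono hK' hxF')
    have h2 : F ⊆ F' := fun v hv => (T.frame_spec K').subset_of_mem_relInt h1 hx
      (Finset.coe_subset.2 hK') hxF' hv
    have h3 : F = F' := Finset.eq_of_subset_of_card_le h2 (by omega)
    rwa [h3]
  have hint : ∀ Z : Set E, hull F ⊆ Z →
      (⟨x, hFfr hxF⟩ : frontier Ω) ∈ interior (Subtype.val ⁻¹' Z : Set (frontier Ω)) := by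
    intro Z hZ
    rw [mem_interior_iff_mem_nhds]
    filter_upwards [continuous_subtype_val.continuousAt.eventually hev] with y hy
    exact hZ (hy y.2)
  exact Set.disjoint_left.1 hdisj (hint Γ hFΓ') (hint S hFS')

end TetMesh

/-! ### Integrals of piecewise smooth functions -/

/-- The divergence theorem on a tetrahedron for the product of a polynomial field and a smooth
function. -/
lemma integral_dvg_mul_add (A : E ≃ᵃ[ℝ] E) (q : Fin 3 → Poly) {φ : E → ℝ} (hφ : ContDiff ℝ 1 φ) :
    ∫ x in A '' refTet, (peval x (dvg q) * φ x + ∑ j, peval x (q j) * partialDeriv j φ x) =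
      ∑ i, ∫ x in faceHull A i, inner ℝ (normal A i) (evec q x) * φ x
        ∂(Measure.euclideanHausdorffMeasure 2) := by
  have hq : ∀ j, ContDiff ℝ 1 fun x => peval x (q j) := fun j =>
    (contDiff_peval (q j)).of_le (by simp)
  have hprod : ∀ j, ContDiff ℝ 1 fun x => peval x (q j) * φ x := fun j => (hq j).mul hφ
  have h1 : ∀ x, peval x (dvg q) * φ x + ∑ j, peval x (q j) * partialDeriv j φ x =
      ∑ j, partialDeriv j (fun x => peval x (q j) * φ x) x := by
    intro x
    rw [dvg_apply, peval_sum, Finset.sum_mul, ← Finset.sum_add_distrib]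
    refine Finset.sum_congr rfl fun j _ => ?_
    have h := ((hasFDerivAt_peval (q j) x).differentiableAt.hasFDerivAt.mul
      (hφ.differentiable (by simp) x).hasFDerivAt).fderiv
    have h2 := partialDeriv_peval j (q j) x
    simp only [partialDeriv] at h2 ⊢
    have h3 : fderiv ℝ (fun x => peval x (q j) * φ x) x = _ := h
    rw [h3]
    simp only [_root_.add_apply, _root_.smul_apply, smul_eq_mul, h2]
    ring
  have hc : IsCompact (A '' refTet) := isCompact_refTet.image (continuous_affineEquiv A)
  have hφc := hφ.continuous
  simp_rw [h1]
  rw [integral_finsetSum _ fun j _ =>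
    ((continuous_partialDeriv (hprod j) j).continuousOn.integrableOn_compact hc)]
  simp_rw [integral_partialDeriv A (hprod _), Finset.mul_sum]
  rw [Finset.sum_comm]
  refine Finset.sum_congr rfl fun i _ => ?_
  rw [faceHull, integral_face]
  have h4 : ∀ x, inner ℝ (normal A i) (evec q x) * φ x =
      ∑ l, normal A i l * (peval x (q l) * φ x) := by
    intro x
    rw [PiLp.inner_apply, Finset.sum_mul]
    refine Finset.sum_congr rfl fun l _ => ?_
    simp
    ring
  have h5 : triInt A i (fun x => inner ℝ (normal A i) (evec q x) * φ x) =
      ∑ l, normal A i l * triInt A i (fun x => peval x (q l) * φ x) := by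
    simp only [triInt, h4]
    rw [integral_finsetSum]
    · simp_rw [integral_const_mul]
    · intro l _
      have : Continuous fun y => normal A i l * (peval (triMap (faceVert A i) y) (q l) *
          φ (triMap (faceVert A i) y)) := by
        have := hφc.comp (continuous_triMap (faceVert A i))
        fun_prop
      exact this.continuousOn.integrableOn_compact isCompact_refTri
  rw [h5, Finset.mul_sum]
  refine Finset.sum_congr rfl fun l _ => ?_
  have h6 : gr A i l = -‖gr A i‖ * normal A i l := by
    conv_lhs => rw [gr_eq_smul_normal]
    simp
  rw [h6]
  ring

namespace TetMesh

variable {Ω : Set E} (T : TetMesh Ω)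

lemma disjoint_interior {K K' : T.elements} (hne : K ≠ K') :
    Disjoint (interior (hull K.1)) (interior (hull K'.1)) := by
  rw [Set.disjoint_left]
  intro x hx hx'
  have hK := T.frame_spec K
  obtain ⟨j, hj⟩ : ∃ j, T.frame K (refVert j) ∉ K'.1 := by
    by_contra h
    push Not at h
    refine hne (Subtype.ext (Finset.eq_of_subset_of_card_le (fun v hv => ?_) ?_))
    · obtain ⟨j, rfl⟩ := hK.exists_vertex hv
      exact h j
    · rw [T.card_eq _ K.2, T.card_eq _ K'.2]
  have h1 : ∀ y ∈ hull K.1 ∩ hull K'.1, bary (T.frame K) j y = 0 := by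
    intro y hy
    exact ((mem_convexHull_iff_bary (Set.inter_subset_left.trans hK.subset)).1
      (T.conforming K.1 K.2 K'.1 K'.2 hy) j).2 fun h => hj h.2
  have hlim : Filter.Tendsto (fun t : ℝ => x + t • gr (T.frame K) j) (nhdsWithin 0 (Set.Ioi 0))
      (nhds x) := by
    have : Continuous fun t : ℝ => x + t • gr (T.frame K) j := by fun_prop
    simpa using (this.tendsto 0).mono_left nhdsWithin_le_nhds
  have hev : ∀ᶠ y in nhds x, y ∈ hull K.1 ∩ hull K'.1 :=
    Filter.inter_mem (mem_interior_iff_mem_nhds.1 hx) (mem_interior_iff_mem_nhds.1 hx')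
  obtain ⟨t, ht1, ht⟩ := ((hlim.eventually hev).and self_mem_nhdsWithin).exists
  have ht : 0 < t := ht
  have h2 := bary_sub (T.frame K) j (x + t • gr (T.frame K) j) x
  rw [h1 _ ht1, h1 _ ⟨interior_subset hx, interior_subset hx'⟩, add_sub_cancel_left,
    inner_smul_right, real_inner_self_eq_norm_sq] at h2
  have := norm_gr_pos (T.frame K) j
  have h3 : 0 < t * ‖gr (T.frame K) j‖ ^ 2 := by positivity
  linarith

lemma glue_eq {V : Type*} [AddCommMonoid V] (f : T.elements → E → V) {K : T.elements} {x : E}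
    (hx : x ∈ interior (hull K.1)) : T.glue f x = f K x := by
  rw [glue, Finset.sum_eq_single K]
  · exact Set.indicator_of_mem hx _
  · intro K' _ hne
    exact Set.indicator_of_notMem (fun h => Set.disjoint_left.1 (T.disjoint_interior hne) h hx) _
  · simp

lemma interior_hull_ae_eq (K : Finset E) : interior (hull K) =ᵐ[volume] hull K :=
  interior_ae_eq_of_null_frontier ((convex_convexHull ℝ _).addHaar_frontier volume)

lemma iUnion_interior_ae_eq (hreg : interior (closure Ω) = Ω) :
    (⋃ K : T.elements, interior (hull K.1)) =ᵐ[volume] Ω := by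
  refine Filter.EventuallyLE.antisymm (Filter.Eventually.of_forall fun x hx => ?_) ?_
  · obtain ⟨K, hK⟩ := Set.mem_iUnion.1 hx
    rw [← hreg]
    exact interior_mono (T.hull_subset_closure K) hK
  · have h : Ω ≤ᵐ[volume] ⋃ K : T.elements, hull K.1 := by
      refine Filter.Eventually.of_forall fun x hx => ?_
      have := subset_closure hx
      rw [← T.cover] at this
      obtain ⟨K, hK, hx⟩ := Set.mem_iUnion₂.1 this
      exact Set.mem_iUnion.2 ⟨⟨K, hK⟩, hx⟩
    exact h.trans (Filter.EventuallyEq.countable_iUnion fun K : T.elements =>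
      interior_hull_ae_eq K.1).symm.le

/-- A function that is continuous on each tetrahedron up to the boundary is integrable, and its
integral is the sum of those over the tetrahedra. -/
lemma integral_eq_sum (hreg : interior (closure Ω) = Ω) {f : E → ℝ} {g : T.elements → E → ℝ}
    (hg : ∀ K, Continuous (g K)) (h : ∀ K, ∀ x ∈ interior (hull K.1), f x = g K x) :
    IntegrableOn f Ω ∧ ∫ x in Ω, f x = ∑ K, ∫ x in hull K.1, g K x := by
  have hint : ∀ K : T.elements, IntegrableOn f (interior (hull K.1)) := fun K =>
    (((hg K).continuousOn.integrableOn_compact (isCompact_hull K.1)).mono_set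
      interior_subset).congr_fun (fun x hx => (h K x hx).symm) isOpen_interior.measurableSet
  have hae := T.iUnion_interior_ae_eq hreg
  constructor
  · rw [← integrableOn_congr_set_ae hae, integrableOn_finite_iUnion]
    exact hint
  · rw [← setIntegral_congr_set hae, integral_iUnion_fintype
      (fun K => isOpen_interior.measurableSet) (fun K K' hne => T.disjoint_interior hne) hint]
    refine Finset.sum_congr rfl fun K _ => ?_
    rw [setIntegral_congr_fun isOpen_interior.measurableSet (h K)]
    exact setIntegral_congr_set (interior_hull_ae_eq K.1)

lemma memLp_two (hreg : interior (closure Ω) = Ω) {f : E → ℝ} {g : T.elements → E → ℝ}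
    (hg : ∀ K, Continuous (g K)) (h : ∀ K, ∀ x ∈ interior (hull K.1), f x = g K x) :
    MemLp f 2 (volume.restrict Ω) := by
  rw [memLp_two_iff_integrable_sq (T.integral_eq_sum hreg hg h).1.aestronglyMeasurable]
  exact (T.integral_eq_sum hreg (f := fun x => f x ^ 2) (fun K => (hg K).pow 2)
    fun K x hx => by rw [h K x hx, Pi.pow_apply]).1

variable {T}

lemma toField_eq (σ : T.BrokenTensor) {K : T.elements} {x : E} (hx : x ∈ interior (hull K.1)) :
    toField σ x = val σ K x := T.glue_eq _ hx

lemma brokenDiv_eq (σ : T.BrokenTensor) {K : T.elements} {x : E} (hx : x ∈ interior (hull K.1))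
    (i : Fin 3) : brokenDiv σ x i = peval x (dvg (σ K i)) := by
  rw [brokenDiv, T.glue_eq _ hx, dvg_apply, peval_sum]

lemma integral_frobSq_toField (hreg : interior (closure Ω) = Ω) (σ : T.BrokenTensor) :
    ∫ x in Ω, frobSq (toField σ x) = ∑ K, ∫ x in hull K.1, ∑ i, ‖evec (σ K i) x‖ ^ 2 := by
  refine (T.integral_eq_sum hreg (fun K => by fun_prop) fun K x hx => ?_).2
  rw [toField_eq σ hx, frobSq]
  refine Finset.sum_congr rfl fun i _ => ?_
  simp [EuclideanSpace.norm_sq_eq, val]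

lemma integral_vecSq_brokenDiv (hreg : interior (closure Ω) = Ω) (σ : T.BrokenTensor) :
    ∫ x in Ω, vecSq (brokenDiv σ x) =
      ∑ K, ∫ x in hull K.1, ∑ i, peval x (dvg (σ K i)) ^ 2 := by
  refine (T.integral_eq_sum hreg (fun K => by fun_prop) fun K x hx => ?_).2
  simp_rw [vecSq, brokenDiv_eq σ hx]

/-! ### Conforming fields -/

open Classical in
/-- The faces of a tetrahedron of the mesh correspond to the vertices opposite to them. -/
lemma sum_faces_eq (K : T.elements) {g : Finset E → ℝ} {g' : Fin 4 → ℝ}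
    (h : ∀ i F, IsFace (T.frame K) i F → F ⊆ K.1 → g F = g' i) :
    ∑ F ∈ T.faces with F ⊆ K.1, g F = ∑ i, g' i := by
  have hK := T.frame_spec K
  choose F hF using fun i => hK.isFace_image i
  symm
  refine Finset.sum_bij (fun i _ => F i) ?_ ?_ ?_ ?_
  · intro i _
    exact Finset.mem_filter.2 ⟨T.mem_faces.2 ⟨K, (hF i).1, (hF i).2.1⟩, (hF i).1⟩
  · intro i _ j _ hij
    have := (hF j).2.2
    rw [← hij] at this
    exact (hF i).2.2.unique this
  · intro G hG
    obtain ⟨hG1, hG2⟩ := Finset.mem_filter.1 hG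
    obtain ⟨-, -, hG3⟩ := T.mem_faces.1 hG1
    obtain ⟨i, hi⟩ := hK.exists_isFace hG2 hG3
    refine ⟨i, Finset.mem_univ _, Finset.coe_injective ?_⟩
    rw [(hF i).2.2, hi]
  · intro i _
    exact (h i (F i) (hF i).2.2 (hF i).1).symm

open Classical in
lemma sum_elements_sum_faces (g : T.elements → Finset E → ℝ) :
    ∑ K, ∑ F ∈ T.faces with F ⊆ K.1, g K F =
      ∑ F ∈ T.faces, ∑ K : T.elements with F ⊆ K.1, g K F := by
  simp_rw [Finset.sum_filter]
  rw [Finset.sum_comm]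

lemma mulVec_val (σ : T.BrokenTensor) (K : T.elements) (x n : E) (i : Fin 3) :
    Matrix.mulVec (val σ K x) (fun j => n j) i = inner ℝ n (evec (σ K i) x) := by
  simp [Matrix.mulVec, dotProduct, val, PiLp.inner_apply]

open Classical in
lemma jump_apply (σ : T.BrokenTensor) (F : Finset E) (x : E) (i : Fin 3) :
    jump σ F x i =
      ∑ K : T.elements with F ⊆ K.1, inner ℝ (outwardNormal K.1 F) (evec (σ K i) x) := by
  rw [jump, Finset.sum_apply]
  exact Finset.sum_congr rfl fun K _ => mulVec_val σ K x _ i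

lemma integrableOn_hull_face {F : Finset E} (hF : F ∈ T.faces) {f : E → ℝ} (hf : Continuous f) :
    IntegrableOn f (hull F) (Measure.euclideanHausdorffMeasure 2) := by
  obtain ⟨K, hK, hF3⟩ := T.mem_faces.1 hF
  obtain ⟨i, hi⟩ := (T.frame_spec K).exists_isFace hK hF3
  rw [hi.hull_eq]
  exact integrableOn_face _ i hf

lemma mem_interiorFaces_or (hopen : IsOpen Ω) (hreg : interior (closure Ω) = Ω) {F : Finset E}
    (hF : F ∈ T.faces) : F ∈ T.interiorFaces ∨ F ∈ T.boundaryFaces := by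
  obtain ⟨K, hK, hF3⟩ := T.mem_faces.1 hF
  rcases T.face_cases hopen hreg hF3 hK with h | h
  exacts [Or.inr h.1, Or.inl h.1]

lemma mem_starFaces {S : Set E} {F : Finset E} :
    F ∈ T.starFaces S ↔ F ∈ T.interiorFaces ∨ F ∈ T.boundaryFacesIn S := by
  classical
  rw [starFaces, Finset.mem_union]

lemma mem_faces_of_mem_starFaces {S : Set E} {F : Finset E} (hF : F ∈ T.starFaces S) :
    F ∈ T.faces := by
  rcases mem_starFaces.1 hF with h | h
  · obtain ⟨hF3, K, -, -, hK, -⟩ := T.mem_interiorFaces.1 h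
    exact T.mem_faces.2 ⟨K, hK, hF3⟩
  · exact (T.mem_boundaryFaces.1 (T.mem_boundaryFacesIn.1 h).1).1

/-- Integration by parts over the mesh for a field without jumps: the contributions of the
interior faces and of the faces on `S` cancel, and the test function vanishes on the others. -/
lemma integral_brokenDiv_mul_add (hopen : IsOpen Ω) (hreg : interior (closure Ω) = Ω) {S : Set E}
    (hS : T.CompatibleWith S) {σ : T.BrokenTensor}
    (hσ : ∀ F ∈ T.starFaces S, ∀ x ∈ hull F, jump σ F x = 0) (i : Fin 3) {φ : E → ℝ}
    (hφ : ContDiff ℝ ∞ φ) (hsupp : tsupport φ ∩ frontier Ω ⊆ S) :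
    ∫ x in Ω, (brokenDiv σ x i * φ x + ∑ j, toField σ x i j * partialDeriv j φ x) = 0 := by
  classical
  have hφ1 : ContDiff ℝ 1 φ := hφ.of_le (by simp)
  have hφc := hφ.continuous
  have hd := continuous_partialDeriv hφ1
  have h1 := (T.integral_eq_sum hreg
    (f := fun x => brokenDiv σ x i * φ x + ∑ j, toField σ x i j * partialDeriv j φ x)
    (g := fun K x => peval x (dvg (σ K i)) * φ x + ∑ j, peval x (σ K i j) * partialDeriv j φ x)
    (fun K => by fun_prop) fun K x hx => by rw [brokenDiv_eq σ hx, toField_eq σ hx]; rfl).2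
  rw [h1]
  have h2 : ∀ K : T.elements, ∫ x in hull K.1, (peval x (dvg (σ K i)) * φ x +
      ∑ j, peval x (σ K i j) * partialDeriv j φ x) = ∑ F ∈ T.faces with F ⊆ K.1,
      ∫ x in hull F, inner ℝ (outwardNormal K.1 F) (evec (σ K i) x) * φ x
        ∂(Measure.euclideanHausdorffMeasure 2) := by
    intro K
    have hK := T.frame_spec K
    rw [← hK.image_refTet, integral_dvg_mul_add _ _ hφ1]
    refine (sum_faces_eq K fun j F hF hFK => ?_).symm
    rw [outwardNormal_eq hK hF, hF.hull_eq]
  simp_rw [h2]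
  rw [sum_elements_sum_faces]
  refine Finset.sum_eq_zero fun F hF => ?_
  have h3 : ∑ K : T.elements with F ⊆ K.1,
      ∫ x in hull F, inner ℝ (outwardNormal K.1 F) (evec (σ K i) x) * φ x
        ∂(Measure.euclideanHausdorffMeasure 2) =
      ∫ x in hull F, jump σ F x i * φ x ∂(Measure.euclideanHausdorffMeasure 2) := by
    rw [← integral_finsetSum _ fun K _ => integrableOn_hull_face hF (by fun_prop)]
    simp_rw [jump_apply, Finset.sum_mul]
  rw [h3]
  refine setIntegral_eq_zero_of_forall_eq_zero fun x hx => ?_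
  by_cases hFS : F ∈ T.starFaces S
  · rw [hσ F hFS x hx]
    simp
  · have hFb : F ∈ T.boundaryFaces := (mem_interiorFaces_or hopen hreg hF).resolve_left
      fun h => hFS (mem_starFaces.2 (Or.inl h))
    have hz : ∀ y ∈ relInt F, φ y = 0 := by
      intro y hy
      by_contra hne
      have hyS : y ∈ S := hsupp ⟨subset_tsupport φ hne,
        (T.mem_boundaryFaces.1 hFb).2 (relInt_subset_hull F hy)⟩
      exact hFS (mem_starFaces.2 (Or.inr (T.mem_boundaryFacesIn_of_mem_relInt hS hF hy hyS)))
    obtain ⟨-, -, hF3⟩ := T.mem_faces.1 hF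
    have hx' := hull_subset_closure_relInt (nonempty_of_card hF3) hx
    have hz' : φ x = 0 := closure_minimal (t := {y | φ y = 0}) hz
      (isClosed_eq hφc continuous_const) hx'
    rw [hz', mul_zero]

lemma memLp_toField (hreg : interior (closure Ω) = Ω) (σ : T.BrokenTensor) (i j : Fin 3) :
    MemLp (fun x => toField σ x i j) 2 (volume.restrict Ω) :=
  T.memLp_two hreg (g := fun K x => peval x (σ K i j)) (fun K => by fun_prop)
    fun K x hx => by rw [toField_eq σ hx]; rfl

lemma memLp_brokenDiv (hreg : interior (closure Ω) = Ω) (σ : T.BrokenTensor) (i : Fin 3) :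
    MemLp (fun x => brokenDiv σ x i) 2 (volume.restrict Ω) :=
  T.memLp_two hreg (g := fun K x => peval x (dvg (σ K i))) (fun K => by fun_prop)
    fun K x hx => brokenDiv_eq σ hx i

lemma integrableOn_toField_mul (hreg : interior (closure Ω) = Ω) (σ : T.BrokenTensor) (i : Fin 3)
    {φ : E → ℝ} (hφ : ContDiff ℝ ∞ φ) :
    IntegrableOn (fun x => ∑ j, toField σ x i j * partialDeriv j φ x) Ω := by
  have hd := continuous_partialDeriv (hφ.of_le (by simp) : ContDiff ℝ 1 φ)
  exact (T.integral_eq_sum hreg (g := fun K x => ∑ j, peval x (σ K i j) * partialDeriv j φ x)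
    (fun K => by fun_prop) fun K x hx => by rw [toField_eq σ hx]; rfl).1

lemma integrableOn_brokenDiv_mul (hreg : interior (closure Ω) = Ω) (σ : T.BrokenTensor) (i : Fin 3)
    {φ : E → ℝ} (hφ : Continuous φ) : IntegrableOn (fun x => brokenDiv σ x i * φ x) Ω :=
  (T.integral_eq_sum hreg (g := fun K x => peval x (dvg (σ K i)) * φ x)
    (fun K => by fun_prop) fun K x hx => by rw [brokenDiv_eq σ hx]).1

/-- Without jumps, the elementwise divergence is the weak divergence. -/
lemma hasWeakDiv_brokenDiv (hopen : IsOpen Ω) (hreg : interior (closure Ω) = Ω) {S : Set E}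
    (hS : T.CompatibleWith S) {σ : T.BrokenTensor}
    (hσ : ∀ F ∈ T.starFaces S, ∀ x ∈ hull F, jump σ F x = 0) :
    HasWeakDiv Ω (toField σ) (brokenDiv σ) := by
  refine ⟨memLp_brokenDiv hreg σ, fun i φ hφ _ hsupp => ?_⟩
  have h := integral_brokenDiv_mul_add hopen hreg hS hσ i hφ fun x hx => by
    have h2 := hx.2
    rw [frontier, hopen.interior_eq] at h2
    exact absurd (hsupp hx.1) h2.2
  rw [integral_add (integrableOn_brokenDiv_mul hreg σ i hφ.continuous)
    (integrableOn_toField_mul hreg σ i hφ)] at h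
  linarith

end TetMesh

/-- The weak divergence is unique. -/
lemma HasWeakDiv.ae_eq {Ω : Set E} (hopen : IsOpen Ω) (hbdd : Bornology.IsBounded Ω) {τ : E → Mat}
    {g g' : E → Fin 3 → ℝ} (hg : HasWeakDiv Ω τ g) (hg' : HasWeakDiv Ω τ g') :
    g =ᵐ[volume.restrict Ω] g' := by
  have : IsFiniteMeasure (volume.restrict Ω) := ⟨by simpa using hbdd.measure_lt_top⟩
  have hint : ∀ i, IntegrableOn (fun x => g x i) Ω := fun i =>
    (hg.1 i).integrable (by norm_num)
  have hint' : ∀ i, IntegrableOn (fun x => g' x i) Ω := fun i =>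
    (hg'.1 i).integrable (by norm_num)
  have h : ∀ i, ∀ᵐ x, x ∈ Ω → g x i - g' x i = 0 := by
    intro i
    refine hopen.ae_eq_zero_of_integral_contDiff_smul_eq_zero
      ((hint i).sub (hint' i)).locallyIntegrableOn fun φ hφ hc hsupp => ?_
    have hbd : ∃ C, ∀ x, ‖φ x‖ ≤ C := hφ.continuous.bounded_above_of_compact_support hc
    obtain ⟨C, hC⟩ := hbd
    have hm := hφ.continuous.aestronglyMeasurable (μ := volume.restrict Ω)
    have e1 := (hg.2 i φ hφ hc hsupp).trans (hg'.2 i φ hφ hc hsupp).symm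
    have i1 : Integrable (fun x => g x i * φ x) (volume.restrict Ω) :=
      (hint i).mul_bdd (c := C) hm (Filter.Eventually.of_forall hC)
    have i2 : Integrable (fun x => g' x i * φ x) (volume.restrict Ω) :=
      (hint' i).mul_bdd (c := C) hm (Filter.Eventually.of_forall hC)
    rw [← setIntegral_eq_integral_of_forall_compl_eq_zero (s := Ω)]
    · have h2 : ∫ x in Ω, (g x i * φ x - g' x i * φ x) = 0 := by
        rw [integral_sub i1 i2, e1, sub_self]
      rw [← h2]
      congr 1
      funext x
      simp only [smul_eq_mul]
      ring
    · intro x hx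
      have : φ x = 0 := by
        by_contra hne
        exact hx (hsupp (subset_tsupport φ hne))
      rw [this, zero_smul]
  have h2 := ae_all_iff.2 h
  filter_upwards [(ae_restrict_iff' hopen.measurableSet).2 (h2.mono fun x hx hxΩ i => hx i hxΩ)]
    with x hx
  funext i
  exact sub_eq_zero.1 (hx i)

namespace TetMesh

variable {Ω : Set E} {T : TetMesh Ω}

lemma weakDiv_ae_eq (hopen : IsOpen Ω) (hbdd : Bornology.IsBounded Ω)
    (hreg : interior (closure Ω) = Ω) {S : Set E} (hS : T.CompatibleWith S) {σ : T.BrokenTensor}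
    (hσ : ∀ F ∈ T.starFaces S, ∀ x ∈ hull F, jump σ F x = 0) :
    weakDiv Ω (toField σ) =ᵐ[volume.restrict Ω] brokenDiv σ := by
  have hw := hasWeakDiv_brokenDiv hopen hreg hS hσ
  have hex : ∃ g, HasWeakDiv Ω (toField σ) g := ⟨_, hw⟩
  rw [weakDiv, dif_pos hex]
  exact hex.choose_spec.ae_eq hopen hbdd hw

/-- A piecewise polynomial field whose normal components match across the interior faces and
vanish on `S` lies in `W`. -/
lemma toField_mem_spaceW (hopen : IsOpen Ω) (hbdd : Bornology.IsBounded Ω)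
    (hreg : interior (closure Ω) = Ω) {S : Set E} (hS : T.CompatibleWith S) {σ : T.BrokenTensor}
    (hσ : ∀ F ∈ T.starFaces S, ∀ x ∈ hull F, jump σ F x = 0) : toField σ ∈ spaceW Ω S := by
  refine ⟨⟨memLp_toField hreg σ, _, hasWeakDiv_brokenDiv hopen hreg hS hσ⟩,
    fun i φ hφ _ hsupp => ?_⟩
  rw [← integral_brokenDiv_mul_add hopen hreg hS hσ i hφ hsupp]
  refine integral_congr_ae ?_
  filter_upwards [weakDiv_ae_eq hopen hbdd hreg hS hσ] with x hx
  rw [hx]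

lemma hdivNormSq_eq (hopen : IsOpen Ω) (hbdd : Bornology.IsBounded Ω)
    (hreg : interior (closure Ω) = Ω) {S : Set E} (hS : T.CompatibleWith S) {σ : T.BrokenTensor}
    (hσ : ∀ F ∈ T.starFaces S, ∀ x ∈ hull F, jump σ F x = 0) :
    hdivNormSq Ω (toField σ) =
      (∫ x in Ω, frobSq (toField σ x)) + ∫ x in Ω, vecSq (brokenDiv σ x) := by
  rw [hdivNormSq]
  congr 1
  refine integral_congr_ae ?_
  filter_upwards [weakDiv_ae_eq hopen hbdd hreg hS hσ] with x hx
  rw [hx]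

end TetMesh

namespace TetMesh

/-! ### The averaging projection -/

variable {Ω : Set E} {T : TetMesh Ω}

open Classical in
lemma sum_filter_of_forall_iff_eq {V : Type*} [AddCommMonoid V] {F : Finset E} {K : T.elements}
    (h : ∀ K' : T.elements, F ⊆ K'.1 ↔ K' = K) (g : T.elements → V) :
    ∑ K' : T.elements with F ⊆ K'.1, g K' = g K := by
  rw [Finset.sum_filter]
  simp [h]

open Classical in
lemma sum_filter_of_forall_iff_or {V : Type*} [AddCommMonoid V] {F : Finset E}
    {K K' : T.elements} (hne : K' ≠ K) (h : ∀ K'' : T.elements, F ⊆ K''.1 ↔ K'' = K ∨ K'' = K')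
    (g : T.elements → V) : ∑ K'' : T.elements with F ⊆ K''.1, g K'' = g K + g K' := by
  have h1 : (Finset.univ.filter fun K'' : T.elements => F ⊆ K''.1) = {K, K'} := by
    ext K''
    simp [h]
  rw [h1, Finset.sum_pair hne.symm]

lemma continuous_of_mem_nedelec {m : ℕ} (hm : 1 ≤ m) {K : Finset E} {w : E → E}
    (hw : w ∈ nedelec m K) (A : E ≃ᵃ[ℝ] E) : Continuous w := by
  obtain ⟨ŵ, -, h⟩ := exists_of_mem_nedelec hm hw A
  have h1 : w = fun y => LinearMap.adjoint (A.linear.symm : E →ₗ[ℝ] E) (evec ŵ (A.symm y)) := by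
    funext y
    rw [← h, A.apply_symm_apply]
  rw [h1]
  exact (LinearMap.continuous_of_finiteDimensional _).comp
    ((continuous_evec ŵ).comp (continuous_affineEquiv A.symm))

lemma zero_mem_nedelec (m : ℕ) {K : Finset E} {A : E ≃ᵃ[ℝ] E} (hm : 1 ≤ m)
    (hA : A '' refTet = hull K) : (fun _ => 0) ∈ nedelec m K := by
  have := mem_nedelec_of_mem_refNedelec hm hA (Submodule.zero_mem (refNedelec m))
  convert this using 2
  have h0 : ∀ x, evec 0 x = 0 := fun x => by ext i; simp
  rw [h0, map_zero]

lemma sameMoments_zero (A : E ≃ᵃ[ℝ] E) (q f : Fin 3 → Poly) : SameMoments A 0 q f := by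
  intro w hw
  rw [refNedelec_zero hw, map_zero, map_zero]

/-- The interior moments of a tensor field are the interior moments of its rows. -/
lemma forall_sameMoments_iff {m : ℕ} (hm : 1 ≤ m) (τ σ : T.BrokenTensor) (K : T.elements) :
    (∀ i, SameMoments (T.frame K) m (σ K i) (τ K i)) ↔
      ∀ w : Fin 3 → E → E, (∀ i, w i ∈ nedelec m K.1) →
        ∫ x in hull K.1, ∑ i, ∑ j, val σ K x i j * w i x j =
          ∫ x in hull K.1, ∑ i, ∑ j, val τ K x i j * w i x j := by
  have hA := (T.frame_spec K).image_refTet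
  simp_rw [sameMoments_iff hm hA]
  constructor
  · intro h w hw
    have hint : ∀ (σ : T.BrokenTensor), ∀ i ∈ Finset.univ, IntegrableOn
        (fun x => ∑ j, val σ K x i j * w i x j) (hull K.1) := by
      intro σ i _
      have hc := continuous_of_mem_nedelec hm (hw i) (T.frame K)
      have hc2 : ∀ j, Continuous fun x => val σ K x i j := fun j => continuous_peval (σ K i j)
      have : Continuous fun x => ∑ j, val σ K x i j * w i x j := by fun_prop
      exact this.continuousOn.integrableOn_compact (isCompact_hull K.1)
    rw [integral_finsetSum _ (hint σ), integral_finsetSum _ (hint τ)]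
    exact Finset.sum_congr rfl fun i _ => h i (w i) (hw i)
  · intro h i w hw
    have h1 := h (fun l => if l = i then w else fun _ => 0) fun l => by
      by_cases hl : l = i
      · simpa [hl] using hw
      · simpa [hl] using zero_mem_nedelec m hm hA
    have h2 : ∀ (σ : T.BrokenTensor) (x : E), ∑ l, ∑ j,
        val σ K x l j * (if l = i then w else fun _ => 0) x j = ∑ j, peval x (σ K i j) * w x j := by
      intro σ x
      rw [Finset.sum_eq_single i]
      · simp [val]
      · intro l _ hl
        simp [hl]
      · simp
    simp_rw [h2] at h1
    exact h1

/-- Two normal traces of polynomial tensors on a face agree if their moments do: their difference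
is itself an admissible weight. -/
lemma forall_faceMoment_eq_iff {k : ℕ} {F : Finset E} (hF : F.card = 3) {K : T.elements}
    (hK : F ⊆ K.1) {p q : Matrix (Fin 3) (Fin 3) Poly} (hp : ∀ i j, (p i j).totalDegree ≤ k)
    (hq : ∀ i j, (q i j).totalDegree ≤ k) :
    (∀ φ : Fin 3 → Poly, (∀ i, (φ i).totalDegree ≤ k) →
      faceMoment K.1 F (fun x => p.map (peval x)) φ =
        faceMoment K.1 F (fun x => q.map (peval x)) φ) ↔
    ∀ x ∈ hull F, ∀ i, inner ℝ (outwardNormal K.1 F) (evec (p i) x) =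
      inner ℝ (outwardNormal K.1 F) (evec (q i) x) := by
  set n := outwardNormal K.1 F
  have hmom : ∀ (p : Matrix (Fin 3) (Fin 3) Poly) (φ : Fin 3 → Poly),
      faceMoment K.1 F (fun x => p.map (peval x)) φ =
        ∫ x in hull F, ∑ i, inner ℝ n (evec (p i) x) * peval x (φ i)
          ∂(Measure.euclideanHausdorffMeasure 2) := by
    intro p φ
    rw [faceMoment]
    congr 1
  simp_rw [hmom]
  constructor
  · intro h x hx i
    have hf := T.mem_faces.2 ⟨K, hK, hF⟩
    -- the weight `d` is the difference of the two normal components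
    set d : Fin 3 → Poly := fun i => ∑ j, MvPolynomial.C (n j) * (p i j - q i j) with hd
    have hdeg : ∀ i, (d i).totalDegree ≤ k := fun i =>
      MvPolynomial.totalDegree_finsetSum_le fun j _ =>
        totalDegree_C_mul_le_of_le _ (totalDegree_sub_le_of_le (hp i j) (hq i j))
    have hdx : ∀ x i, peval x (d i) = inner ℝ n (evec (p i) x) - inner ℝ n (evec (q i) x) := by
      intro x i
      simp only [hd, peval_sum, peval_mul, peval_C, peval_sub, PiLp.inner_apply, evec_apply,
        ← Finset.sum_sub_distrib]
      refine Finset.sum_congr rfl fun j _ => ?_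
      simp
      ring
    have h1 := h d hdeg
    have hint : ∀ p : Matrix (Fin 3) (Fin 3) Poly, IntegrableOn
        (fun x => ∑ i, inner ℝ n (evec (p i) x) * peval x (d i)) (hull F)
        (Measure.euclideanHausdorffMeasure 2) := fun p =>
      integrableOn_hull_face hf (by fun_prop)
    rw [← sub_eq_zero, ← integral_sub (hint p) (hint q)] at h1
    simp_rw [← Finset.sum_sub_distrib, ← sub_mul, ← hdx] at h1
    obtain ⟨l, hl⟩ := (T.frame_spec K).exists_isFace hK hF
    rw [hl.hull_eq, faceHull, integral_face] at h1
    have h2 : triInt (T.frame K) l (fun x => ∑ i, peval x (d i) * peval x (d i)) = 0 :=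
      (mul_eq_zero.1 h1).resolve_left
        (mul_pos (vol_pos _) (norm_gr_pos _ _)).ne'
    rw [hl.hull_eq, faceHull, ← image_triMap] at hx
    obtain ⟨y, hy, rfl⟩ := hx
    have h3 := eq_zero_of_integral_refTri_eq_zero (by fun_prop)
      (fun y _ => Finset.sum_nonneg fun i _ => mul_self_nonneg _) h2 y hy
    have h4 := (Finset.sum_eq_zero_iff_of_nonneg fun i _ => mul_self_nonneg _).1 h3 i
      (Finset.mem_univ i)
    have h5 := mul_self_eq_zero.1 h4
    rw [hdx] at h5
    exact sub_eq_zero.1 h5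
  · intro h φ _
    have hm : MeasurableSet (hull F) := (isCompact_hull F).isClosed.measurableSet
    exact setIntegral_congr_fun hm fun x hx => by simp only [h x hx]

open Classical in
/-- The polynomials that represent the average of `τ` on a face. -/
noncomputable def meanPoly (τ : T.BrokenTensor) (F : Finset E) : Matrix (Fin 3) (Fin 3) Poly :=
  fun i j => MvPolynomial.C
    (((Finset.univ : Finset T.elements).filter fun K => F ⊆ K.1).card : ℝ)⁻¹ *
      ∑ K : T.elements with F ⊆ K.1, τ K i j

lemma mean_eq (τ : T.BrokenTensor) (F : Finset E) :
    mean τ F = fun x => (meanPoly τ F).map (peval x) := by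
  classical
  funext x
  ext i j
  simp [mean, meanPoly, val, Matrix.sum_apply]

open Classical in
/-- The polynomials whose normal components the averaging projection has on the face `F`. -/
noncomputable def faceTarget (S : Set E) (τ : T.BrokenTensor) (F : Finset E) :
    Matrix (Fin 3) (Fin 3) Poly :=
  if F ∈ T.boundaryFacesIn S then 0 else meanPoly τ F

lemma totalDegree_meanPoly_le {k : ℕ} {τ : T.BrokenTensor} (hτ : τ ∈ T.spaceWh k) (F : Finset E)
    (i j : Fin 3) : (meanPoly τ F i j).totalDegree ≤ k :=
  totalDegree_C_mul_le_of_le _ (MvPolynomial.totalDegree_finsetSum_le fun K _ => hτ K i j)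

lemma totalDegree_faceTarget_le {k : ℕ} {τ : T.BrokenTensor} (hτ : τ ∈ T.spaceWh k) (S : Set E)
    (F : Finset E) (i j : Fin 3) : (faceTarget S τ F i j).totalDegree ≤ k := by
  rw [faceTarget]
  split_ifs
  · simp
  · exact totalDegree_meanPoly_le hτ F i j

lemma meanPoly_of_forall_iff_eq {F : Finset E} {K : T.elements}
    (h : ∀ K' : T.elements, F ⊆ K'.1 ↔ K' = K) (τ : T.BrokenTensor) : meanPoly τ F = τ K := by
  classical
  ext1 i j
  rw [meanPoly, sum_filter_of_forall_iff_eq h, Finset.card_eq_sum_ones,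
    sum_filter_of_forall_iff_eq h]
  simp

lemma meanPoly_of_forall_iff_or {F : Finset E} {K K' : T.elements} (hne : K' ≠ K)
    (h : ∀ K'' : T.elements, F ⊆ K''.1 ↔ K'' = K ∨ K'' = K') (τ : T.BrokenTensor) (i j : Fin 3) :
    meanPoly τ F i j = MvPolynomial.C 2⁻¹ * (τ K i j + τ K' i j) := by
  classical
  rw [meanPoly, sum_filter_of_forall_iff_or hne h, Finset.card_eq_sum_ones,
    sum_filter_of_forall_iff_or hne h]
  norm_num

/-- The normal components of `σ` are those prescribed for the averaging projection of `τ`. -/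
def HasTargetTraces (S : Set E) (τ σ : T.BrokenTensor) : Prop :=
  ∀ (K : T.elements) (F : Finset E), F.card = 3 → F ⊆ K.1 → ∀ x ∈ hull F, ∀ i,
    inner ℝ (outwardNormal K.1 F) (evec (σ K i) x) =
      inner ℝ (outwardNormal K.1 F) (evec (faceTarget S τ F i) x)

lemma HasTargetTraces.jump_eq_zero {S : Set E} {τ σ : T.BrokenTensor} (hopen : IsOpen Ω)
    (hreg : interior (closure Ω) = Ω) (h : HasTargetTraces S τ σ) :
    ∀ F ∈ T.starFaces S, ∀ x ∈ hull F, jump σ F x = 0 := by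
  classical
  intro F hF x hx
  funext i
  obtain ⟨K, hK, hF3⟩ := T.mem_faces.1 (mem_faces_of_mem_starFaces hF)
  rw [jump_apply, Pi.zero_apply]
  rw [Finset.sum_congr rfl fun K hK => h K F hF3 (Finset.mem_filter.1 hK).2 x hx i]
  rcases T.face_cases hopen hreg hF3 hK with ⟨-, hFi, -⟩ | ⟨-, -, K', hne, hn, hiff⟩
  · have hFS := (mem_starFaces.1 hF).resolve_left hFi
    refine Finset.sum_eq_zero fun K _ => ?_
    rw [faceTarget, if_pos hFS]
    have h0 : evec ((0 : Matrix (Fin 3) (Fin 3) Poly) i) x = 0 := by ext j; simp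
    rw [h0, inner_zero_right]
  · rw [sum_filter_of_forall_iff_or hne hiff, hn, inner_neg_left, add_neg_cancel]

/-- The conditions of the averaging projection in terms of the rows of its restrictions: the
moments on the faces determine the normal components, and the conformity follows from them. -/
lemma isAveragingProjection_iff (hopen : IsOpen Ω) (hbdd : Bornology.IsBounded Ω)
    (hreg : interior (closure Ω) = Ω) {Γ S : Set E} (hΓS : Γ ∪ S = frontier Ω)
    (hdisj : Disjoint (interior (Subtype.val ⁻¹' Γ : Set (frontier Ω)))
      (interior (Subtype.val ⁻¹' S : Set (frontier Ω))))
    (hΓ : T.CompatibleWith Γ) (hS : T.CompatibleWith S) {m : ℕ} {τ σ : T.BrokenTensor}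
    (hτ : τ ∈ T.spaceWh (m + 1)) :
    IsAveragingProjection Γ S (m + 1) τ σ ↔ σ ∈ T.spaceWh (m + 1) ∧
      (∀ K i, SameMoments (T.frame K) m (σ K i) (τ K i)) ∧ HasTargetTraces S τ σ := by
  classical
  have hval : ∀ (σ : T.BrokenTensor) K, val σ K = fun x => (σ K).map (peval x) := fun _ _ => rfl
  have hzero : ∀ (K : T.elements) F φ, faceMoment K.1 F
      (fun x => (0 : Matrix (Fin 3) (Fin 3) Poly).map (peval x)) φ = 0 := by
    intro K F φ
    simp [faceMoment, Matrix.mulVec, dotProduct]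
  have htarget : ∀ F, F ∉ T.boundaryFacesIn S → faceTarget S τ F = meanPoly τ F :=
    fun F hF => if_neg hF
  have htargetS : ∀ F, F ∈ T.boundaryFacesIn S → faceTarget S τ F = 0 := fun F hF => if_pos hF
  constructor
  · intro h
    have hσ := h.mem.1
    refine ⟨hσ, fun K => ?_, fun K F hF hK => ?_⟩
    · rcases Nat.eq_zero_or_pos m with rfl | hm
      · exact fun i => sameMoments_zero _ _ _
      · exact (forall_sameMoments_iff hm τ σ K).2 (h.on_element (by omega) K)
    · refine (forall_faceMoment_eq_iff hF hK (hσ K) (totalDegree_faceTarget_le hτ S F)).1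
        fun φ hφ => ?_
      rcases T.face_cases hopen hreg hF hK with ⟨hFb, -, hiff⟩ | ⟨hFi, hFb, -⟩
      · by_cases hFS : F ∈ T.boundaryFacesIn S
        · rw [htargetS F hFS, hzero]
          exact h.on_S F hFS K hK φ hφ
        · have hFΓ := (T.mem_boundaryFacesIn_or hΓS hΓ hS hFb).resolve_right hFS
          rw [htarget F hFS, meanPoly_of_forall_iff_eq hiff]
          exact h.on_Γ F hFΓ K hK φ hφ
      · rw [htarget F fun h => hFb (T.mem_boundaryFacesIn.1 h).1, ← mean_eq]
        exact h.on_interior F hFi K hK φ hφ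
  · rintro ⟨hσ, hmom, htr⟩
    have hface : ∀ (K : T.elements) F, F.card = 3 → F ⊆ K.1 → ∀ φ : Fin 3 → Poly,
        (∀ i, (φ i).totalDegree ≤ m + 1) → faceMoment K.1 F (val σ K) φ =
          faceMoment K.1 F (fun x => (faceTarget S τ F).map (peval x)) φ := fun K F hF hK =>
      (forall_faceMoment_eq_iff hF hK (hσ K) (totalDegree_faceTarget_le hτ S F)).2 (htr K F hF hK)
    have hcard : ∀ F ∈ T.faces, F.card = 3 := fun F hF => by
      obtain ⟨-, -, h⟩ := T.mem_faces.1 hF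
      exact h
    have hcardb : ∀ Z, ∀ F ∈ T.boundaryFacesIn Z, F.card = 3 := fun Z F hF =>
      hcard F (T.mem_boundaryFaces.1 (T.mem_boundaryFacesIn.1 hF).1).1
    refine ⟨⟨hσ, toField_mem_spaceW hopen hbdd hreg hS (htr.jump_eq_zero hopen hreg)⟩, ?_, ?_, ?_,
      ?_⟩
    · intro F hF K hK φ hφ
      rw [hface K F (hcardb Γ F hF) hK φ hφ,
        htarget F (T.notMem_boundaryFacesIn hΓS hdisj hΓ hS hF)]
      rcases T.face_cases hopen hreg (hcardb Γ F hF) hK with ⟨-, -, hiff⟩ | ⟨-, hFb, -⟩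
      · rw [meanPoly_of_forall_iff_eq hiff, hval]
      · exact absurd (T.mem_boundaryFacesIn.1 hF).1 hFb
    · intro F hF K hK φ hφ
      rw [hface K F (hcardb S F hF) hK φ hφ, htargetS F hF, hzero]
    · intro F hF K hK φ hφ
      have hF3 := (T.mem_interiorFaces.1 hF).1
      rw [hface K F hF3 hK φ hφ, htarget F, mean_eq]
      intro hFS
      rcases T.face_cases hopen hreg hF3 hK with ⟨-, hFi, -⟩ | ⟨-, hFb, -⟩
      · exact hFi hF
      · exact hFb (T.mem_boundaryFacesIn.1 hFS).1
    · intro hk K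
      exact (forall_sameMoments_iff (by omega) τ σ K).1 (hmom K)

/-- The prescribed moments and normal components determine a piecewise polynomial tensor. -/
lemma existsUnique_hasTargetTraces (S : Set E) {m : ℕ} {τ : T.BrokenTensor}
    (hτ : τ ∈ T.spaceWh (m + 1)) : ∃! σ : T.BrokenTensor, σ ∈ T.spaceWh (m + 1) ∧
      (∀ K i, SameMoments (T.frame K) m (σ K i) (τ K i)) ∧ HasTargetTraces S τ σ := by
  choose F hF using fun (K : T.elements) i => (T.frame_spec K).isFace_image i
  have hex : ∀ (K : T.elements) (i : Fin 3), ∃ q ∈ polyV (m + 1),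
      SameMoments (T.frame K) m q (τ K i) ∧ ∀ l, ∀ x ∈ faceHull (T.frame K) l,
        inner ℝ (normal (T.frame K) l) (evec q x) =
          peval x (∑ j, MvPolynomial.C (normal (T.frame K) l j) * faceTarget S τ (F K l) i j) :=
    fun K i => exists_interpolant (T.frame K) (fun l => MvPolynomial.totalDegree_finsetSum_le
      fun j _ => totalDegree_C_mul_le_of_le _ (totalDegree_faceTarget_le hτ S _ i j)) (τ K i)
  choose q hq hqm hqt using hex
  refine ⟨fun K => Matrix.of (q K), ⟨fun K i j => mem_polyV.1 (hq K i) j, hqm, ?_⟩, ?_⟩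
  · intro K G hG hGK x hx i
    obtain ⟨l, hl⟩ := (T.frame_spec K).exists_isFace hGK hG
    have hGF : G = F K l := Finset.coe_injective (by rw [(hF K l).2.2, hl])
    rw [outwardNormal_eq (T.frame_spec K) hl]
    rw [hl.hull_eq] at hx
    have h1 := hqt K i l x hx
    rw [← hGF] at h1
    refine h1.trans ?_
    simp only [peval_sum, peval_mul, peval_C, PiLp.inner_apply, evec_apply]
    refine Finset.sum_congr rfl fun j _ => ?_
    simp [mul_comm]
  · rintro σ ⟨hσ, hσm, hσt⟩
    funext K i
    refine eq_of_normal_eq (T.frame K) (mem_polyV.2 (hσ K i)) (hq K i)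
      (fun w hw => (hσm K i w hw).trans (hqm K i w hw).symm) fun l x hx => ?_
    have h1 := hqt K i l x hx
    have h2 := hσt K (F K l) (hF K l).2.1 (hF K l).1 x
      (by rw [(hF K l).2.2.hull_eq]; exact hx) i
    rw [outwardNormal_eq (T.frame_spec K) (hF K l).2.2] at h2
    rw [h2]
    refine Eq.trans ?_ h1.symm
    simp only [peval_sum, peval_mul, peval_C, PiLp.inner_apply, evec_apply]
    refine Finset.sum_congr rfl fun j _ => ?_
    simp [mul_comm]

end TetMesh

/-! ### The distance to the averaging projection -/

lemma SameMoments.sub {A : E ≃ᵃ[ℝ] E} {m : ℕ} {q f : Fin 3 → Poly} (h : SameMoments A m q f) :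
    SameMoments A m (f - q) 0 := by
  intro w hw
  rw [map_sub, map_zero, map_sub, map_zero, LinearMap.sub_apply, LinearMap.zero_apply, h w hw,
    sub_self]

namespace TetMesh

variable {Ω : Set E} {T : TetMesh Ω}

/-- The squared `L²` norm of a piecewise polynomial tensor and of its elementwise divergence. -/
noncomputable def brokenNormSq (τ : T.BrokenTensor) : ℝ :=
  ∑ K : T.elements, ∑ i, ((∫ x in hull K.1, ‖evec (τ K i) x‖ ^ 2) +
    ∫ x in hull K.1, peval x (dvg (τ K i)) ^ 2)

lemma integrableOn_hull (K : Finset E) {f : E → ℝ} (hf : Continuous f) : IntegrableOn f (hull K) :=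
  hf.continuousOn.integrableOn_compact (isCompact_hull K)

lemma integral_add_integral_eq_brokenNormSq (hreg : interior (closure Ω) = Ω)
    (τ : T.BrokenTensor) :
    (∫ x in Ω, frobSq (toField τ x)) + ∫ x in Ω, vecSq (brokenDiv τ x) = brokenNormSq τ := by
  rw [integral_frobSq_toField hreg, integral_vecSq_brokenDiv hreg, ← Finset.sum_add_distrib]
  refine Finset.sum_congr rfl fun K _ => ?_
  rw [Finset.sum_add_distrib, integral_finsetSum _ fun i _ => integrableOn_hull _ (by fun_prop),
    integral_finsetSum _ fun i _ => integrableOn_hull _ (by fun_prop)]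

lemma brokenNormSq_nonneg (τ : T.BrokenTensor) : 0 ≤ brokenNormSq τ :=
  Finset.sum_nonneg fun _ _ => Finset.sum_nonneg fun _ _ =>
    add_nonneg (integral_nonneg fun _ => sq_nonneg _) (integral_nonneg fun _ => sq_nonneg _)

lemma evec_sub (p q : Fin 3 → Poly) (x : E) : evec (p - q) x = evec p x - evec q x := by
  ext i
  simp

lemma brokenNormSq_sub_comm (τ σ : T.BrokenTensor) :
    brokenNormSq (τ - σ) = brokenNormSq (σ - τ) := by
  refine Finset.sum_congr rfl fun K _ => Finset.sum_congr rfl fun i _ => ?_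
  have h1 : ∀ τ σ : T.BrokenTensor, (τ - σ) K i = τ K i - σ K i := fun _ _ => rfl
  rw [h1, h1]
  congr 2
  · funext x
    rw [evec_sub, evec_sub, norm_sub_rev]
  · funext x
    rw [map_sub, map_sub, peval_sub, peval_sub]
    ring

lemma brokenNormSq_le (τ σ : T.BrokenTensor) :
    brokenNormSq τ ≤ 2 * brokenNormSq σ + 2 * brokenNormSq (τ - σ) := by
  simp only [brokenNormSq, Finset.mul_sum, ← Finset.sum_add_distrib]
  refine Finset.sum_le_sum fun K _ => Finset.sum_le_sum fun i _ => ?_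
  have h1 : (τ - σ) K i = τ K i - σ K i := rfl
  have e1 : ∫ x in hull K.1, ‖evec (τ K i) x‖ ^ 2 ≤ 2 * (∫ x in hull K.1, ‖evec (σ K i) x‖ ^ 2) +
      2 * ∫ x in hull K.1, ‖evec ((τ - σ) K i) x‖ ^ 2 := by
    rw [← integral_const_mul, ← integral_const_mul, ← integral_add
      (integrableOn_hull _ (by fun_prop)) (integrableOn_hull _ (by fun_prop))]
    refine integral_mono (integrableOn_hull _ (by fun_prop)) (integrableOn_hull _ (by fun_prop))
      fun x => ?_
    simp only [h1, evec_sub]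
    have h2 := norm_add_le (evec (σ K i) x) (evec (τ K i) x - evec (σ K i) x)
    rw [add_sub_cancel] at h2
    have h3 := pow_le_pow_left₀ (norm_nonneg _) h2 2
    nlinarith [sq_nonneg (‖evec (σ K i) x‖ - ‖evec (τ K i) x - evec (σ K i) x‖)]
  have e2 : ∫ x in hull K.1, peval x (dvg (τ K i)) ^ 2 ≤
      2 * (∫ x in hull K.1, peval x (dvg (σ K i)) ^ 2) +
      2 * ∫ x in hull K.1, peval x (dvg ((τ - σ) K i)) ^ 2 := by
    rw [← integral_const_mul, ← integral_const_mul, ← integral_add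
      (integrableOn_hull _ (by fun_prop)) (integrableOn_hull _ (by fun_prop))]
    refine integral_mono (integrableOn_hull _ (by fun_prop)) (integrableOn_hull _ (by fun_prop))
      fun x => ?_
    simp only [h1, map_sub, peval_sub]
    nlinarith [sq_nonneg (peval x (dvg (τ K i)) - 2 * peval x (dvg (σ K i)))]
  linarith

lemma norm_linear_single_le_diam (K : T.elements) (j : Fin 3) :
    ‖(T.frame K).linear (EuclideanSpace.single j 1)‖ ≤ Metric.diam (hull K.1) := by
  have h1 := map_sub_eq (T.frame K) (refVert j.succ) (refVert 0)
  have h2 : refVert j.succ - refVert 0 = EuclideanSpace.single j (1 : ℝ) := by simp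
  rw [h2] at h1
  rw [← h1, ← dist_eq_norm]
  exact Metric.dist_le_diam_of_mem (isCompact_hull K.1).isBounded
    (subset_convexHull ℝ _ ((T.frame_spec K).vertex_mem _))
    (subset_convexHull ℝ _ ((T.frame_spec K).vertex_mem _))

lemma diam_face_pos {F : Finset E} (hF : F.card = 3) : 0 < Metric.diam (hull F) := by
  obtain ⟨a, ha, b, hb, hab⟩ := Finset.one_lt_card.1 (by omega : 1 < F.card)
  exact (dist_pos.2 hab).trans_le (Metric.dist_le_diam_of_mem (isCompact_hull F).isBounded
    (subset_convexHull ℝ _ ha) (subset_convexHull ℝ _ hb))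

lemma ShapeRegular.nonneg {ρ : ℝ} (hT : T.ShapeRegular ρ) (K : T.elements) : 0 ≤ ρ := by
  obtain ⟨x, r, hr, -, h⟩ := hT K.1 K.2
  have := Metric.diam_nonneg (s := hull K.1)
  by_contra hρ
  push Not at hρ
  nlinarith

/-- On a shape regular tetrahedron the heights are comparable to the diameters of the faces. -/
lemma ShapeRegular.norm_gr_le {ρ : ℝ} (hT : T.ShapeRegular ρ) {K : T.elements} {F : Finset E}
    (hF : F.card = 3) (hK : F ⊆ K.1) (i : Fin 4) :
    ‖gr (T.frame K) i‖ ≤ ρ * (Metric.diam (hull F))⁻¹ := by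
  have hρ := hT.nonneg K
  obtain ⟨x, r, hr, hb, h⟩ := hT K.1 K.2
  rw [← (T.frame_spec K).image_refTet] at hb
  have h1 := DGElasticity.norm_gr_le (T.frame K) i hr hb
  have h2 : Metric.diam (hull F) ≤ Metric.diam (hull K.1) :=
    Metric.diam_mono (hull_mono hK) (isCompact_hull K.1).isBounded
  have hg := norm_gr_pos (T.frame K) i
  rw [← div_eq_mul_inv, le_div_iff₀ (diam_face_pos hF)]
  calc ‖gr (T.frame K) i‖ * Metric.diam (hull F)
      ≤ ‖gr (T.frame K) i‖ * (ρ * (2 * r)) :=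
        mul_le_mul_of_nonneg_left (h2.trans h) hg.le
    _ = ρ * (‖gr (T.frame K) i‖ * (2 * r)) := by ring
    _ ≤ ρ * 1 := mul_le_mul_of_nonneg_left h1 hρ
    _ = ρ := mul_one ρ

open Classical in
/-- The normal components of the difference between `τ` and a field with the traces prescribed for
its averaging projection are half the jump of `τ` on both sides of an interior face, the jump on
the faces on `S`, and zero on the other faces. -/
lemma HasTargetTraces.sum_sq_le {S : Set E} {τ σ : T.BrokenTensor} (hopen : IsOpen Ω)
    (hreg : interior (closure Ω) = Ω) (h : HasTargetTraces S τ σ) {F : Finset E} (hF : F ∈ T.faces)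
    {x : E} (hx : x ∈ hull F) :
    ∑ K : T.elements with F ⊆ K.1, ∑ i, inner ℝ (outwardNormal K.1 F) (evec ((τ - σ) K i) x) ^ 2 ≤
      if F ∈ T.starFaces S then vecSq (jump τ F x) else 0 := by
  obtain ⟨K, hK, hF3⟩ := T.mem_faces.1 hF
  have hd : ∀ (K : T.elements) i, F ⊆ K.1 →
      inner ℝ (outwardNormal K.1 F) (evec ((τ - σ) K i) x) =
      inner ℝ (outwardNormal K.1 F) (evec (τ K i) x) -
        inner ℝ (outwardNormal K.1 F) (evec (faceTarget S τ F i) x) := by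
    intro K i hK
    rw [← h K F hF3 hK x hx i, ← inner_sub_right, ← evec_sub]
    rfl
  rcases T.face_cases hopen hreg hF3 hK with ⟨hFb, hFi, hiff⟩ | ⟨hFi, hFb, K', hne, hn, hiff⟩
  · rw [sum_filter_of_forall_iff_eq hiff]
    simp_rw [hd K _ hK]
    by_cases hFS : F ∈ T.boundaryFacesIn S
    · rw [if_pos (mem_starFaces.2 (Or.inr hFS)), vecSq]
      refine (Finset.sum_congr rfl fun i _ => ?_).le
      have h0 : evec ((0 : Matrix (Fin 3) (Fin 3) Poly) i) x = 0 := by ext j; simp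
      rw [faceTarget, if_pos hFS, h0, inner_zero_right, sub_zero, jump_apply,
        sum_filter_of_forall_iff_eq hiff]
    · rw [if_neg fun h => (mem_starFaces.1 h).elim hFi hFS, faceTarget, if_neg hFS,
        meanPoly_of_forall_iff_eq hiff]
      simp
  · rw [if_pos (mem_starFaces.2 (Or.inl hFi)), sum_filter_of_forall_iff_or hne hiff, vecSq,
      ← Finset.sum_add_distrib]
    refine Finset.sum_le_sum fun i _ => ?_
    have hFS : F ∉ T.boundaryFacesIn S := fun h => hFb (T.mem_boundaryFacesIn.1 h).1
    have hm : evec (faceTarget S τ F i) x =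
        (2⁻¹ : ℝ) • (evec (τ K i) x + evec (τ K' i) x) := by
      ext j
      simp [faceTarget, if_neg hFS, meanPoly_of_forall_iff_or hne hiff, mul_add]
    rw [hd K i hK, hd K' i ((hiff K').2 (Or.inr rfl)), hn, jump_apply,
      sum_filter_of_forall_iff_or hne hiff, hn, hm]
    simp only [inner_neg_left, inner_smul_right, inner_add_right]
    nlinarith [sq_nonneg (inner ℝ (outwardNormal K.1 F) (evec (τ K i) x) -
      inner ℝ (outwardNormal K.1 F) (evec (τ K' i) x))]

lemma continuous_vecSq_jump (τ : T.BrokenTensor) (F : Finset E) :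
    Continuous fun x => vecSq (jump τ F x) := by
  classical
  simp_rw [vecSq, jump_apply]
  fun_prop

lemma jumpNormSq_nonneg (S : Set E) (τ : T.BrokenTensor) : 0 ≤ jumpNormSq S τ :=
  Finset.sum_nonneg fun _ _ => integral_nonneg fun _ =>
    mul_nonneg (inv_nonneg.2 Metric.diam_nonneg) (Finset.sum_nonneg fun _ _ => sq_nonneg _)

/-- The sum over all tetrahedra of the face terms in the bound for fields without interior
moments is controlled by the jumps. -/
lemma sum_gr_mul_integral_le {ρ : ℝ} (hT : T.ShapeRegular ρ) {S : Set E} {τ σ : T.BrokenTensor}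
    (hopen : IsOpen Ω) (hreg : interior (closure Ω) = Ω) (h : HasTargetTraces S τ σ) :
    ∑ K : T.elements, ∑ i, ∑ l, ‖gr (T.frame K) l‖ * ∫ x in faceHull (T.frame K) l,
      inner ℝ (normal (T.frame K) l) (evec ((τ - σ) K i) x) ^ 2
        ∂(Measure.euclideanHausdorffMeasure 2) ≤ |ρ| * jumpNormSq S τ := by
  classical
  set a : T.elements → Finset E → E → ℝ := fun K F x =>
    ∑ i, inner ℝ (outwardNormal K.1 F) (evec ((τ - σ) K i) x) ^ 2 with ha
  have hac : ∀ K F, Continuous (a K F) := fun K F => by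
    simp only [ha]
    fun_prop
  have h1 : ∀ K : T.elements, ∑ i, ∑ l, ‖gr (T.frame K) l‖ * ∫ x in faceHull (T.frame K) l,
      inner ℝ (normal (T.frame K) l) (evec ((τ - σ) K i) x) ^ 2
        ∂(Measure.euclideanHausdorffMeasure 2) ≤
      ∑ F ∈ T.faces with F ⊆ K.1, |ρ| * (Metric.diam (hull F))⁻¹ *
        ∫ x in hull F, a K F x ∂(Measure.euclideanHausdorffMeasure 2) := by
    intro K
    have hK := T.frame_spec K
    choose F hF using fun l => hK.isFace_image l
    rw [Finset.sum_comm, sum_faces_eq K (g' := fun l => |ρ| * (Metric.diam (hull (F l)))⁻¹ *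
        ∫ x in hull (F l), a K (F l) x ∂(Measure.euclideanHausdorffMeasure 2))]
    · refine Finset.sum_le_sum fun l _ => ?_
      rw [← Finset.mul_sum, (hF l).2.2.hull_eq]
      have h2 : ∫ x in faceHull (T.frame K) l, a K (F l) x ∂(Measure.euclideanHausdorffMeasure 2) =
          ∑ i, ∫ x in faceHull (T.frame K) l,
            inner ℝ (normal (T.frame K) l) (evec ((τ - σ) K i) x) ^ 2
            ∂(Measure.euclideanHausdorffMeasure 2) := by
        simp only [ha]
        rw [outwardNormal_eq hK (hF l).2.2]
        exact integral_finsetSum _ fun i _ => integrableOn_face _ _ (by fun_prop)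
      rw [h2, ← (hF l).2.2.hull_eq, abs_of_nonneg (hT.nonneg K)]
      exact mul_le_mul_of_nonneg_right (hT.norm_gr_le (hF l).2.1 (hF l).1 l)
        (Finset.sum_nonneg fun i _ => integral_nonneg fun x => sq_nonneg _)
    · intro l G hG _
      have : G = F l := Finset.coe_injective (by rw [(hF l).2.2, hG])
      rw [this]
  refine (Finset.sum_le_sum fun K _ => h1 K).trans ?_
  rw [sum_elements_sum_faces]
  have h2 : ∀ F ∈ T.faces, ∑ K : T.elements with F ⊆ K.1, |ρ| * (Metric.diam (hull F))⁻¹ *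
        ∫ x in hull F, a K F x ∂(Measure.euclideanHausdorffMeasure 2) ≤
      if F ∈ T.starFaces S then |ρ| * ∫ x in hull F, (Metric.diam (hull F))⁻¹ *
        vecSq (jump τ F x) ∂(Measure.euclideanHausdorffMeasure 2) else 0 := by
    intro F hF
    have hm : MeasurableSet (hull F) := (isCompact_hull F).isClosed.measurableSet
    rw [← Finset.mul_sum, ← integral_finsetSum _ fun K _ => integrableOn_hull_face hF (hac K F)]
    have h3 : ∫ x in hull F, ∑ K : T.elements with F ⊆ K.1, a K F x
        ∂(Measure.euclideanHausdorffMeasure 2) ≤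
        ∫ x in hull F, (if F ∈ T.starFaces S then vecSq (jump τ F x) else 0)
          ∂(Measure.euclideanHausdorffMeasure 2) := by
      refine setIntegral_mono_on (integrableOn_hull_face hF
        (continuous_finsetSum _ fun K _ => hac K F)) (integrableOn_hull_face hF ?_) hm
        fun x hx => h.sum_sq_le hopen hreg hF hx
      split_ifs
      exacts [continuous_vecSq_jump τ F, continuous_const]
    refine (mul_le_mul_of_nonneg_left h3
      (mul_nonneg (abs_nonneg ρ) (inv_nonneg.2 Metric.diam_nonneg))).trans ?_
    split_ifs
    · rw [integral_const_mul, mul_assoc]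
    · simp
  refine (Finset.sum_le_sum h2).trans ?_
  rw [← Finset.sum_filter, jumpNormSq, Finset.mul_sum]
  refine Finset.sum_le_sum_of_subset_of_nonneg (fun F hF => (Finset.mem_filter.1 hF).2)
    fun F _ _ => mul_nonneg (abs_nonneg ρ) (integral_nonneg fun _ =>
      mul_nonneg (inv_nonneg.2 Metric.diam_nonneg) (Finset.sum_nonneg fun _ _ => sq_nonneg _))

/-- The distance to the averaging projection is bounded by the jumps, with a constant that depends
on the mesh through its shape regularity only. -/
lemma exists_brokenNormSq_sub_le (hopen : IsOpen Ω) (hbdd : Bornology.IsBounded Ω)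
    (hreg : interior (closure Ω) = Ω) (S : Set E) (m : ℕ) (ρ : ℝ) :
    ∃ M : ℝ, 0 ≤ M ∧ ∀ T : TetMesh Ω, T.ShapeRegular ρ → ∀ τ ∈ T.spaceWh (m + 1),
      ∀ σ ∈ T.spaceWh (m + 1), (∀ K i, SameMoments (T.frame K) m (σ K i) (τ K i)) →
        HasTargetTraces S τ σ → brokenNormSq (τ - σ) ≤ M * jumpNormSq S τ := by
  obtain ⟨C, hC, hbound⟩ := exists_bound m
  -- the factor `R ^ 2` bounds the squared mesh size in the `L²` estimate
  set R := Metric.diam (closure Ω)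
  -- for `ρ < 0` there are no tetrahedra; the absolute value keeps the constant nonnegative
  refine ⟨C * (R ^ 2 + 1) * |ρ|, by positivity, fun T hT τ hτ σ hσ hmom htr => ?_⟩
  rw [mul_assoc _ |ρ|]
  refine le_trans ?_ (mul_le_mul_of_nonneg_left (sum_gr_mul_integral_le hT hopen hreg htr)
    (by positivity))
  rw [brokenNormSq, Finset.mul_sum]
  refine Finset.sum_le_sum fun K _ => ?_
  rw [Finset.mul_sum]
  refine Finset.sum_le_sum fun i _ => ?_
  have hD : Metric.diam (hull K.1) ≤ R :=
    Metric.diam_mono (T.hull_subset_closure K) hbdd.closure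
  have h := hbound (T.frame K) ((τ - σ) K i) R
    (Submodule.sub_mem _ (mem_polyV.2 (hτ K i)) (mem_polyV.2 (hσ K i))) (hmom K i).sub
    fun j => (norm_linear_single_le_diam K j).trans hD
  rw [(T.frame_spec K).image_refTet] at h
  linarith [h.1, h.2]

end TetMesh

end DGElasticity

theorem mainTheorem6
    (Ω : Set DGElasticity.E) (hopen : IsOpen Ω) (hbdd : Bornology.IsBounded Ω)
    (hreg : interior (closure Ω) = Ω)
    (Γ S : Set DGElasticity.E) (hΓS : Γ ∪ S = frontier Ω)
    (hdisj : Disjoint (interior (Subtype.val ⁻¹' Γ : Set (frontier Ω)))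
      (interior (Subtype.val ⁻¹' S : Set (frontier Ω))))
    (k : ℕ) (hk : 1 ≤ k) (ρ : ℝ) :
    ∃ c C : ℝ, 0 < c ∧ 0 < C ∧
      ∀ T : DGElasticity.TetMesh Ω, T.ShapeRegular ρ → T.CompatibleWith Γ → T.CompatibleWith S →
        ∀ τ ∈ T.spaceWh k,
          (∃! σ : T.BrokenTensor, DGElasticity.TetMesh.IsAveragingProjection Γ S k τ σ) ∧
          ∀ σ : T.BrokenTensor, DGElasticity.TetMesh.IsAveragingProjection Γ S k τ σ →
            c * DGElasticity.TetMesh.dgNorm S τ ≤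
                √(DGElasticity.hdivNormSq Ω (DGElasticity.TetMesh.toField σ) +
                  DGElasticity.TetMesh.jumpNormSq S τ) ∧
            √(DGElasticity.hdivNormSq Ω (DGElasticity.TetMesh.toField σ) +
                DGElasticity.TetMesh.jumpNormSq S τ) ≤
              C * DGElasticity.TetMesh.dgNorm S τ := by
  obtain ⟨m, rfl⟩ : ∃ m, k = m + 1 := ⟨k - 1, by omega⟩
  obtain ⟨M, hM, hbound⟩ :=
    DGElasticity.TetMesh.exists_brokenNormSq_sub_le hopen hbdd hreg S m ρ
  -- with `N` the squared broken norm and `J` the jumps, `N τ + J` and `N σ + J` differ at most by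
  -- the factor `2 M + 2`, as `N (τ - σ) ≤ M J`
  set L : ℝ := 2 * M + 2 with hL
  have hL0 : 0 < √L := Real.sqrt_pos.2 (by linarith)
  refine ⟨(√L)⁻¹, √L, inv_pos.2 hL0, hL0, fun T hT hΓ hS τ hτ => ?_⟩
  have hiff := fun σ : T.BrokenTensor =>
    DGElasticity.TetMesh.isAveragingProjection_iff hopen hbdd hreg hΓS hdisj hΓ hS (σ := σ) hτ
  simp_rw [hiff]
  refine ⟨DGElasticity.TetMesh.existsUnique_hasTargetTraces S hτ, ?_⟩
  rintro σ ⟨hσ, hmom, htr⟩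
  have h1 := hbound T hT τ hτ σ hσ hmom htr
  have h2 := DGElasticity.TetMesh.brokenNormSq_le τ σ
  have h3 := DGElasticity.TetMesh.brokenNormSq_le σ τ
  rw [DGElasticity.TetMesh.brokenNormSq_sub_comm] at h3
  have hJ := DGElasticity.TetMesh.jumpNormSq_nonneg S τ
  have hNσ := DGElasticity.TetMesh.brokenNormSq_nonneg σ
  have hNτ := DGElasticity.TetMesh.brokenNormSq_nonneg τ
  have hdg : DGElasticity.TetMesh.dgNorm S τ = √(DGElasticity.TetMesh.brokenNormSq τ +
      DGElasticity.TetMesh.jumpNormSq S τ) := by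
    rw [DGElasticity.TetMesh.dgNorm,
      ← DGElasticity.TetMesh.integral_add_integral_eq_brokenNormSq hreg]
    congr 1
    ring
  rw [hdg, DGElasticity.TetMesh.hdivNormSq_eq hopen hbdd hreg hS (htr.jump_eq_zero hopen hreg),
    DGElasticity.TetMesh.integral_add_integral_eq_brokenNormSq hreg]
  have hMσ := mul_nonneg hM hNσ
  have hMτ := mul_nonneg hM hNτ
  constructor
  · rw [inv_mul_le_iff₀ hL0, ← Real.sqrt_mul (by linarith)]
    refine Real.sqrt_le_sqrt ?_
    rw [hL]
    nlinarith
  · rw [← Real.sqrt_mul (by linarith)]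
    refine Real.sqrt_le_sqrt ?_
    rw [hL]
    nlinarith
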